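/- Let $d\ge 2$, let $\mathcal E=\{\pm e_1,\dots,\pm e_d\}$ be the unit vectors of $\mathbb Z^d$, and let $\gamma^1\neq\gamma^2$ be two probability measures on $\mathcal E$ (no ellipticity is assumed). For $p\in[0,1]$ let $\nu_p$ be the law of the i.i.d. environment $\omega=(\omega_x)_{x\in\mathbb Z^d}$ with $\nu_p(\omega_x=\gamma^1)=p$ and $\nu_p(\omega_x=\gamma^2)=1-p$. Given $\omega$, let $\mathbb P_\omega$ be the law of the Markov chain $(X_n)_{n\ge 0}$ on $\mathbb Z^d$ with $X_0=0$ and transition probabilities $p_\omega(x,x+e)=\omega_x(e)$, $e\in\mathcal E$, and let $P_p(X\in A,\ \omega\in B)=\int_B\mathbb P_\omega(A)\,d\nu_p(\omega)$ be the joint (annealed) law of the environment and the walk. Put $E^i=\{e\in\mathcal E:\gamma^i(e)>0\}$, let $u_i=\sum_{e\in\mathcal E}\gamma^i(e)\,e\in\mathbb R^d$ be the local drift of $\gamma^i$, let $N_n=\#\{0\le m<n:\omega_{X_m}=\gamma^1\}$, and write $x^{[j]}$ for the $j$-th coordinate of a vector $x$. **Coupling.** There is a probability space carrying, for all $p\in[0,1]$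 simultaneously, pairs $(\omega[p],X[p])$ such that $(\omega[p],X[p])$ has law $P_p$ for each $p$, and such that for each $p\in[0,1]$ the (possibly random) limit $V[p]=\lim_{n\to\infty}n^{-1}X_n[p]$ exists almost surely, and for all $0\le p<p'\le 1$ the following hold, where $N_n[p]$ is computed from $(\omega[p],X[p])$: 1. almost surely, $N_n[p']\ge N_n[p]$ for every $n\ge 0$; 2. for every $e\in E^1\setminus E^2$ with $-e\notin E^1$, almost surely $X_n[p']\cdot e\ge X_n[p]\cdot e$ for every $n\ge 0$; 3. if $u_1^{[1]}>u_2^{[1]}$ then, almost surely, $X_n^{[1]}[p']\ge X_n^{[1]}[p]$ for infinitely many $n$; 4. for every $u\in\mathbb R^d\setminus\{0\}$: if $(u_1-u_2)\cdot u\ge 0$ then $V[p']\cdot u\ge V[p]\cdot u$ almost surely, and if $(u_1-u_2)\cdot u\le 0$ then $V[p']\cdot u\le V[p]\cdot u$ almost surely. **Deterministic speeds.** Let $S\subseteq[0,1]$ (for instance $S=(0,1)$ or $S=[0,1]$) and suppose that for every $p\in S$ there is a deterministic $v[p]\in\mathbb R^d$ with $P_p\big(\lim_{n\to\infty}n^{-1}X_n=v[p]\big)=1$.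 Then for each $j\in\{1,\dots,d\}$ the coordinate $v^{[j]}[p]$ is a monotone (non-decreasing or non-increasing) function of $p\in S$. -/

import Mathlib

open MeasureTheory ProbabilityTheory Filter Topology

noncomputable section

namespace RWRE

/-- Sites of the lattice `ℤ^d`. -/
abbrev Site (d : ℕ) : Type := Fin d → ℤ

/-- The set `{± e_i : i = 1, …, d}` of unit vectors of `ℤ^d`. -/
def unitVectors (d : ℕ) : Finset (Site d) :=
  Finset.univ.image (fun i : Fin d => (Pi.single i (1 : ℤ) : Site d)) ∪
    Finset.univ.image (fun i : Fin d => (Pi.single i (-1 : ℤ) : Site d))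

/-- A nearest-neighbour step. -/
abbrev Step (d : ℕ) : Type := {e : Site d // e ∈ unitVectors d}

/-- Probability measures on the set of unit vectors (with the σ-algebra generated by the
evaluations). -/
abbrev LocalEnv (d : ℕ) : Type := ProbabilityMeasure (Step d)

/-- Environments `ω = (ω_x)` (with the product σ-algebra). -/
abbrev Env (d : ℕ) : Type := Site d → LocalEnv d

/-- The probability `γ(e)` that `γ` gives to `e` (it is `0` if `e` is not a unit vector). -/
def prob {d : ℕ} (γ : LocalEnv d) (e : Site d) : ℝ :=
  (γ : Measure (Step d)).real {s | (s : Site d) = e}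

/-- The set of available directions `E = {e : γ(e) > 0}`. -/
def directions {d : ℕ} (γ : LocalEnv d) : Set (Site d) := {e | 0 < prob γ e}

/-- A lattice site, seen as a vector of `ℝ^d`. -/
def toReal {d : ℕ} (x : Site d) : Fin d → ℝ := fun i => (x i : ℝ)

/-- The local drift `u = ∑_e γ(e) e`. -/
def drift {d : ℕ} (γ : LocalEnv d) : Fin d → ℝ :=
  ∑ e ∈ unitVectors d, prob γ e • toReal e

/-- The law of a single step of the walk located at `z.2` in the environment `z.1`. -/
def stepKernel (d : ℕ) : Kernel (Env d × Site d) (Step d) where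
  toFun z := (z.1 z.2 : Measure (Step d))
  measurable' := by
    refine measurable_subtype_coe.comp ?_
    exact measurable_from_prod_countable_left fun x => measurable_pi_apply x

instance (d : ℕ) : IsMarkovKernel (stepKernel d) where
  isProbabilityMeasure z := inferInstanceAs (IsProbabilityMeasure (z.1 z.2 : Measure (Step d)))

/-- The transition kernel of the walk, with the (unchanging) environment carried along:
from `(ω, x)` move to `(ω, x + e)` with probability `ω_x(e)`. -/
def transition (d : ℕ) : Kernel (Env d × Site d) (Env d × Site d) :=
  (Kernel.id ×ₖ stepKernel d).map (fun q => (q.1.1, q.1.2 + (q.2 : Site d)))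

instance (d : ℕ) : IsMarkovKernel (transition d) :=
  Kernel.IsMarkovKernel.map _ (by fun_prop)

/-- The quenched law `P_ω` on trajectories: the law of the time-homogeneous Markov chain
started at the origin with transition probabilities `p_ω(x, x + e) = ω_x(e)`. -/
def quenchedLaw (d : ℕ) : Kernel (Env d) (ℕ → Site d) :=
  ((Kernel.traj (X := fun _ : ℕ => Env d × Site d)
      (fun n => (transition d).comap (fun h => h ⟨n, Finset.mem_Iic.2 le_rfl⟩)
        (measurable_pi_apply _)) 0).comap
    (fun ω _ => (ω, 0)) (by fun_prop)).map (fun s n => (s n).2)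

instance (d : ℕ) : IsMarkovKernel (quenchedLaw d) :=
  Kernel.IsMarkovKernel.map _ (by fun_prop)

/-- The single-site law `μ = p δ_{γ₁} + (1 - p) δ_{γ₂}`. -/
def siteLaw {d : ℕ} (γ₁ γ₂ : LocalEnv d) (p : unitInterval) : Measure (LocalEnv d) :=
  ENNReal.ofReal p • Measure.dirac γ₁ + ENNReal.ofReal (1 - p) • Measure.dirac γ₂

instance {d : ℕ} (γ₁ γ₂ : LocalEnv d) (p : unitInterval) :
    IsProbabilityMeasure (siteLaw γ₁ γ₂ p) where
  measure_univ := by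
    simp [siteLaw, ← ENNReal.ofReal_add p.2.1 (sub_nonneg.2 p.2.2)]

/-- The law of the i.i.d. environment, `ν = μ^{⊗ ℤ^d}`. -/
def envLaw {d : ℕ} (γ₁ γ₂ : LocalEnv d) (p : unitInterval) : Measure (Env d) :=
  Measure.infinitePi (fun _ : Site d => siteLaw γ₁ γ₂ p)

instance {d : ℕ} (γ₁ γ₂ : LocalEnv d) (p : unitInterval) :
    IsProbabilityMeasure (envLaw γ₁ γ₂ p) := by
  unfold envLaw; infer_instance

/-- The joint (annealed) law of the environment and of the walk,
`P(X ∈ A, ω ∈ B) = ∫_B P_ω(A) dν(ω)`. -/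
def annealedLaw {d : ℕ} (γ₁ γ₂ : LocalEnv d) (p : unitInterval) :
    Measure (Env d × (ℕ → Site d)) :=
  envLaw γ₁ γ₂ p ⊗ₘ quenchedLaw d

/-- `(ω, X)` is, under `P`, a random walk `X` in the i.i.d. random environment `ω` whose sites
take the value `γ₁` with probability `p` and `γ₂` with probability `1 - p`. -/
structure IsRWRE {d : ℕ} (γ₁ γ₂ : LocalEnv d) (p : unitInterval) {Ω : Type*}
    [MeasurableSpace Ω] (P : Measure Ω) (ω : Ω → Env d) (X : Ω → ℕ → Site d) : Prop where
  measurable_env : Measurable ω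
  measurable_walk : Measurable X
  map_eq : P.map (fun a => (ω a, X a)) = annealedLaw γ₁ γ₂ p

open Classical in
/-- The number of times `0 ≤ m < n` at which the trajectory `x` sits at a site of the
environment `ω` whose value is `γ`. -/
def visits {d : ℕ} (γ : LocalEnv d) (ω : Env d) (x : ℕ → Site d) (n : ℕ) : ℕ :=
  ((Finset.range n).filter (fun m => ω (x m) = γ)).card

/-- The trajectory `x` has limiting velocity `v`, i.e. `x_n / n → v`. -/
def HasVelocity {d : ℕ} (x : ℕ → Site d) (v : Fin d → ℝ) : Prop :=
  Tendsto (fun n : ℕ => (n : ℝ)⁻¹ • toReal (x n)) atTop (𝓝 v)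

end RWRE

end

open MeasureTheory ProbabilityTheory Filter Topology
open scoped ENNReal
set_option linter.unusedSectionVars false

noncomputable section

namespace RWRE

/-! ### Cylinder probabilities of the quenched chain -/

section

/-! Coupling. Give every site a uniform mark and fix two independent i.i.d. stacks of steps, with
laws γ₁ and γ₂, shared by all p. At parameter p the walk takes the next unused step of the first
stack at a site whose mark is at most p, and of the second stack otherwise. For fixed marks this is
the quenched chain (`map_stackWalk`), since different visits use different entries of the stacks. If
N_n counts the steps taken from the first stack, then X_n = S¹(N_n) + S²(n - N_n), so the position
is a function of n and N_n that does not involve p. Whenever the counts for p < p' agree, the walks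
agree, and the next increment of the count is at least as large for p'. Hence N[p] ≤ N[p'] at all
times (`stackCount_mono`).

The comparisons follow from this. A direction that the second stack never uses, and whose opposite
the first never uses, gives a pathwise order (`ae_coupWalk_dotProduct_le`). By the law of large
numbers for both stacks, X_n = N_n u₁ + (n - N_n) u₂ + o(n), so V[p'] - V[p] is a nonnegative
multiple of u₁ - u₂ (`velocity_le`); this also orders deterministic speeds. For the order infinitely
often, recentre the steps by a constant strictly between the two drifts. One then needs times at
which one stack is at a record while the fresh part of the other never drops below its present level
(`frequently_le_of_counts`, `ae_coupling_record`).

Existence of the velocity is the long part, as no ellipticity is available. It is enough to treat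
one coordinate h of the walk in an i.i.d. environment. Let q be the annealed probability that the
walk never goes below its starting height and is unbounded above.

If q > 0, a walk that is unbounded above has regeneration times. Conditionally on the event of
probability q, the height gained and the time spent until the first regeneration are independent of
the path seen from there, which has the same law again. A renewal argument bounds the mean height
gain (`sum_aheadSet_regenHeight_le`). The mean time may be infinite, in which case the speed is 0
(`ae_aheadLaw_tendsto`).

If q = 0, the walk very probably backtracks from each new level. An induction shows that passing
from a new level k to k + s with at most j upcrossings into k is unlikely for large s, uniformly in
the environment below k (`eventually_envBound_slowSet`). So a large proportion of levels is crossed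
more than j times, and h(X_n) ≤ 2n/(j+1) + O(1) for every j (`ae_forall_exists_le`). Applying the
dichotomy to h and -h gives a limit in all cases (`ae_exists_tendsto_height`). -/

/-- The probability that the walk in the environment `ω` jumps from `x` to `y`. -/
def stepProb {d : ℕ} (ω : Env d) (x y : Site d) : ℝ≥0∞ :=
  (ω x : Measure (Step d)) {s | (s : Site d) = y - x}

/-- The probability that the walk in `ω` follows the path `w` during its first `n` steps. -/
def pathProb {d : ℕ} (ω : Env d) (w : ℕ → Site d) (n : ℕ) : ℝ≥0∞ :=
  ∏ i ∈ Finset.range n, stepProb ω (w i) (w (i + 1))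

/-- The trajectories that agree with `w` up to time `n`. -/
def cyl {E : Type*} (n : ℕ) (w : ℕ → E) : Set (ℕ → E) := {x | ∀ i ≤ n, x i = w i}

theorem measurable_stepProb {d : ℕ} (x y : Site d) :
    Measurable fun ω : Env d => stepProb ω x y := by
  unfold stepProb
  exact (Measure.measurable_coe (Set.to_countable _).measurableSet).comp
    (measurable_subtype_coe.comp (measurable_pi_apply x))

theorem transition_apply {d : ℕ} (z : Env d × Site d) :
    transition d z =
      ((z.1 z.2 : Measure (Step d))).map (fun e : Step d => (z.1, z.2 + (e : Site d))) := by
  unfold transition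
  rw [Kernel.map_apply _ (by fun_prop), Kernel.prod_apply, Kernel.id_apply, Measure.dirac_prod,
    Measure.map_map (by fun_prop) (by fun_prop)]
  rfl

theorem lintegral_partialTraj_zero_succ {E : Type*} [MeasurableSpace E]
    (κ : (n : ℕ) → Kernel ((i : Finset.Iic n) → E) E) [∀ n, IsMarkovKernel (κ n)] (n : ℕ)
    (x₀ : (i : Finset.Iic 0) → E) {G : ((i : Finset.Iic (n + 1)) → E) → ℝ≥0∞} (hG : Measurable G) :
    ∫⁻ y, G y ∂(Kernel.partialTraj (X := fun _ => E) κ 0 (n + 1) x₀) =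
      ∫⁻ y, ∫⁻ s, G (IicProdIoc (X := fun _ => E) n (n + 1)
        (y, MeasurableEquiv.piSingleton (X := fun _ => E) n s)) ∂(κ n y)
        ∂(Kernel.partialTraj (X := fun _ => E) κ 0 n x₀) := by
  have hm : Measurable fun a => G (IicProdIoc (X := fun _ : ℕ => E) n (n + 1) a) :=
    hG.comp measurable_IicProdIoc
  rw [Kernel.partialTraj_succ_of_le (Nat.zero_le n),
    Kernel.lintegral_map _ (measurable_IicProdIoc (X := fun _ : ℕ => E)) _ hG]
  rw [Kernel.lintegral_comp _ _ _ hm]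
  refine lintegral_congr fun y => ?_
  have hy : Measurable fun b => G (IicProdIoc (X := fun _ : ℕ => E) n (n + 1) (y, b)) :=
    hm.comp measurable_prodMk_left
  rw [Kernel.lintegral_id_prod hm, Kernel.lintegral_map _ (by fun_prop) _ hy]

theorem IicProdIoc_piSingleton_of_le {E : Type*} [MeasurableSpace E] {n : ℕ}
    (y : (i : Finset.Iic n) → E) (s : E) (i : Finset.Iic (n + 1)) (hi : (i : ℕ) ≤ n) :
    IicProdIoc (X := fun _ : ℕ => E) n (n + 1)
      (y, MeasurableEquiv.piSingleton (X := fun _ => E) n s) i = y ⟨i, Finset.mem_Iic.2 hi⟩ := by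
  simp [IicProdIoc, hi]

theorem IicProdIoc_piSingleton_last {E : Type*} [MeasurableSpace E] {n : ℕ}
    (y : (i : Finset.Iic n) → E) (s : E) :
    IicProdIoc (X := fun _ : ℕ => E) n (n + 1)
      (y, MeasurableEquiv.piSingleton (X := fun _ => E) n s)
      ⟨n + 1, Finset.mem_Iic.2 le_rfl⟩ = s := by
  simp [IicProdIoc, MeasurableEquiv.piSingleton]

/-- Induction on the number of steps. The environment component never changes, so the probability of
the last step is a function of it and can be absorbed into the weight; this is why the weight `g` is
arbitrary. -/
theorem lintegral_partialTraj_transition {d : ℕ} (ω : Env d) (w : ℕ → Site d) (n : ℕ)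
    {g : Env d → ℝ≥0∞} (hg : Measurable g) :
    ∫⁻ y, {y : (i : Finset.Iic n) → Env d × Site d | ∀ i, (y i).2 = w i}.indicator
        (fun y => g (y ⟨n, Finset.mem_Iic.2 le_rfl⟩).1) y
      ∂(Kernel.partialTraj (X := fun _ => Env d × Site d)
        (fun n => (transition d).comap (fun h => h ⟨n, Finset.mem_Iic.2 le_rfl⟩)
          (measurable_pi_apply _)) 0 n (fun _ => (ω, 0))) =
      if w 0 = 0 then pathProb ω w n * g ω else 0 := by
  induction n generalizing g with
  | zero =>
    rw [Kernel.partialTraj_self, Kernel.id_apply, lintegral_dirac']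
    · by_cases h : w 0 = 0
      · rw [Set.indicator_of_mem]
        · simp [h, pathProb]
        · rintro ⟨i, hi⟩
          obtain rfl : i = 0 := by simpa using hi
          exact h.symm
      · rw [Set.indicator_of_notMem, if_neg h]
        intro h'
        exact h (h' ⟨0, by simp⟩).symm
    · refine Measurable.indicator (by fun_prop) ?_
      simp only [Set.ofPred_forall]
      refine MeasurableSet.iInter fun i => ?_
      exact measurableSet_eq_fun (by fun_prop) (by fun_prop)
  | succ n ih =>
    rw [lintegral_partialTraj_zero_succ]
    · have key : ∀ y : (i : Finset.Iic n) → Env d × Site d,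
          ∫⁻ s, {y : (i : Finset.Iic (n + 1)) → Env d × Site d | ∀ i, (y i).2 = w i}.indicator
            (fun y => g (y ⟨n + 1, Finset.mem_Iic.2 le_rfl⟩).1)
            (IicProdIoc (X := fun _ => Env d × Site d) n (n + 1)
              (y, MeasurableEquiv.piSingleton (X := fun _ => Env d × Site d) n s))
            ∂(transition d (y ⟨n, Finset.mem_Iic.2 le_rfl⟩)) =
          {y : (i : Finset.Iic n) → Env d × Site d | ∀ i, (y i).2 = w i}.indicator
            (fun y => (fun ω' => g ω' * stepProb ω' (w n) (w (n + 1)))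
              (y ⟨n, Finset.mem_Iic.2 le_rfl⟩).1) y := by
        intro y
        have hset : ∀ s : Env d × Site d, IicProdIoc (X := fun _ => Env d × Site d) n (n + 1)
              (y, MeasurableEquiv.piSingleton (X := fun _ => Env d × Site d) n s) ∈
              {y : (i : Finset.Iic (n + 1)) → Env d × Site d | ∀ i, (y i).2 = w i} ↔
            (∀ i, (y i).2 = w i) ∧ s.2 = w (n + 1) := by
          intro s
          constructor
          · intro h
            refine ⟨fun i => ?_, ?_⟩
            · have hi := Finset.mem_Iic.1 i.2
              rw [← IicProdIoc_piSingleton_of_le y s ⟨i, Finset.mem_Iic.2 (by omega)⟩ hi]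
              exact h _
            · rw [← IicProdIoc_piSingleton_last y s]
              exact h _
          · rintro ⟨h1, h2⟩ ⟨i, hi⟩
            rcases Nat.lt_or_ge n i with hlt | hle
            · obtain rfl : i = n + 1 := by
                have := Finset.mem_Iic.1 hi
                omega
              rw [IicProdIoc_piSingleton_last]
              exact h2
            · rw [IicProdIoc_piSingleton_of_le _ _ _ hle]
              exact h1 ⟨i, _⟩
        by_cases hy : ∀ i, (y i).2 = w i
        · have hyS : y ∈ {y : (i : Finset.Iic n) → Env d × Site d | ∀ i, (y i).2 = w i} := hy
          rw [Set.indicator_of_mem hyS]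
          have : ∀ s : Env d × Site d,
              {y : (i : Finset.Iic (n + 1)) → Env d × Site d | ∀ i, (y i).2 = w i}.indicator
                (fun y => g (y ⟨n + 1, Finset.mem_Iic.2 le_rfl⟩).1)
                (IicProdIoc (X := fun _ => Env d × Site d) n (n + 1)
                  (y, MeasurableEquiv.piSingleton (X := fun _ => Env d × Site d) n s)) =
              (Prod.snd ⁻¹' {w (n + 1)}).indicator (fun s => g s.1) s := by
            intro s
            by_cases hs : s.2 = w (n + 1)
            · rw [Set.indicator_of_mem ((hset s).2 ⟨hy, hs⟩), IicProdIoc_piSingleton_last,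
                Set.indicator_of_mem (by simpa using hs)]
            · rw [Set.indicator_of_notMem (fun h => hs ((hset s).1 h).2),
                Set.indicator_of_notMem (by simpa using hs)]
          simp only [this]
          have hm : MeasurableSet (Prod.snd ⁻¹' {w (n + 1)} : Set (Env d × Site d)) :=
            measurable_snd (measurableSet_singleton _)
          have hgm : Measurable ((Prod.snd ⁻¹' {w (n + 1)} : Set (Env d × Site d)).indicator
              (fun s => g s.1)) := by
            refine Measurable.indicator ?_ hm
            exact hg.comp measurable_fst
          rw [transition_apply, lintegral_map hgm (by fun_prop)]
          have hyn := hy ⟨n, Finset.mem_Iic.2 le_rfl⟩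
          have : ∀ e : Step d, (Prod.snd ⁻¹' {w (n + 1)} : Set (Env d × Site d)).indicator
                (fun s => g s.1) ((y ⟨n, Finset.mem_Iic.2 le_rfl⟩).1,
                  (y ⟨n, Finset.mem_Iic.2 le_rfl⟩).2 + (e : Site d)) =
              {s : Step d | (s : Site d) = w (n + 1) - w n}.indicator
                (fun _ => g (y ⟨n, Finset.mem_Iic.2 le_rfl⟩).1) e := by
            intro e
            rw [hyn]
            by_cases he : (e : Site d) = w (n + 1) - w n
            · rw [Set.indicator_of_mem, Set.indicator_of_mem]
              · exact he
              · simp [he]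
            · rw [Set.indicator_of_notMem, Set.indicator_of_notMem]
              · exact he
              · intro h
                apply he
                rw [← show w n + (e : Site d) = w (n + 1) from h]
                abel
          simp only [this]
          rw [lintegral_indicator_const (Set.to_countable _).measurableSet, hyn]
          rfl
        · have hyS : y ∉ {y : (i : Finset.Iic n) → Env d × Site d | ∀ i, (y i).2 = w i} := hy
          rw [Set.indicator_of_notMem hyS]
          have : ∀ s : Env d × Site d,
              {y : (i : Finset.Iic (n + 1)) → Env d × Site d | ∀ i, (y i).2 = w i}.indicator
                (fun y => g (y ⟨n + 1, Finset.mem_Iic.2 le_rfl⟩).1)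
                (IicProdIoc (X := fun _ => Env d × Site d) n (n + 1)
                  (y, MeasurableEquiv.piSingleton (X := fun _ => Env d × Site d) n s)) = 0 :=
            fun s => Set.indicator_of_notMem (fun h => hy ((hset s).1 h).1) _
          simp only [this, lintegral_zero]
      simp only [Kernel.comap_apply, key]
      rw [ih (g := fun ω' => g ω' * stepProb ω' (w n) (w (n + 1)))
        (hg.mul (measurable_stepProb _ _))]
      split_ifs
      · rw [pathProb, pathProb, Finset.prod_range_succ]; ring
      · rfl
    · refine Measurable.indicator (by fun_prop) ?_
      simp only [Set.ofPred_forall]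
      refine MeasurableSet.iInter fun i => ?_
      exact measurableSet_eq_fun (by fun_prop) (by fun_prop)

/-- The quenched probability of a cylinder. -/
theorem quenchedLaw_cyl {d : ℕ} (ω : Env d) (n : ℕ) (w : ℕ → Site d) :
    quenchedLaw d ω (cyl n w) = if w 0 = 0 then pathProb ω w n else 0 := by
  have hm : MeasurableSet {y : (i : Finset.Iic n) → Env d × Site d | ∀ i, (y i).2 = w i} := by
    simp only [Set.ofPred_forall]
    refine MeasurableSet.iInter fun i => ?_
    exact measurableSet_eq_fun (by fun_prop) (by fun_prop)
  have hc : MeasurableSet (cyl n w) := by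
    simp only [cyl, Set.ofPred_forall]
    refine MeasurableSet.iInter fun i => MeasurableSet.iInter fun _ => ?_
    exact measurableSet_eq_fun (by fun_prop) (by fun_prop)
  have h := lintegral_partialTraj_transition ω w n (g := fun _ => 1) measurable_const
  rw [lintegral_indicator_const hm, one_mul, mul_one, ← Kernel.traj_map_frestrictLe_apply,
    Measure.map_apply (by fun_prop) hm] at h
  rw [quenchedLaw, Kernel.map_apply' _ (by fun_prop) _ hc, Kernel.comap_apply, ← h]
  congr 1
  ext s
  simp [cyl, Preorder.frestrictLe]

end

/-! ### Events decided in finite time, and a zero-one criterion -/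

section

/-- Apply countable additivity to the restriction of the measure to `A`; only the fibres have to be
measurable. -/
theorem measure_eq_tsum_fiber {α β : Type*} [MeasurableSpace α] [Countable β] [MeasurableSpace β]
    [MeasurableSingletonClass β] (μ : Measure α) {f : α → β} (hf : Measurable f) (A : Set α) :
    μ A = ∑' c, μ (A ∩ f ⁻¹' {c}) := by
  have h : (Set.univ : Set α) = ⋃ c, f ⁻¹' {c} := by ext; simp
  calc μ A = μ.restrict A Set.univ := by simp
    _ = ∑' c, μ.restrict A (f ⁻¹' {c}) := by
      rw [h]
      refine measure_iUnion ?_ fun c => hf (measurableSet_singleton c)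
      exact fun a b hab => Disjoint.preimage f (by simpa using hab)
    _ = ∑' c, μ (A ∩ f ⁻¹' {c}) := by
      refine tsum_congr fun c => ?_
      rw [Measure.restrict_apply (hf (measurableSet_singleton c)), Set.inter_comm]

section Discrete

variable {E : Type*} [Countable E] [MeasurableSpace E] [MeasurableSingletonClass E]

theorem measurableSet_cyl {E : Type*} [MeasurableSpace E] [MeasurableSingletonClass E] (n : ℕ)
    (w : ℕ → E) : MeasurableSet (cyl n w) := by
  simp only [cyl, Set.ofPred_forall]
  refine MeasurableSet.iInter fun i => MeasurableSet.iInter fun _ => ?_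
  have := measurable_pi_apply (X := fun _ : ℕ => E) i (measurableSet_singleton (w i))
  exact this

theorem isPiSystem_cyl {E : Type*} :
    IsPiSystem {s : Set (ℕ → E) | ∃ n w, s = cyl n w} := by
  rintro _ ⟨n, w, rfl⟩ _ ⟨m, v, rfl⟩ ⟨x, hx, hx'⟩
  refine ⟨max n m, x, ?_⟩
  ext y
  constructor
  · rintro ⟨h1, h2⟩ i hi
    rcases le_max_iff.1 hi with h | h
    · rw [h1 i h, hx i h]
    · rw [h2 i h, hx' i h]
  · intro h
    exact ⟨fun i hi => by rw [h i (le_max_of_le_left hi), hx i hi],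
      fun i hi => by rw [h i (le_max_of_le_right hi), hx' i hi]⟩

/-- The first `n + 1` entries of a sequence. -/
def initial {E : Type*} (n : ℕ) (x : ℕ → E) : Fin (n + 1) → E := fun i => x i

/-- Extend a finite sequence to an infinite one by repeating the last entry. -/
def extend {E : Type*} {n : ℕ} (w : Fin (n + 1) → E) : ℕ → E :=
  fun i => w ⟨min i n, by omega⟩

theorem initial_preimage_singleton {E : Type*} {n : ℕ} (w : Fin (n + 1) → E) :
    initial n ⁻¹' {w} = cyl n (extend w) := by
  ext x
  simp only [Set.mem_preimage, Set.mem_singleton_iff, cyl, Set.mem_ofPred_eq, extend]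
  constructor
  · rintro rfl i hi
    simp [initial, hi]
  · intro h
    ext i
    have := h i (by omega)
    rw [initial, this]
    congr 1
    ext
    simp
    omega

theorem measurable_initial {E : Type*} [MeasurableSpace E] (n : ℕ) :
    Measurable (initial n : (ℕ → E) → _) := by
  unfold initial; fun_prop

/-- Cylinders are stable under nonempty intersection, and since `E` is countable every
one-coordinate event is a countable union of them. The total masses agree by summation over the
cylinders at time 0. -/
theorem measure_ext_cyl {μ ν : Measure (ℕ → E)} [IsFiniteMeasure μ]
    (h : ∀ n w, μ (cyl n w) = ν (cyl n w)) : μ = ν := by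
  refine ext_of_generate_finite {s : Set (ℕ → E) | ∃ n w, s = cyl n w} ?_ isPiSystem_cyl ?_ ?_
  · apply le_antisymm
    · refine iSup_le fun i => ?_
      rintro _ ⟨s, -, rfl⟩
      have : (fun x : ℕ → E => x i) ⁻¹' s =
          ⋃ w : {w : Fin (i + 1) → E // w (Fin.last i) ∈ s}, cyl i (extend w.1) := by
        ext x
        simp only [Set.mem_preimage, Set.mem_iUnion, ← initial_preimage_singleton,
          Set.mem_singleton_iff, Subtype.exists]
        constructor
        · exact fun hx => ⟨initial i x, by simpa [initial] using hx, rfl⟩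
        · rintro ⟨w, hw, rfl⟩
          simpa [initial] using hw
      rw [this]
      exact MeasurableSet.iUnion fun w => MeasurableSpace.measurableSet_generateFrom ⟨_, _, rfl⟩
    · refine MeasurableSpace.generateFrom_le ?_
      rintro _ ⟨n, w, rfl⟩
      exact measurableSet_cyl n w
  · rintro _ ⟨n, w, rfl⟩
    exact h n w
  · rw [measure_eq_tsum_fiber μ (measurable_initial 0) Set.univ,
      measure_eq_tsum_fiber ν (measurable_initial 0) Set.univ]
    simp only [initial_preimage_singleton, Set.univ_inter, h]

/-- Membership in `B` is decided by the entries up to time `n`. -/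
def InitDet {E : Type*} (n : ℕ) (B : Set (ℕ → E)) : Prop :=
  ∀ ⦃x y⦄, (∀ i ≤ n, x i = y i) → x ∈ B → y ∈ B

theorem InitDet.inter_initial {E : Type*} {n : ℕ} {B : Set (ℕ → E)} (h : InitDet n B)
    (w : Fin (n + 1) → E) :
    B ∩ initial n ⁻¹' {w} = cyl n (extend w) ∨ B ∩ initial n ⁻¹' {w} = ∅ := by
  rw [initial_preimage_singleton]
  by_cases hw : extend w ∈ B
  · left
    refine Set.inter_eq_right.2 fun x hx => ?_
    exact h (fun i hi => (hx i hi).symm) hw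
  · right
    rw [Set.eq_empty_iff_forall_notMem]
    rintro x ⟨hxB, hx⟩
    exact hw (h hx hxB)

theorem InitDet.measurableSet {n : ℕ} {B : Set (ℕ → E)} (h : InitDet n B) : MeasurableSet B := by
  have : B = ⋃ w, B ∩ initial n ⁻¹' {w} := by ext; simp
  rw [this]
  refine MeasurableSet.iUnion fun w => ?_
  rcases h.inter_initial w with h | h <;> rw [h]
  · exact measurableSet_cyl _ _
  · exact MeasurableSet.empty

end Discrete

/-- If, for some `c < 1`, the conditional probability of `G` given any finite number of
coordinates is at most `c`, then `G` is a null set. -/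
theorem measure_eq_zero_of_forall_initDet {E : Type*} [MeasurableSpace E]
    (μ : Measure (ℕ → E)) [IsProbabilityMeasure μ] {G : Set (ℕ → E)} (hG : MeasurableSet G)
    {c : ℝ} (hc : c < 1)
    (h : ∀ n B, MeasurableSet B → InitDet n B → μ.real (G ∩ B) ≤ c * μ.real B) : μ G = 0 := by
  let ℱ : Filtration ℕ (MeasurableSpace.pi (X := fun _ : ℕ => E)) := Filtration.piLE
  have hsup : (⨆ n, ℱ n) = MeasurableSpace.pi (X := fun _ : ℕ => E) := by
    refine le_antisymm (iSup_le fun n => ℱ.le n) (iSup_le fun n => ?_)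
    refine le_trans ?_ (le_iSup _ n)
    rintro _ ⟨s, hs, rfl⟩
    refine ⟨(fun f : (i : Set.Iic n) → E => f ⟨n, Set.mem_Iic.2 le_rfl⟩) ⁻¹' s, ?_, rfl⟩
    exact measurable_pi_apply _ hs
  have hint : Integrable (G.indicator (fun _ => (1 : ℝ))) μ :=
    (integrable_const 1).indicator hG
  -- Lévy's upward theorem: the conditional probabilities of `G` tend to its indicator, which is 1
  -- on `G`, while they never exceed `c < 1`.
  have hlim := hint.tendsto_ae_condExp (ℱ := ℱ) (by
    rw [hsup]
    exact (stronglyMeasurable_const.indicator hG))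
  have hle : ∀ n, μ[G.indicator (fun _ => (1 : ℝ)) | ℱ n] ≤ᵐ[μ] fun _ => c := by
    intro n
    have := ae_le_of_forall_setIntegral_le (μ := μ.trim (ℱ.le n))
      (f := μ[G.indicator (fun _ => (1 : ℝ)) | ℱ n]) (g := fun _ => c)
      (integrable_condExp.trim (ℱ.le n) stronglyMeasurable_condExp) (integrable_const c) ?_
    · exact ae_le_of_ae_le_trim this
    · intro s hs _
      rw [← setIntegral_trim (ℱ.le n) stronglyMeasurable_condExp hs,
        setIntegral_condExp (ℱ.le n) hint hs, setIntegral_const, setIntegral_indicator hG,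
        setIntegral_const]
      have hs' := ℱ.le n _ hs
      have := h n s hs' (by
        obtain ⟨s', -, rfl⟩ := hs
        intro x y hxy hx
        have : Preorder.restrictLe (π := fun _ : ℕ => E) n y = Preorder.restrictLe n x := by
          ext i
          exact (hxy i i.2).symm
        rw [Set.mem_preimage] at hx ⊢
        rwa [this])
      rw [Set.inter_comm] at this
      simp only [smul_eq_mul, mul_one, measureReal_def, trim_measurableSet_eq (ℱ.le n) hs] at this ⊢
      linarith
  have : ∀ᵐ x ∂μ, x ∉ G := by
    filter_upwards [hlim, ae_all_iff.2 hle] with x hx hx' hxG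
    rw [Set.indicator_of_mem hxG] at hx
    exact absurd (le_of_tendsto hx (Eventually.of_forall hx')) (not_le.2 hc)
  simpa [ae_iff] using this

end

/-! ### Markov property and locality of the quenched law -/

section

/-- The trajectory after time `t`, recentred at its starting point. -/
def recenter {d : ℕ} (t : ℕ) (x : ℕ → Site d) : ℕ → Site d := fun i => x (t + i) - x t

/-- The environment seen from `y`. -/
def envShift {d : ℕ} (y : Site d) (ω : Env d) : Env d := fun x => ω (y + x)

theorem measurable_recenter {d : ℕ} (t : ℕ) : Measurable (recenter (d := d) t) := by
  unfold recenter; fun_prop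

theorem measurable_envShift {d : ℕ} (y : Site d) : Measurable (envShift y) := by
  unfold envShift; fun_prop

theorem recenter_recenter {d : ℕ} (s t : ℕ) (x : ℕ → Site d) :
    recenter s (recenter t x) = recenter (t + s) x := by
  ext i
  simp [recenter, add_assoc]

theorem envShift_envShift {d : ℕ} (y z : Site d) (ω : Env d) :
    envShift z (envShift y ω) = envShift (y + z) ω := by
  ext i
  simp [envShift, add_assoc]

theorem pathProb_congr {d : ℕ} {ω ω' : Env d} {w w' : ℕ → Site d} {n : ℕ}
    (hw : ∀ i ≤ n, w i = w' i) (h : ∀ i < n, ω (w i) = ω' (w i)) :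
    pathProb ω w n = pathProb ω' w' n := by
  refine Finset.prod_congr rfl fun i hi => ?_
  have hi' := Finset.mem_range.1 hi
  rw [stepProb, stepProb, h i hi', hw i hi'.le, hw (i + 1) hi']

theorem pathProb_add {d : ℕ} (ω : Env d) (w : ℕ → Site d) (t n : ℕ) :
    pathProb ω w (t + n) = pathProb ω w t * pathProb (envShift (w t) ω) (recenter t w) n := by
  rw [pathProb, Finset.prod_range_add]
  congr 1
  refine Finset.prod_congr rfl fun i _ => ?_
  simp [stepProb, envShift, recenter, add_assoc]

/-- The Markov property, for a cylinder. -/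
theorem quenchedLaw_cyl_inter {d : ℕ} (ω : Env d) (t : ℕ) (w : ℕ → Site d)
    {A : Set (ℕ → Site d)} (hA : MeasurableSet A) :
    quenchedLaw d ω (cyl t w ∩ recenter t ⁻¹' A) =
      quenchedLaw d ω (cyl t w) * quenchedLaw d (envShift (w t) ω) A := by
  have key : ((quenchedLaw d ω).restrict (cyl t w)).map (recenter t) =
      quenchedLaw d ω (cyl t w) • quenchedLaw d (envShift (w t) ω) := by
    refine measure_ext_cyl fun n v => ?_
    rw [Measure.map_apply (measurable_recenter t) (measurableSet_cyl n v),
      Measure.restrict_apply (measurable_recenter t (measurableSet_cyl n v)), Measure.smul_apply,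
      smul_eq_mul, quenchedLaw_cyl _ n v]
    by_cases hv : v 0 = 0
    -- The concatenation of `w` up to time `t` with the translate of `v`; both conditions together
    -- describe one cylinder.
    · let u : ℕ → Site d := fun i => if i ≤ t then w i else w t + v (i - t)
      have hu : ∀ i ≤ t, u i = w i := fun i hi => by simp [u, hi]
      have hu' : ∀ i, u (t + i) = w t + v i := by
        intro i
        rcases Nat.eq_zero_or_pos i with rfl | hi
        · simp [u, hv]
        · simp [u, hi.ne']
      have hset : recenter t ⁻¹' cyl n v ∩ cyl t w = cyl (t + n) u := by
        ext x
        simp only [Set.mem_inter_iff, Set.mem_preimage, cyl, Set.mem_ofPred_eq, recenter]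
        constructor
        · rintro ⟨h1, h2⟩ i hi
          rcases le_or_gt i t with hit | hit
          · rw [h2 i hit, hu i hit]
          · obtain ⟨j, rfl⟩ := Nat.exists_eq_add_of_le hit.le
            rw [hu', ← h1 j (by omega), h2 t le_rfl]
            abel
        · intro h
          have h2 : ∀ i ≤ t, x i = w i := fun i hi => by rw [h i (by omega), hu i hi]
          refine ⟨fun i hi => ?_, h2⟩
          rw [h (t + i) (by omega), hu', h2 t le_rfl]
          abel
      rw [hset, quenchedLaw_cyl, quenchedLaw_cyl, hu 0 (Nat.zero_le _), if_pos hv, pathProb_add,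
        hu t le_rfl, pathProb_congr (w := u) (w' := w) hu fun _ _ => rfl,
        pathProb_congr (w := recenter t u) (w' := v)
          (fun i _ => by simp [recenter, hu', hu t le_rfl]) fun _ _ => rfl]
      split_ifs <;> simp
    · rw [if_neg hv, mul_zero]
      convert measure_empty (μ := quenchedLaw d ω)
      rw [Set.eq_empty_iff_forall_notMem]
      rintro x ⟨h, -⟩
      apply hv
      rw [← h 0 (Nat.zero_le _)]
      simp [recenter]
  have := congrArg (fun m => m A) key
  simp only [Measure.smul_apply, smul_eq_mul] at this
  rw [Measure.map_apply (measurable_recenter t) hA,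
    Measure.restrict_apply (measurable_recenter t hA), Set.inter_comm] at this
  exact this

/-- The Markov property. -/
theorem quenchedLaw_inter_recenter {d : ℕ} (ω : Env d) {t : ℕ} {B : Set (ℕ → Site d)}
    (hB : InitDet t B) {y : Site d} (hy : ∀ x ∈ B, x t = y) {A : Set (ℕ → Site d)}
    (hA : MeasurableSet A) :
    quenchedLaw d ω (B ∩ recenter t ⁻¹' A) =
      quenchedLaw d ω B * quenchedLaw d (envShift y ω) A := by
  rw [measure_eq_tsum_fiber _ (measurable_initial t) (B ∩ _),
    measure_eq_tsum_fiber _ (measurable_initial t) B, ← ENNReal.tsum_mul_right]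
  refine tsum_congr fun w => ?_
  rw [Set.inter_right_comm]
  rcases hB.inter_initial w with h | h
  · have : extend w ∈ cyl t (extend w) := fun i _ => rfl
    rw [← h] at this
    rw [h, quenchedLaw_cyl_inter _ _ _ hA, hy _ this.1]
  · simp [h]

/-- The quenched probability of an event decided at time `n` depends only on the environment at
the sites visited before time `n`. -/
theorem quenchedLaw_congr_of_initDet {d : ℕ} {ω ω' : Env d} {n : ℕ} {B : Set (ℕ → Site d)}
    (hB : InitDet n B) {S : Set (Site d)} (hS : ∀ x ∈ B, ∀ i < n, x i ∈ S)
    (h : ∀ x ∈ S, ω x = ω' x) : quenchedLaw d ω B = quenchedLaw d ω' B := by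
  rw [measure_eq_tsum_fiber _ (measurable_initial n) B,
    measure_eq_tsum_fiber (quenchedLaw d ω') (measurable_initial n) B]
  refine tsum_congr fun w => ?_
  rcases hB.inter_initial w with hw | hw
  · have : extend w ∈ B := by
      have : extend w ∈ cyl n (extend w) := fun i _ => rfl
      rw [← hw] at this
      exact this.1
    rw [hw, quenchedLaw_cyl, quenchedLaw_cyl,
      pathProb_congr (fun _ _ => rfl) fun i hi => h _ (hS _ this i hi)]
  · simp [hw]

theorem InitDet.inter {E : Type*} {n : ℕ} {B C : Set (ℕ → E)} (hB : InitDet n B)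
    (hC : InitDet n C) : InitDet n (B ∩ C) :=
  fun _ _ h hx => ⟨hB h hx.1, hC h hx.2⟩

theorem InitDet.mono {E : Type*} {m n : ℕ} {B : Set (ℕ → E)} (hB : InitDet m B) (h : m ≤ n) :
    InitDet n B := fun _ _ hxy hx => hB (fun i hi => hxy i (hi.trans h)) hx

theorem initDet_cyl {E : Type*} (n : ℕ) (w : ℕ → E) : InitDet n (cyl n w) :=
  fun _ _ h hx i hi => (h i hi).symm.trans (hx i hi)

/-- The quenched probability of an event on which the walk never leaves `S` depends only on the
environment in `S`. -/
theorem quenchedLaw_congr_of_forall_mem {d : ℕ} {ω ω' : Env d} {A : Set (ℕ → Site d)}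
    (hA : MeasurableSet A) {S : Set (Site d)} (hS : ∀ x ∈ A, ∀ i, x i ∈ S)
    (h : ∀ x ∈ S, ω x = ω' x) : quenchedLaw d ω A = quenchedLaw d ω' A := by
  -- Staying in `S` forever is not decided in finite time, so it is approached by staying in `S` up
  -- to time `m`. The two quenched laws, restricted to the decreasing limit, agree on cylinders and
  -- hence on `A`.
  let C : ℕ → Set (ℕ → Site d) := fun m => {x | ∀ i ≤ m, x i ∈ S}
  have hCm : ∀ m, InitDet m (C m) := fun m x y hxy hx i hi => hxy i hi ▸ hx i hi
  have hanti : Antitone C := fun m n hmn x hx i hi => hx i (hi.trans hmn)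
  have hmeas : MeasurableSet (⋂ m, C m) := MeasurableSet.iInter fun m => (hCm m).measurableSet
  have key : (quenchedLaw d ω).restrict (⋂ m, C m) = (quenchedLaw d ω').restrict (⋂ m, C m) := by
    refine measure_ext_cyl fun n w => ?_
    rw [Measure.restrict_apply (measurableSet_cyl n w),
      Measure.restrict_apply (measurableSet_cyl n w), Set.inter_iInter]
    have hlim : ∀ η : Env d, Tendsto (fun m => quenchedLaw d η (cyl n w ∩ C m)) atTop
        (𝓝 (quenchedLaw d η (⋂ m, cyl n w ∩ C m))) := fun η =>
      tendsto_measure_iInter_atTop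
        (fun m => ((measurableSet_cyl n w).inter (hCm m).measurableSet).nullMeasurableSet)
        (fun a b hab => Set.inter_subset_inter_right _ (hanti hab)) ⟨0, measure_ne_top _ _⟩
    refine tendsto_nhds_unique (hlim ω) ((hlim ω').congr' ?_)
    filter_upwards [eventually_ge_atTop n] with m hm
    exact (quenchedLaw_congr_of_initDet (((initDet_cyl n w).mono hm).inter (hCm m))
      (fun x hx i hi => hx.2 i hi.le) h).symm
  have hAC : A ⊆ ⋂ m, C m := fun x hx => Set.mem_iInter.2 fun m i _ => hS x hx i
  have := congrArg (fun m => m A) key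
  simpa only [Measure.restrict_apply hA, Set.inter_eq_left.2 hAC] using this

section Environment

variable {d : ℕ} (m : Measure (LocalEnv d)) [IsProbabilityMeasure m]

/-- The law of an i.i.d. environment. -/
abbrev iidEnv {d : ℕ} (m : Measure (LocalEnv d)) : Measure (Env d) :=
  Measure.infinitePi fun _ : Site d => m

theorem map_envShift_iidEnv (y : Site d) : (iidEnv m).map (envShift y) = iidEnv m := by
  classical
  refine Measure.eq_infinitePi _ fun s t ht => ?_
  rw [Measure.map_apply (measurable_envShift y)
    (MeasurableSet.pi s.countable_toSet fun i _ => ht i)]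
  have : envShift y ⁻¹' (Set.pi (s : Set (Site d)) t) =
      Set.pi ((s.image fun x => y + x : Finset (Site d)) : Set (Site d)) fun x => t (x - y) := by
    ext ω
    simp only [envShift, Set.mem_preimage, Set.mem_pi, Finset.mem_coe, Finset.mem_image]
    constructor
    · rintro h _ ⟨i, hi, rfl⟩
      simpa using h i hi
    · intro h i hi
      simpa using h _ ⟨i, hi, rfl⟩
  rw [this, Measure.infinitePi_pi _ fun i _ => ht _,
    Finset.prod_image fun a _ b _ h => add_left_cancel h]
  simp

end Environment

/-- Functions of disjoint sets of coordinates are independent. -/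
theorem lintegral_mul_infinitePi {ι α : Type*} [MeasurableSpace α] (m : Measure α)
    [IsProbabilityMeasure m] {f g : (ι → α) → ℝ≥0∞} (hf : Measurable f) (hg : Measurable g)
    {S T : Set ι} (hfS : DependsOn f S) (hgT : DependsOn g T) (hST : Disjoint S T) :
    ∫⁻ ω, f ω * g ω ∂(Measure.infinitePi fun _ : ι => m) =
      (∫⁻ ω, f ω ∂(Measure.infinitePi fun _ : ι => m)) *
        ∫⁻ ω, g ω ∂(Measure.infinitePi fun _ : ι => m) := by
  classical
  have hne : Nonempty (α) := nonempty_of_isProbabilityMeasure m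
  let e : α := hne.some
  let 𝓜 : ι → MeasurableSpace ((ι → α)) := fun x =>
    MeasurableSpace.comap (fun ω => ω x) inferInstance
  have hind : iIndep 𝓜 (Measure.infinitePi fun _ : ι => m) := by
    have := iIndepFun_infinitePi (P := fun _ : ι => m) (X := fun _ => id)
      (fun _ => measurable_id)
    exact this
  have hle : ∀ x, 𝓜 x ≤ MeasurableSpace.pi := fun x => (measurable_pi_apply x).comap_le
  have key : ∀ (f : (ι → α) → ℝ≥0∞) (S : Set ι), Measurable f → DependsOn f S →
      Measurable[⨆ x ∈ S, 𝓜 x] f := by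
    intro f S hf hfS
    -- Freezing the coordinates outside `S` does not change `f`, and makes its measurability with
    -- respect to the coordinates in `S` visible.
    let p : (ι → α) → (ι → α) := fun ω x => if x ∈ S then ω x else e
    have hp : Measurable[⨆ x ∈ S, 𝓜 x] p := by
      refine @measurable_pi_lambda _ _ _ (⨆ x ∈ S, 𝓜 x) _ _ fun x => ?_
      by_cases hx : x ∈ S
      · simp only [p, hx, if_true]
        refine Measurable.of_comap_le ?_
        exact le_iSup₂ (f := fun x (_ : x ∈ S) => 𝓜 x) x hx
      · simp only [p, hx, if_false]
        exact measurable_const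
    have : f = f ∘ p := by
      ext ω
      exact hfS fun x hx => by simp [p, hx]
    rw [this]
    exact hf.comp hp
  exact lintegral_mul_eq_lintegral_mul_lintegral_of_independent_measurableSpace
    (iSup₂_le fun x _ => hle x) (iSup₂_le fun x _ => hle x)
    (indep_iSup_of_disjoint hle hind hST) (key f S hf hfS) (key g T hg hgT)

end

/-! ### Annealed law and independence at the first hitting time of a level -/

section

variable {d : ℕ}

/-- Nearest-neighbour trajectories started at the origin. -/
def IsWalk (x : ℕ → Site d) : Prop := x 0 = 0 ∧ ∀ n, x (n + 1) - x n ∈ unitVectors d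

theorem IsWalk.recenter {x : ℕ → Site d} (hx : IsWalk x) (t : ℕ) : IsWalk (recenter t x) := by
  refine ⟨by simp [RWRE.recenter], fun n => ?_⟩
  have := hx.2 (t + n)
  simpa [RWRE.recenter, add_assoc] using this

theorem stepProb_eq_zero (ω : Env d) {x y : Site d} (h : y - x ∉ unitVectors d) :
    stepProb ω x y = 0 := by
  have : {s : Step d | (s : Site d) = y - x} = ∅ := by
    rw [Set.eq_empty_iff_forall_notMem]
    rintro s hs
    exact h (hs ▸ s.2)
  rw [stepProb, this, measure_empty]

theorem ae_isWalk (ω : Env d) : ∀ᵐ x ∂(quenchedLaw d ω), IsWalk x := by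
  have h : ∀ (n : ℕ) (B : Set (ℕ → Site d)), InitDet n B →
      (∀ w ∈ B, quenchedLaw d ω (cyl n w) = 0) → quenchedLaw d ω B = 0 := by
    intro n B hB h0
    rw [measure_eq_tsum_fiber _ (measurable_initial n) B, ENNReal.tsum_eq_zero]
    intro w
    rcases hB.inter_initial w with hw | hw
    · rw [hw]
      refine h0 _ ?_
      have : extend w ∈ cyl n (extend w) := fun i _ => rfl
      rw [← hw] at this
      exact this.1
    · simp [hw]
  have h1 : ∀ᵐ x ∂(quenchedLaw d ω), x 0 = 0 := by
    rw [ae_iff]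
    refine h 0 _ (fun x y hxy hx => ?_) fun w hw => ?_
    · simpa [hxy 0 le_rfl] using hx
    · rw [quenchedLaw_cyl, if_neg hw]
  have h2 : ∀ n, ∀ᵐ x ∂(quenchedLaw d ω), x (n + 1) - x n ∈ unitVectors d := by
    intro n
    rw [ae_iff]
    refine h (n + 1) _ (fun x y hxy hx => ?_) fun w hw => ?_
    · simpa [hxy n (by omega), hxy (n + 1) le_rfl] using hx
    · rw [quenchedLaw_cyl, pathProb, Finset.prod_range_succ, stepProb_eq_zero ω hw]
      simp
  filter_upwards [h1, ae_all_iff.2 h2] with x hx hx'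
  exact ⟨hx, hx'⟩

/-- The annealed law of the walk in an i.i.d. environment. -/
def pathLaw (m : Measure (LocalEnv d)) : Measure (ℕ → Site d) :=
  (iidEnv m).bind (quenchedLaw d)

variable (m : Measure (LocalEnv d))

theorem pathLaw_apply {A : Set (ℕ → Site d)} (hA : MeasurableSet A) :
    pathLaw m A = ∫⁻ ω, quenchedLaw d ω A ∂(iidEnv m) :=
  Measure.bind_apply hA (Kernel.aemeasurable _)

variable [IsProbabilityMeasure m]

instance : IsProbabilityMeasure (pathLaw m) := by
  unfold pathLaw
  infer_instance

theorem measurableSet_isWalk : MeasurableSet {x : ℕ → Site d | IsWalk x} := by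
  have : {x : ℕ → Site d | IsWalk x} =
      {x | x 0 = 0} ∩ ⋂ n, {x | x (n + 1) - x n ∈ unitVectors d} := by
    ext x; simp [IsWalk]
  rw [this]
  refine MeasurableSet.inter ?_ (MeasurableSet.iInter fun n => ?_)
  · exact measurableSet_eq_fun (measurable_pi_apply 0) measurable_const
  · exact (show Measurable fun x : ℕ → Site d => x (n + 1) - x n by fun_prop)
      (Set.to_countable (↑(unitVectors d) : Set (Site d))).measurableSet

theorem ae_isWalk_pathLaw : ∀ᵐ x ∂(pathLaw m), IsWalk x := by
  refine (pathLaw_apply m measurableSet_isWalk.compl).trans ?_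
  exact (lintegral_congr fun ω => ae_iff.1 (ae_isWalk ω)).trans lintegral_zero

theorem measurable_quenchedLaw_envShift (y : Site d) {A : Set (ℕ → Site d)}
    (hA : MeasurableSet A) : Measurable fun ω => quenchedLaw d (envShift y ω) A :=
  ((quenchedLaw d).measurable_coe hA).comp (measurable_envShift y)

theorem envShift_zero (ω : Env d) : envShift 0 ω = ω := by
  ext x; simp [envShift]

theorem lintegral_envShift (y : Site d) {f : Env d → ℝ≥0∞} (hf : Measurable f) :
    ∫⁻ ω, f (envShift y ω) ∂(iidEnv m) = ∫⁻ ω, f ω ∂(iidEnv m) := by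
  rw [← lintegral_map hf (measurable_envShift y), map_envShift_iidEnv]

/-- `t` is the first time at which the walk has height `k`. -/
def FirstHit (h : Site d →+ ℤ) (k : ℤ) (t : ℕ) (x : ℕ → Site d) : Prop :=
  h (x t) = k ∧ ∀ i < t, h (x i) < k

theorem FirstHit.unique {h : Site d →+ ℤ} {k : ℤ} {s t : ℕ} {x : ℕ → Site d}
    (hs : FirstHit h k s x) (ht : FirstHit h k t x) : s = t := by
  rcases lt_trichotomy s t with hlt | heq | hlt
  · exact absurd hs.1 (ht.2 s hlt).ne
  · exact heq
  · exact absurd ht.1 (hs.2 t hlt).ne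

theorem initDet_firstHit (h : Site d →+ ℤ) (k : ℤ) (t : ℕ) :
    InitDet t {x | FirstHit h k t x} :=
  fun _ _ hxy hx => ⟨hxy t le_rfl ▸ hx.1, fun i hi => hxy i hi.le ▸ hx.2 i hi⟩

/-- The quenched probability of `A` depends only on the environment in `{h ≥ 0}`. -/
def AheadLocal (h : Site d →+ ℤ) (A : Set (ℕ → Site d)) : Prop :=
  DependsOn (fun ω => quenchedLaw d ω A) {z | 0 ≤ h z}

/-- Seen from a point of height 0, the event `A` reads the environment only at heights at least 0,
while `F` reads it at negative heights. The factors are therefore independent, and stationarity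
removes the shift. -/
theorem lintegral_mul_aheadLocal {h : Site d →+ ℤ} {F : Env d → ℝ≥0∞} (hF : Measurable F)
    (hFd : DependsOn F {z | h z < 0}) {A : Set (ℕ → Site d)} (hA : MeasurableSet A)
    (hAl : AheadLocal h A) {y : Site d} (hy : h y = 0) :
    ∫⁻ ω, F ω * quenchedLaw d (envShift y ω) A ∂(iidEnv m) =
      (∫⁻ ω, F ω ∂(iidEnv m)) * pathLaw m A := by
  rw [lintegral_mul_infinitePi m hF (measurable_quenchedLaw_envShift y hA) hFd
    (T := {z | 0 ≤ h z}), lintegral_envShift m y ((quenchedLaw d).measurable_coe hA),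
    pathLaw_apply m hA]
  · intro ω ω' hω
    refine hAl fun z hz => ?_
    refine hω _ ?_
    simpa [hy] using hz
  · rw [Set.disjoint_left]
    intro z hz hz'
    exact (not_lt.2 (show 0 ≤ h z from hz')) (show h z < 0 from hz)

/-- Until a level is first hit, the walk has used only the environment strictly below that level.
Summing over the hitting point `y` and moving it to the origin, the past becomes a weight `F y` on
the environment in `{h < 0}`. This common form serves both the exact independence and the uniform
upper bound below. -/
theorem pathLaw_inter_recenter {h : Site d →+ ℤ} {k : ℤ} {t : ℕ} {B : Set (ℕ → Site d)}
    (hB : InitDet t B) (hBF : ∀ x ∈ B, FirstHit h k t x) :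
    ∃ F : Site d → Env d → ℝ≥0∞, (∀ y, Measurable (F y)) ∧
      (∀ y, DependsOn (F y) {z | h z < 0}) ∧
      (pathLaw m B = ∑' y, ∫⁻ ω, F y ω ∂(iidEnv m)) ∧
      ∀ A, MeasurableSet A → pathLaw m (B ∩ recenter t ⁻¹' A) =
        ∑' y, ∫⁻ ω, F y ω * quenchedLaw d ω A ∂(iidEnv m) := by
  have hpt : ∀ y : Site d, InitDet t {x : ℕ → Site d | x t = y} :=
    fun y x x' hxx hx => (hxx t le_rfl).symm.trans hx
  have hBy : ∀ y, InitDet t (B ∩ {x | x t = y}) := fun y => hB.inter (hpt y)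
  have hfib : ∀ y : Site d, (fun x : ℕ → Site d => x t) ⁻¹' {y} = {x | x t = y} := fun y => rfl
  refine ⟨fun y ω => quenchedLaw d (envShift (-y) ω) (B ∩ {x | x t = y}), fun y => ?_, fun y => ?_,
    ?_, fun A hA => ?_⟩
  · exact measurable_quenchedLaw_envShift _ (hBy y).measurableSet
  · intro ω ω' hω
    refine quenchedLaw_congr_of_initDet (hBy y) (S := {z | h z < h y}) ?_ fun z hz => ?_
    · rintro x ⟨hx, rfl⟩ i hi
      have := hBF x hx
      exact this.1 ▸ this.2 i hi
    · refine hω _ ?_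
      simpa using hz
  · rw [measure_eq_tsum_fiber (pathLaw m) (measurable_pi_apply t) B]
    refine tsum_congr fun y => ?_
    rw [hfib, pathLaw_apply m (hBy y).measurableSet,
      lintegral_envShift m (-y) ((quenchedLaw d).measurable_coe (hBy y).measurableSet)]
  · rw [measure_eq_tsum_fiber (pathLaw m) (measurable_pi_apply t) (B ∩ _)]
    refine tsum_congr fun y => ?_
    rw [hfib, Set.inter_right_comm,
      pathLaw_apply m ((hBy y).measurableSet.inter (measurable_recenter t hA)),
      ← lintegral_envShift m (-y) ((quenchedLaw d).measurable_coe
        ((hBy y).measurableSet.inter (measurable_recenter t hA)))]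
    refine lintegral_congr fun ω => ?_
    rw [quenchedLaw_inter_recenter _ (hBy y) (fun x hx => hx.2) hA, envShift_envShift]
    simp [envShift_zero]

/-- After the first hitting time of a level, an event for which the walk does not backtrack is
independent of the past. -/
theorem pathLaw_inter_recenter_eq {h : Site d →+ ℤ} {k : ℤ} {t : ℕ} {B A : Set (ℕ → Site d)}
    (hB : InitDet t B) (hBF : ∀ x ∈ B, FirstHit h k t x) (hA : MeasurableSet A)
    (hAl : AheadLocal h A) :
    pathLaw m (B ∩ recenter t ⁻¹' A) = pathLaw m B * pathLaw m A := by
  obtain ⟨F, hF, hFd, h1, h2⟩ := pathLaw_inter_recenter m hB hBF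
  rw [h1, h2 A hA, ← ENNReal.tsum_mul_right]
  refine tsum_congr fun y => ?_
  have := lintegral_mul_aheadLocal m (hF y) (hFd y) hA hAl (y := 0) (map_zero h)
  simpa [envShift_zero] using this

/-- Given any environment in `{h < 0}`, the walk started at `x` is in `A` with probability at
most `η`. -/
def EnvBound (h : Site d →+ ℤ) (m : Measure (LocalEnv d)) (η : ℝ≥0∞) (x : Site d)
    (A : Set (ℕ → Site d)) : Prop :=
  ∀ F : Env d → ℝ≥0∞, Measurable F → DependsOn F {z | h z < 0} →
    ∫⁻ ω, F ω * quenchedLaw d (envShift x ω) A ∂(iidEnv m) ≤ η * ∫⁻ ω, F ω ∂(iidEnv m)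

theorem pathLaw_inter_recenter_le {h : Site d →+ ℤ} {k : ℤ} {t : ℕ} {B A : Set (ℕ → Site d)}
    (hB : InitDet t B) (hBF : ∀ x ∈ B, FirstHit h k t x) (hA : MeasurableSet A) {η : ℝ≥0∞}
    (hη : EnvBound h m η 0 A) :
    pathLaw m (B ∩ recenter t ⁻¹' A) ≤ η * pathLaw m B := by
  obtain ⟨F, hF, hFd, h1, h2⟩ := pathLaw_inter_recenter m hB hBF
  rw [h1, h2 A hA, ← ENNReal.tsum_mul_left]
  refine ENNReal.tsum_le_tsum fun y => ?_
  have := hη (F y) (hF y) (hFd y)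
  simpa [envShift_zero] using this

theorem aheadLocal_of_forall {h : Site d →+ ℤ} {A : Set (ℕ → Site d)} (hA : MeasurableSet A)
    (hA0 : ∀ x ∈ A, ∀ i, 0 ≤ h (x i)) : AheadLocal h A :=
  fun _ _ hω => quenchedLaw_congr_of_forall_mem hA (S := {z | 0 ≤ h z}) hA0 hω

/-- An event decided at time `n` reads the environment only at the sites visited strictly before
`n`. The final position may thus lie below height 0, as it does for first returns. -/
theorem aheadLocal_iUnion {h : Site d →+ ℤ} {B : ℕ → Set (ℕ → Site d)}
    (hB : ∀ n, InitDet n (B n)) (hdisj : Pairwise (Function.onFun Disjoint B))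
    (h0 : ∀ n, ∀ x ∈ B n, ∀ i < n, 0 ≤ h (x i)) : AheadLocal h (⋃ n, B n) := by
  intro ω ω' hω
  simp only
  rw [measure_iUnion hdisj fun n => (hB n).measurableSet,
    measure_iUnion hdisj fun n => (hB n).measurableSet]
  exact tsum_congr fun n =>
    quenchedLaw_congr_of_initDet (hB n) (S := {z | 0 ≤ h z}) (h0 n) hω

end

/-! ### Bounds uniform in the environment behind the walk -/

section

variable {d : ℕ} {h : Site d →+ ℤ} {m : Measure (LocalEnv d)} [IsProbabilityMeasure m]

theorem EnvBound.mono {η η' : ℝ≥0∞} {x : Site d} {A B : Set (ℕ → Site d)}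
    (hB : EnvBound h m η x B) (hAB : A ⊆ B) (hη : η ≤ η') : EnvBound h m η' x A := by
  intro F hF hFd
  calc _ ≤ ∫⁻ ω, F ω * quenchedLaw d (envShift x ω) B ∂(iidEnv m) :=
        lintegral_mono fun ω => mul_le_mul_right (measure_mono hAB) _
    _ ≤ η * ∫⁻ ω, F ω ∂(iidEnv m) := hB F hF hFd
    _ ≤ _ := mul_le_mul_left hη _

theorem EnvBound.union {η η' : ℝ≥0∞} {x : Site d} {A B : Set (ℕ → Site d)}
    (hA : EnvBound h m η x A) (hAm : MeasurableSet A) (hB : EnvBound h m η' x B) :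
    EnvBound h m (η + η') x (A ∪ B) := by
  intro F hF hFd
  calc _ ≤ ∫⁻ ω, (F ω * quenchedLaw d (envShift x ω) A +
          F ω * quenchedLaw d (envShift x ω) B) ∂(iidEnv m) := by
        refine lintegral_mono fun ω => ?_
        rw [← mul_add]
        exact mul_le_mul_right (measure_union_le _ _) _
    _ = _ := lintegral_add_left (hF.mul (measurable_quenchedLaw_envShift x hAm)) _
    _ ≤ _ := by
        rw [add_mul]
        exact add_le_add (hA F hF hFd) (hB F hF hFd)

theorem EnvBound.biUnion {ι : Type*} (s : Finset ι) {η : ℝ≥0∞} {x : Site d}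
    {A : ι → Set (ℕ → Site d)} (hA : ∀ i ∈ s, EnvBound h m η x (A i))
    (hAm : ∀ i ∈ s, MeasurableSet (A i)) :
    EnvBound h m (s.card * η) x (⋃ i ∈ s, A i) := by
  classical
  induction s using Finset.induction_on with
  | empty =>
    intro F hF hFd
    simp
  | insert a s ha ih =>
    rw [Finset.set_biUnion_insert, Finset.card_insert_of_notMem ha]
    refine EnvBound.mono ((hA a (by simp)).union (hAm a (by simp))
      (ih (fun i hi => hA i (by simp [hi])) fun i hi => hAm i (by simp [hi]))) subset_rfl ?_
    push_cast
    rw [add_mul, one_mul, add_comm]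

theorem envBound_empty {η : ℝ≥0∞} {x : Site d} : EnvBound h m η x ∅ := by
  intro F hF hFd
  simp

theorem envBound_aheadLocal {A : Set (ℕ → Site d)} (hA : MeasurableSet A)
    (hAl : AheadLocal h A) {y : Site d} (hy : h y = 0) :
    EnvBound h m (pathLaw m A) y A := by
  intro F hF hFd
  rw [lintegral_mul_aheadLocal m hF hFd hA hAl hy, mul_comm]

/-- The quenched probability of being at `y` at time `i` is bounded by 1 and dropped. What the walk
has learnt about the environment ahead is thereby forgotten, at the price of a later union bound
over the pairs `(i, y)`. -/
theorem envBound_of_recenter {η : ℝ≥0∞} {z : Site d} {A : Set (ℕ → Site d)}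
    (hA : MeasurableSet A) {i : ℕ} {y : Site d} (hη : EnvBound h m η (z + y) A) :
    EnvBound h m η z ({x | x i = y} ∩ recenter i ⁻¹' A) := by
  intro F hF hFd
  refine le_trans (lintegral_mono fun ω => mul_le_mul_right ?_ (F ω)) (hη F hF hFd)
  rw [quenchedLaw_inter_recenter _ (t := i) (y := y) (B := {x | x i = y})
    (fun x x' hxx hx => (hxx i le_rfl).symm.trans hx) (fun x hx => hx) hA, envShift_envShift]
  exact mul_le_of_le_one_left' prob_le_one

/-- The strong Markov property for `EnvBound`. -/
theorem envBound_iUnion_recenter {η : ℝ≥0∞} {z : Site d} {B : ℕ → Set (ℕ → Site d)}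
    (hB : ∀ i, InitDet i (B i)) (hdisj : Pairwise (Function.onFun Disjoint B))
    (hneg : ∀ i, ∀ x ∈ B i, ∀ k < i, h (z + x k) < 0) {A : Set (ℕ → Site d)}
    (hA : MeasurableSet A) (hη : ∀ i, ∀ x ∈ B i, EnvBound h m η (z + x i) A) :
    EnvBound h m η z (⋃ i, B i ∩ recenter i ⁻¹' A) := by
  intro F hF hFd
  have hpt : ∀ i (y : Site d), InitDet i {x : ℕ → Site d | x i = y} :=
    fun i y x x' hxx hx => (hxx i le_rfl).symm.trans hx
  have hBy : ∀ i y, InitDet i (B i ∩ {x | x i = y}) := fun i y => (hB i).inter (hpt i y)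
  have hfib : ∀ i (y : Site d), (fun x : ℕ → Site d => x i) ⁻¹' {y} = {x | x i = y} :=
    fun i y => rfl
  have hmB : ∀ i y, Measurable fun ω => quenchedLaw d (envShift z ω) (B i ∩ {x | x i = y}) :=
    fun i y => measurable_quenchedLaw_envShift z (hBy i y).measurableSet
  have hle : ∀ i y, ∫⁻ ω, F ω * quenchedLaw d (envShift z ω) (B i ∩ {x | x i = y}) *
      quenchedLaw d (envShift (z + y) ω) A ∂(iidEnv m) ≤
      η * ∫⁻ ω, F ω * quenchedLaw d (envShift z ω) (B i ∩ {x | x i = y}) ∂(iidEnv m) := by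
    intro i y
    rcases (B i ∩ {x | x i = y}).eq_empty_or_nonempty with he | ⟨x, hx, hxy⟩
    · simp [he]
    · have hb := hη i x hx
      rw [show x i = y from hxy] at hb
      -- The probability of the initial piece joins the weight. This is allowed because that piece
      -- stays in `{h < 0}` before its last time.
      refine hb _ (hF.mul (hmB i y)) ?_
      intro ω ω' hω
      refine congrArg₂ (· * ·) (hFd hω) ?_
      refine quenchedLaw_congr_of_initDet (hBy i y) (S := {w | h (z + w) < 0})
        (fun x hx k hk => hneg i x hx.1 k hk) fun w hw => hω _ hw
  calc ∫⁻ ω, F ω * quenchedLaw d (envShift z ω) (⋃ i, B i ∩ recenter i ⁻¹' A) ∂(iidEnv m)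
      ≤ ∫⁻ ω, ∑' i, ∑' y, F ω * quenchedLaw d (envShift z ω) (B i ∩ {x | x i = y}) *
      quenchedLaw d (envShift (z + y) ω) A ∂(iidEnv m) := by
        refine lintegral_mono fun ω => ?_
        simp_rw [mul_assoc, ENNReal.tsum_mul_left]
        refine mul_le_mul_right ((measure_iUnion_le _).trans ?_) _
        refine ENNReal.tsum_le_tsum fun i => ?_
        rw [measure_eq_tsum_fiber _ (measurable_pi_apply i) (B i ∩ _)]
        refine ENNReal.tsum_le_tsum fun y => ?_
        rw [hfib, Set.inter_right_comm,
          quenchedLaw_inter_recenter _ (hBy i y) (fun x hx => hx.2) hA, envShift_envShift]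
    _ = ∑' i, ∑' y, ∫⁻ ω, F ω * quenchedLaw d (envShift z ω) (B i ∩ {x | x i = y}) *
      quenchedLaw d (envShift (z + y) ω) A ∂(iidEnv m) := by
        have h1 : ∀ i y, Measurable fun ω => F ω * quenchedLaw d (envShift z ω)
            (B i ∩ {x | x i = y}) * quenchedLaw d (envShift (z + y) ω) A := fun i y =>
          (hF.mul (hmB i y)).mul (measurable_quenchedLaw_envShift _ hA)
        rw [lintegral_tsum fun i => (Measurable.tsum (h1 i)).aemeasurable]
        exact tsum_congr fun i => lintegral_tsum fun y => (h1 i y).aemeasurable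
    _ ≤ ∑' i, ∑' y, η * ∫⁻ ω, F ω * quenchedLaw d (envShift z ω)
          (B i ∩ {x | x i = y}) ∂(iidEnv m) :=
        ENNReal.tsum_le_tsum fun i => ENNReal.tsum_le_tsum fun y => hle i y
    _ = η * ∫⁻ ω, ∑' i, ∑' y, F ω * quenchedLaw d (envShift z ω)
          (B i ∩ {x | x i = y}) ∂(iidEnv m) := by
        simp_rw [ENNReal.tsum_mul_left]
        congr 1
        have h1 : ∀ i y, Measurable fun ω => F ω * quenchedLaw d (envShift z ω)
            (B i ∩ {x | x i = y}) := fun i y => hF.mul (hmB i y)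
        have h2 : ∀ i, ∫⁻ ω, F ω * quenchedLaw d (envShift z ω) (B i) ∂(iidEnv m) =
            ∑' y, ∫⁻ ω, F ω * quenchedLaw d (envShift z ω)
            (B i ∩ {x | x i = y}) ∂(iidEnv m) := by
          intro i
          rw [← lintegral_tsum fun y => (h1 i y).aemeasurable]
          refine lintegral_congr fun ω => ?_
          rw [ENNReal.tsum_mul_left, measure_eq_tsum_fiber _ (measurable_pi_apply i) (B i)]
          rfl
        have h3 : ∀ i ω, ∑' y, quenchedLaw d (envShift z ω) (B i ∩ {x | x i = y}) =
            quenchedLaw d (envShift z ω) (B i) := by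
          intro i ω
          rw [measure_eq_tsum_fiber _ (measurable_pi_apply i) (B i)]
          rfl
        simp_rw [h3, ← h2, ← ENNReal.tsum_mul_left]
        exact (lintegral_tsum fun i => (hF.mul (measurable_quenchedLaw_envShift z
          (hB i).measurableSet)).aemeasurable).symm
    _ ≤ η * ∫⁻ ω, F ω ∂(iidEnv m) := by
        refine mul_le_mul_right (lintegral_mono fun ω => ?_) _
        have h3 : ∀ i, ∑' y, quenchedLaw d (envShift z ω) (B i ∩ {x | x i = y}) =
            quenchedLaw d (envShift z ω) (B i) := by
          intro i
          rw [measure_eq_tsum_fiber _ (measurable_pi_apply i) (B i)]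
          rfl
        simp_rw [ENNReal.tsum_mul_left, h3]
        rw [← measure_iUnion hdisj fun i => (hB i).measurableSet]
        exact mul_le_of_le_one_right' prob_le_one

end

/-! ### Advancing, returning and slow passages: definitions and limits -/

section

variable {d : ℕ} {h : Site d →+ ℤ} {m : Measure (LocalEnv d)} [IsProbabilityMeasure m]

/-- The walk never goes below its starting height and is unbounded above. -/
def aheadSet (h : Site d →+ ℤ) : Set (ℕ → Site d) :=
  {x | (∀ i, 0 ≤ h (x i)) ∧ ∀ k : ℕ, ∃ i, (k : ℤ) ≤ h (x i)}

/-- Starting from height `a`, the walk reaches height `s` with at most `j` upcrossings of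
`{-1, 0}`. -/
def slowSet (h : Site d →+ ℤ) (s : ℤ) (j : ℕ) (a : ℤ) : Set (ℕ → Site d) :=
  {x | ∃ t, x 0 = 0 ∧ (∀ i < t, x (i + 1) - x i ∈ unitVectors d) ∧ a + h (x t) = s ∧
    (∀ i < t, a + h (x i) < s) ∧
    ((Finset.range t).filter fun i => a + h (x i) = -1 ∧ a + h (x (i + 1)) = 0).card ≤ j}

/-- The walk reaches height `s` without going below its starting height. -/
def reachSet (h : Site d →+ ℤ) (s : ℕ) : Set (ℕ → Site d) :=
  {x | ∃ t, (s : ℤ) ≤ h (x t) ∧ ∀ i ≤ t, 0 ≤ h (x i)}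

/-- The walk goes below its starting height, for the first time at time `n`. -/
def returnSet (h : Site d →+ ℤ) (n : ℕ) : Set (ℕ → Site d) :=
  {x | h (x n) < 0 ∧ ∀ i < n, 0 ≤ h (x i)}

theorem initDet_returnSet (n : ℕ) : InitDet n (returnSet h n) :=
  fun _ _ hxy hx => ⟨hxy n le_rfl ▸ hx.1, fun i hi => hxy i hi.le ▸ hx.2 i hi⟩

theorem pairwise_disjoint_returnSet : Pairwise (Function.onFun Disjoint (returnSet h)) := by
  intro i j hij
  rw [Function.onFun, Set.disjoint_left]
  intro x hx hx'
  rcases lt_or_gt_of_ne hij with hlt | hlt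
  · exact absurd (hx'.2 i hlt) (not_le.2 hx.1)
  · exact absurd (hx.2 j hlt) (not_le.2 hx'.1)

/-- `reachSet` decomposed along the first time of reaching. -/
theorem reachSet_eq_iUnion (s : ℕ) : reachSet h s =
    ⋃ t, {x | (s : ℤ) ≤ h (x t) ∧ (∀ i ≤ t, 0 ≤ h (x i)) ∧ ∀ i < t, h (x i) < s} := by
  classical
  ext x
  simp only [Set.mem_iUnion]
  constructor
  · rintro ⟨t, ht, ht'⟩
    have hex : ∃ t, (s : ℤ) ≤ h (x t) := ⟨t, ht⟩
    refine ⟨Nat.find hex, Nat.find_spec hex, fun i hi => ht' i (hi.trans (Nat.find_min' hex ht)),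
      fun i hi => not_le.1 (Nat.find_min hex hi)⟩
  · rintro ⟨t, ht, ht', -⟩
    exact ⟨t, ht, ht'⟩

theorem initDet_reach (s t : ℕ) : InitDet t
    {x | (s : ℤ) ≤ h (x t) ∧ (∀ i ≤ t, 0 ≤ h (x i)) ∧ ∀ i < t, h (x i) < s} :=
  fun _ _ hxy hx => ⟨hxy t le_rfl ▸ hx.1, fun i hi => hxy i hi ▸ hx.2.1 i hi,
    fun i hi => hxy i hi.le ▸ hx.2.2 i hi⟩

theorem measurableSet_reachSet (s : ℕ) : MeasurableSet (reachSet h s) := by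
  rw [reachSet_eq_iUnion]
  exact MeasurableSet.iUnion fun t => (initDet_reach s t).measurableSet

theorem aheadLocal_reachSet (s : ℕ) : AheadLocal h (reachSet h s) := by
  rw [reachSet_eq_iUnion]
  refine aheadLocal_iUnion (initDet_reach s) ?_ fun n x hx i hi => hx.2.1 i hi.le
  intro i j hij
  rw [Function.onFun, Set.disjoint_left]
  intro x hx hx'
  rcases lt_or_gt_of_ne hij with hlt | hlt
  · exact absurd (hx'.2.2 i hlt) (not_lt.2 hx.1)
  · exact absurd (hx.2.2 j hlt) (not_lt.2 hx'.1)

theorem measurableSet_aheadSet : MeasurableSet (aheadSet h) := by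
  have : aheadSet h = (⋂ i, {x | 0 ≤ h (x i)}) ∩ ⋂ k : ℕ, ⋃ i, {x | (k : ℤ) ≤ h (x i)} := by
    ext x; simp [aheadSet]
  rw [this]
  have hm : ∀ i (c : ℤ), MeasurableSet {x : ℕ → Site d | c ≤ h (x i)} := fun i c =>
    measurableSet_le measurable_const ((measurable_of_countable h).comp (measurable_pi_apply i))
  exact (MeasurableSet.iInter fun i => hm i 0).inter
    (MeasurableSet.iInter fun k => MeasurableSet.iUnion fun i => hm i k)

theorem aheadLocal_aheadSet_inter {A : Set (ℕ → Site d)} (hA : MeasurableSet A) :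
    AheadLocal h (A ∩ aheadSet h) :=
  aheadLocal_of_forall (hA.inter measurableSet_aheadSet) fun _ hx i => hx.2.1 i

/-- To see that the height is nonnegative at time `i`, use a level above everything reached up to
time `i`: it is reached later, and the path is nonnegative until then. -/
theorem iInter_reachSet : ⋂ s, reachSet h s = aheadSet h := by
  ext x
  simp only [Set.mem_iInter]
  constructor
  · intro hx
    refine ⟨fun i => ?_, fun k => ?_⟩
    · obtain ⟨M, hM⟩ : ∃ M : ℕ, ∀ k ≤ i, h (x k) < M := by
        refine ⟨∑ k ∈ Finset.range (i + 1), (h (x k)).toNat + 1, fun k hk => ?_⟩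
        have : (h (x k)).toNat ≤ ∑ k ∈ Finset.range (i + 1), (h (x k)).toNat :=
          Finset.single_le_sum (f := fun k => (h (x k)).toNat) (fun _ _ => Nat.zero_le _)
          (Finset.mem_range.2 (Nat.lt_succ_of_le hk))
        omega
      obtain ⟨t, ht, ht'⟩ := hx M
      refine ht' i ?_
      by_contra hlt
      exact absurd (hM t (by omega)) (not_lt.2 ht)
    · obtain ⟨t, ht, -⟩ := hx k
      exact ⟨t, ht⟩
  · rintro ⟨h0, h1⟩ s
    obtain ⟨t, ht⟩ := h1 s
    exact ⟨t, ht, fun i _ => h0 i⟩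

theorem tendsto_pathLaw_reachSet :
    Tendsto (fun s => pathLaw m (reachSet h s)) atTop (𝓝 (pathLaw m (aheadSet h))) := by
  rw [← iInter_reachSet]
  refine tendsto_measure_iInter_atTop (fun s => (measurableSet_reachSet s).nullMeasurableSet) ?_
    ⟨0, measure_ne_top _ _⟩
  rintro s s' hs x ⟨t, ht, ht'⟩
  exact ⟨t, by have : (s : ℤ) ≤ s' := by exact_mod_cast hs
               exact this.trans ht, ht'⟩

/-- A path goes below its starting height for the first time at one time at most, so the events of a
late first return decrease to the empty set. -/
theorem tendsto_pathLaw_returnSet :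
    Tendsto (fun r => pathLaw m (⋃ n, if r < n then returnSet h n else ∅)) atTop (𝓝 0) := by
  have : ⋂ r : ℕ, (⋃ n, if r < n then returnSet h n else ∅) = (∅ : Set (ℕ → Site d)) := by
    rw [Set.eq_empty_iff_forall_notMem]
    intro x hx
    have h1 : ∀ r, ∃ n, r < n ∧ x ∈ returnSet h n := by
      intro r
      obtain ⟨n, hn⟩ := Set.mem_iUnion.1 (Set.mem_iInter.1 hx r)
      refine ⟨n, ?_⟩
      split_ifs at hn with hr
      · exact ⟨hr, hn⟩
      · exact absurd hn (Set.notMem_empty _)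
    obtain ⟨n, -, hn⟩ := h1 0
    obtain ⟨n', hlt, hn'⟩ := h1 n
    exact absurd (hn'.2 n hlt) (not_le.2 hn.1)
  have hlim := tendsto_measure_iInter_atTop (μ := pathLaw m)
    (s := fun r : ℕ => ⋃ n, if r < n then returnSet h n else ∅) (fun r => ?_) ?_
    ⟨0, measure_ne_top _ _⟩
  · rwa [this, measure_empty] at hlim
  · refine (MeasurableSet.iUnion fun n => ?_).nullMeasurableSet
    split_ifs
    · exact (initDet_returnSet n).measurableSet
    · exact MeasurableSet.empty
  · intro r r' hr
    refine Set.iUnion_mono fun n => ?_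
    by_cases hn : r' < n
    · rw [if_pos hn, if_pos (by omega)]
    · rw [if_neg hn]; exact Set.empty_subset _

theorem aheadLocal_return (r : ℕ) :
    AheadLocal h (⋃ n, if r < n then returnSet h n else ∅) := by
  refine aheadLocal_iUnion (fun n => ?_) (fun i j hij => ?_) fun n x hx i hi => ?_
  · split_ifs
    · exact initDet_returnSet n
    · exact fun _ _ _ hx => hx
  · have := pairwise_disjoint_returnSet (h := h) hij
    rw [Function.onFun] at this ⊢
    split_ifs <;> simp [this]
  · split_ifs at hx
    · exact hx.2 i hi
    · exact absurd hx (Set.notMem_empty _)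

theorem initDet_slow (s : ℤ) (j : ℕ) (a : ℤ) (t : ℕ) : InitDet t {x : ℕ → Site d | x 0 = 0 ∧
    (∀ i < t, x (i + 1) - x i ∈ unitVectors d) ∧ a + h (x t) = s ∧
    (∀ i < t, a + h (x i) < s) ∧
    ((Finset.range t).filter fun i => a + h (x i) = -1 ∧ a + h (x (i + 1)) = 0).card ≤ j} := by
  rintro x y hxy ⟨h0, h1, h2, h3, h4⟩
  refine ⟨hxy 0 (by omega) ▸ h0, fun i hi => ?_, hxy t le_rfl ▸ h2,
    fun i hi => hxy i hi.le ▸ h3 i hi, ?_⟩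
  · rw [← hxy i (by omega), ← hxy (i + 1) (by omega)]
    exact h1 i hi
  · convert h4 using 2
    refine Finset.filter_congr fun i hi => ?_
    have := Finset.mem_range.1 hi
    rw [← hxy i (by omega), ← hxy (i + 1) (by omega)]

theorem measurableSet_slowSet (s : ℤ) (j : ℕ) (a : ℤ) : MeasurableSet (slowSet h s j a) := by
  have : slowSet h s j a = ⋃ t, {x : ℕ → Site d | x 0 = 0 ∧
    (∀ i < t, x (i + 1) - x i ∈ unitVectors d) ∧ a + h (x t) = s ∧
    (∀ i < t, a + h (x i) < s) ∧
    ((Finset.range t).filter fun i => a + h (x i) = -1 ∧ a + h (x (i + 1)) = 0).card ≤ j} := by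
    ext x; simp only [slowSet, Set.mem_ofPred_eq, Set.mem_iUnion]
  rw [this]
  exact MeasurableSet.iUnion fun t => (initDet_slow s j a t).measurableSet

/-- A nearest-neighbour path which starts at or below height `0` crosses level `k` before
reaching higher levels. -/
theorem exists_first_crossing (hh : ∀ e ∈ unitVectors d, |h e| ≤ 1) {x : ℕ → Site d} {t : ℕ}
    (hx : ∀ i < t, x (i + 1) - x i ∈ unitVectors d) {k : ℤ} (h0 : h (x 0) ≤ k)
    (hk : k ≤ h (x t)) : ∃ i ≤ t, FirstHit h k i x := by
  classical
  have hex : ∃ i, k ≤ h (x i) := ⟨t, hk⟩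
  have hle : Nat.find hex ≤ t := Nat.find_min' hex hk
  refine ⟨Nat.find hex, hle, le_antisymm ?_ (Nat.find_spec hex),
    fun i hi => not_le.1 (Nat.find_min hex hi)⟩
  rcases Nat.eq_zero_or_pos (Nat.find hex) with hz | hz
  · rw [hz]; exact h0
  · have h1 := not_le.1 (Nat.find_min hex (Nat.sub_lt hz one_pos))
    have h2 := hh _ (hx (Nat.find hex - 1) (by omega))
    rw [Nat.sub_add_cancel hz, map_sub, abs_le] at h2
    omega

end

/-! ### Null advance makes few upcrossings unlikely -/

section

variable {d : ℕ} {h : Site d →+ ℤ} {m : Measure (LocalEnv d)} [IsProbabilityMeasure m]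

/-- A nearest-neighbour path from a negative height to a nonnegative one crosses from -1 to 0 at
least once. -/
theorem slowSet_eq_empty (hh : ∀ e ∈ unitVectors d, |h e| ≤ 1) {s a : ℤ} (hs : 0 ≤ s)
    (ha : a < 0) : slowSet h s 0 a = ∅ := by
  rw [Set.eq_empty_iff_forall_notMem]
  rintro x ⟨t, h0, h1, h2, -, h4⟩
  obtain ⟨i, hi, hi1, hi2⟩ := exists_first_crossing hh h1 (k := -a) (by rw [h0, map_zero]; omega)
    (by omega)
  rw [Nat.le_zero, Finset.card_eq_zero, Finset.filter_eq_empty_iff] at h4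
  rcases Nat.eq_zero_or_pos i with hz | hz
  · rw [hz, h0, map_zero] at hi1; omega
  · have h3 := hh _ (h1 (i - 1) (by omega))
    have h5 := hi2 (i - 1) (by omega)
    have h6 := h4 (Finset.mem_range.2 (show i - 1 < t by omega))
    rw [Nat.sub_add_cancel hz] at h3 h6
    rw [map_sub, abs_le] at h3
    omega

/-- The part of a slow path after an intermediate time. -/
theorem slow_recenter {s : ℤ} {j j' : ℕ} {a b : ℤ} {x : ℕ → Site d} {i : ℕ}
    (hab : a + h (x i) = b)
    (hx : ∃ t, i ≤ t ∧ x 0 = 0 ∧ (∀ i < t, x (i + 1) - x i ∈ unitVectors d) ∧ a + h (x t) = s ∧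
    (∀ i < t, a + h (x i) < s) ∧
    ((Finset.range t).filter fun i => a + h (x i) = -1 ∧ a + h (x (i + 1)) = 0).card ≤ j)
    (hj : ∀ t, i ≤ t →
      ((Finset.range t).filter fun i => a + h (x i) = -1 ∧ a + h (x (i + 1)) = 0).card ≤ j →
      (((Finset.range t).filter fun k => i ≤ k ∧
        (a + h (x k) = -1 ∧ a + h (x (k + 1)) = 0))).card ≤ j') :
    recenter i x ∈ slowSet h s j' b := by
  obtain ⟨t, hit, h0, h1, h2, h3, h4⟩ := hx
  obtain ⟨u, rfl⟩ := Nat.exists_eq_add_of_le hit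
  refine ⟨u, by simp [recenter], fun k hk => ?_, ?_, fun k hk => ?_, ?_⟩
  · have := h1 (i + k) (by omega)
    simpa [recenter, add_assoc] using this
  · simp only [recenter, map_sub]
    omega
  · simp only [recenter, map_sub]
    have := h3 (i + k) (by omega)
    omega
  · refine le_trans (Finset.card_le_card_of_injOn (fun k => i + k) (fun k hk => ?_)
      fun k _ k' _ hkk => by simpa using hkk) (hj (i + u) hit h4)
    simp only [recenter, map_sub, Finset.coe_filter, Finset.mem_range, Set.mem_ofPred_eq] at hk ⊢
    rw [← add_assoc] at hk
    refine ⟨by omega, by omega, ?_, ?_⟩ <;> omega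

/-- The first arrival at absolute height 0 from below is itself an upcrossing, so it uses one unit
of the budget and leaves `j` for the rest of the path. -/
theorem slowSet_subset_iUnion (hh : ∀ e ∈ unitVectors d, |h e| ≤ 1) {s a : ℤ} (hs : 0 ≤ s)
    (ha : a < 0) (j : ℕ) : slowSet h s (j + 1) a ⊆
      ⋃ i, {x | FirstHit h (-a) i x} ∩ recenter i ⁻¹' slowSet h s j 0 := by
  rintro x ⟨t, h0, h1, h2, h3, h4⟩
  obtain ⟨i, hi, hi1, hi2⟩ := exists_first_crossing hh h1 (k := -a) (by rw [h0, map_zero]; omega)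
    (by omega)
  refine Set.mem_iUnion.2 ⟨i, ⟨hi1, hi2⟩, ?_⟩
  refine slow_recenter (by omega) ⟨t, hi, h0, h1, h2, h3, h4⟩ fun u hu hu' => ?_
  rcases Nat.eq_zero_or_pos i with hz | hz
  · rw [hz, h0, map_zero] at hi1; omega
  · have h6 := h1 (i - 1) (by omega)
    have h5 := hi2 (i - 1) (by omega)
    rw [Nat.sub_add_cancel hz] at h6
    have h7 := hh _ h6
    rw [map_sub, abs_le] at h7
    refine Nat.lt_succ_iff.1 (lt_of_lt_of_le (Finset.card_lt_card ?_) hu')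
    -- The step from time `i - 1` to time `i` is the upcrossing that is counted for the whole path
    -- but not for its part after `i`.
    refine Finset.ssubset_iff_of_subset (fun k hk => ?_) |>.2 ⟨i - 1, ?_, ?_⟩
    · simp only [Finset.mem_filter] at hk ⊢
      exact ⟨hk.1, hk.2.2⟩
    · simp only [Finset.mem_filter, Finset.mem_range, Nat.sub_add_cancel hz]
      refine ⟨by omega, by omega, by omega⟩
    · simp only [Finset.mem_filter, not_and]
      intro _ hle
      omega

theorem pairwise_disjoint_firstHit (k : ℤ) :
    Pairwise (Function.onFun Disjoint fun i => {x | FirstHit h k i x}) := by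
  intro i j hij
  rw [Function.onFun, Set.disjoint_left]
  exact fun x hx hx' => hij (FirstHit.unique hx hx')

theorem envBound_slowSet_succ (hh : ∀ e ∈ unitVectors d, |h e| ≤ 1) {s : ℤ} (hs : 0 ≤ s)
    {j : ℕ} {η : ℝ≥0∞} (hη : ∀ y, h y = 0 → EnvBound h m η y (slowSet h s j 0)) {z : Site d}
    (hz : h z < 0) : EnvBound h m η z (slowSet h s (j + 1) (h z)) := by
  refine EnvBound.mono (envBound_iUnion_recenter (fun i => initDet_firstHit h (-h z) i)
    (pairwise_disjoint_firstHit _) (fun i x hx k hk => ?_) (measurableSet_slowSet s j 0)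
    fun i x hx => hη _ ?_) (slowSet_subset_iUnion hh hs hz j) le_rfl
  · have := hx.2 k hk
    rw [map_add]; omega
  · have := hx.1
    rw [map_add]; omega

theorem abs_coord_le_one {e : Site d} (he : e ∈ unitVectors d) (i : Fin d) : |e i| ≤ 1 := by
  simp only [unitVectors, Finset.mem_union, Finset.mem_image, Finset.mem_univ, true_and] at he
  rcases he with ⟨k, rfl⟩ | ⟨k, rfl⟩ <;> by_cases hk : i = k
  all_goals first | (subst hk; simp) | simp [hk]

theorem mem_box {x : ℕ → Site d} {t : ℕ} (h0 : x 0 = 0)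
    (h1 : ∀ i < t, x (i + 1) - x i ∈ unitVectors d) :
    ∀ i ≤ t, x i ∈ Finset.Icc (fun _ : Fin d => -(i : ℤ)) (fun _ => (i : ℤ)) := by
  intro i
  induction i with
  | zero => intro _; simp [h0]; rfl
  | succ i ih =>
    intro hi
    have hxi := ih (by omega)
    rw [Finset.mem_Icc, Pi.le_def, Pi.le_def] at hxi ⊢
    push_cast
    refine ⟨fun c => ?_, fun c => ?_⟩
    all_goals
      have h3 := abs_coord_le_one (h1 i (by omega)) c
      have h4 := hxi.1 c
      have h5 := hxi.2 c
      simp only [Pi.sub_apply, abs_le] at h3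
      omega

/-- There are three possibilities: level `s` is reached without a return, the first return comes
after time `r`, or it comes by time `r`. In the last case it happens at height exactly -1 and in a
box of radius `r`, which leaves finitely many space-time points, and the path after the return is
still slow with the same budget. -/
theorem slowSet_subset_union (hh : ∀ e ∈ unitVectors d, |h e| ≤ 1) (s j r : ℕ) :
    slowSet h s j 0 ⊆ (reachSet h s ∪ ⋃ n, if r < n then returnSet h n else ∅) ∪
      ⋃ q ∈ (Finset.range (r + 1) ×ˢ
          (Finset.Icc (fun _ : Fin d => -(r : ℤ)) (fun _ => (r : ℤ)))).filter (fun q => h q.2 = -1),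
        {x | x q.1 = q.2} ∩ recenter q.1 ⁻¹' slowSet h s j (-1) := by
  classical
  rintro x ⟨t, h0, h1, h2, h3, h4⟩
  by_cases hall : ∀ i ≤ t, 0 ≤ h (x i)
  · exact Or.inl (Or.inl ⟨t, by omega, hall⟩)
  push Not at hall
  have hex : ∃ i, h (x i) < 0 := by
    obtain ⟨i, -, hi⟩ := hall
    exact ⟨i, hi⟩
  set i := Nat.find hex with hi_def
  have hit : i ≤ t := by
    obtain ⟨k, hk, hk'⟩ := hall
    exact (Nat.find_min' hex hk').trans hk
  have hi : h (x i) < 0 := Nat.find_spec hex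
  have hi' : ∀ k < i, 0 ≤ h (x k) := fun k hk => not_lt.1 (Nat.find_min hex hk)
  by_cases hir : r < i
  · refine Or.inl (Or.inr (Set.mem_iUnion.2 ⟨i, ?_⟩))
    rw [if_pos hir]
    exact ⟨hi, hi'⟩
  refine Or.inr (Set.mem_iUnion₂.2 ⟨(i, x i), ?_, rfl, ?_⟩)
  · have hbox := mem_box h0 h1 i hit
    rw [Finset.mem_Icc, Pi.le_def, Pi.le_def] at hbox
    simp only [Finset.mem_filter, Finset.mem_product, Finset.mem_range, Finset.mem_Icc, Pi.le_def]
    refine ⟨⟨by omega, fun c => ?_, fun c => ?_⟩, ?_⟩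
    · have := hbox.1 c
      omega
    · have := hbox.2 c
      omega
    · rcases Nat.eq_zero_or_pos i with hz | hz
      · rw [hz, h0, map_zero] at hi; omega
      · have h6 := hh _ (h1 (i - 1) (by omega))
        have h5 := hi' (i - 1) (by omega)
        rw [Nat.sub_add_cancel hz, map_sub, abs_le] at h6
        omega
  · refine slow_recenter ?_ ⟨t, hit, h0, h1, h2, h3, h4⟩ fun u hu hu' => ?_
    · change 0 + h (x i) = -1
      rcases Nat.eq_zero_or_pos i with hz | hz
      · rw [hz, h0, map_zero] at hi; omega
      · have h6 := hh _ (h1 (i - 1) (by omega))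
        have h5 := hi' (i - 1) (by omega)
        rw [Nat.sub_add_cancel hz, map_sub, abs_le] at h6
        omega
    · refine (Finset.card_le_card fun k hk => ?_).trans hu'
      simp only [Finset.mem_filter] at hk ⊢
      exact ⟨hk.1, hk.2.2⟩

/-- Each of the three possibilities receives a third of `η`. The order of choices matters: `r` makes
late returns rare, `r` determines the finite set of return points, and only then is `s` taken large
enough for the bound from each of these points. -/
theorem eventually_envBound_of_behind (hh : ∀ e ∈ unitVectors d, |h e| ≤ 1)
    (h0 : pathLaw m (aheadSet h) = 0) {j : ℕ}
    (hb : ∀ η : ℝ≥0∞, η ≠ 0 → ∀ᶠ s : ℕ in atTop, ∀ z, h z = -1 →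
      EnvBound h m η z (slowSet h s j (-1))) {η : ℝ≥0∞} (hη : η ≠ 0) :
    ∀ᶠ s : ℕ in atTop, ∀ y, h y = 0 → EnvBound h m η y (slowSet h s j 0) := by
  have hη3 : η / 3 ≠ 0 := ENNReal.div_ne_zero.2 ⟨hη, by simp⟩
  obtain ⟨r, hr⟩ := ((tendsto_pathLaw_returnSet (h := h) (m := m)).eventually_le_const
    (pos_iff_ne_zero.2 hη3)).exists
  set I := (Finset.range (r + 1) ×ˢ
    (Finset.Icc (fun _ : Fin d => -(r : ℤ)) (fun _ => (r : ℤ)))).filter (fun q => h q.2 = -1)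
  have hreach := (tendsto_pathLaw_reachSet (h := h) (m := m)).eventually_le_const
    (h0.symm ▸ pos_iff_ne_zero.2 hη3)
  filter_upwards [hreach, hb (η / 3 / (I.card + 1)) (ENNReal.div_ne_zero.2 ⟨hη3, by simp⟩)]
    with s hs hs' y hy
  have hmret : MeasurableSet (⋃ n, if r < n then returnSet h n else ∅) := by
    refine MeasurableSet.iUnion fun n => ?_
    split_ifs
    · exact (initDet_returnSet n).measurableSet
    · exact MeasurableSet.empty
  have hb1 : EnvBound h m (I.card * (η / 3 / (I.card + 1))) y
      (⋃ q ∈ I, {x | x q.1 = q.2} ∩ recenter q.1 ⁻¹' slowSet h s j (-1)) := by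
    refine EnvBound.biUnion I (fun q hq => ?_) fun q hq => ?_
    · refine envBound_of_recenter (measurableSet_slowSet _ _ _) (hs' _ ?_)
      rw [map_add, hy, (Finset.mem_filter.1 hq).2, zero_add]
    · exact (measurableSet_eq_fun (measurable_pi_apply _) measurable_const).inter
        (measurable_recenter _ (measurableSet_slowSet _ _ _))
  refine EnvBound.mono (((envBound_aheadLocal (measurableSet_reachSet s)
    (aheadLocal_reachSet s) hy).union (measurableSet_reachSet s)
    (envBound_aheadLocal hmret (aheadLocal_return r) hy)).union
    ((measurableSet_reachSet s).union hmret) hb1) (slowSet_subset_union hh s j r) ?_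
  have h3 : (I.card : ℝ≥0∞) * (η / 3 / (I.card + 1)) ≤ η / 3 := by
    calc (I.card : ℝ≥0∞) * (η / 3 / (I.card + 1)) ≤ (I.card + 1) * (η / 3 / (I.card + 1)) :=
          mul_le_mul_left le_self_add _
      _ = η / 3 := ENNReal.mul_div_cancel (by simp) (by simp)
  calc _ ≤ η / 3 + η / 3 + η / 3 := add_le_add (add_le_add hs hr) h3
    _ = η := ENNReal.add_thirds η

/-- Induction on the budget of upcrossings. A walk behind height 0 must spend one upcrossing before
it is at height 0 again, and up to that moment it sees only the environment in `{h < 0}`, in which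
the bound is uniform. With budget 0 this is impossible. -/
theorem eventually_envBound_slowSet (hh : ∀ e ∈ unitVectors d, |h e| ≤ 1)
    (h0 : pathLaw m (aheadSet h) = 0) (j : ℕ) : ∀ η : ℝ≥0∞, η ≠ 0 →
    ∀ᶠ s : ℕ in atTop, ∀ y, h y = 0 → EnvBound h m η y (slowSet h s j 0) := by
  induction j with
  | zero =>
    intro η hη
    refine eventually_envBound_of_behind hh h0 (fun η' hη' => ?_) hη
    filter_upwards with s z hz
    rw [slowSet_eq_empty hh (by omega) (by omega)]
    exact envBound_empty
  | succ j ih =>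
    intro η hη
    refine eventually_envBound_of_behind hh h0 (fun η' hη' => ?_) hη
    filter_upwards [ih η' hη'] with s hs z hz
    have := envBound_slowSet_succ hh (s := s) (by omega) hs (z := z) (by omega)
    rwa [hz] at this

end

/-! ### Null advance forces nonpositive speed -/

section

variable {d : ℕ} {h : Site d →+ ℤ} {m : Measure (LocalEnv d)} [IsProbabilityMeasure m]

/-- After hitting level `k`, the walk reaches level `k + s` with few upcrossings of
`{k - 1, k}`. -/
def quickSet (h : Site d →+ ℤ) (s j k : ℕ) : Set (ℕ → Site d) :=
  ⋃ t, {x | FirstHit h k t x} ∩ recenter t ⁻¹' slowSet h s j 0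

/-- The passage from `k` to `k + s` is complete by the time a level `k' ≥ k + s` is first hit. -/
theorem initDet_quickSet_inter {s j k k' t : ℕ} (hk : k + s ≤ k') :
    InitDet t (quickSet h s j k ∩ {x | FirstHit h k' t x}) := by
  rintro x y hxy ⟨hx, hxt⟩
  refine ⟨?_, initDet_firstHit h k' t hxy hxt⟩
  obtain ⟨u, hu, v, hv⟩ := Set.mem_iUnion.1 hx
  have huv : u + v ≤ t := by
    by_contra hlt
    have h1 : h (x t) = k' := hxt.1
    rcases lt_or_ge t u with htu | htu
    · have := hu.2 t htu
      omega
    · obtain ⟨c, rfl⟩ := Nat.exists_eq_add_of_le htu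
      have h2 := hv.2.2.2.1 c (by omega)
      have h3 := hu.1
      simp only [recenter, map_sub] at h2
      omega
  have hxy' : ∀ i ≤ v, recenter u x i = recenter u y i := fun i hi => by
    simp only [recenter, hxy u (by omega), hxy (u + i) (by omega)]
  exact Set.mem_iUnion.2 ⟨u, initDet_firstHit h k u (fun i hi => hxy i (by omega)) hu,
    v, initDet_slow s j 0 v hxy' hv⟩

/-- Levels in one residue class modulo `s` are at least `s` apart, so the earlier events are decided
when the largest level is first hit. Given that past, the last event has probability at most `η`. -/
theorem pathLaw_biInter_quickSet_le {s j r : ℕ} {η : ℝ≥0∞}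
    (hη : EnvBound h m η 0 (slowSet h s j 0)) (I : Finset ℕ) :
    pathLaw m (⋂ i ∈ I, quickSet h s j (i * s + r)) ≤ η ^ I.card := by
  classical
  induction I using Finset.induction_on_max with
  | empty => simp
  | insert a I ha ih =>
    rw [Finset.card_insert_of_notMem fun hh => lt_irrefl a (ha a hh), pow_succ']
    set G := ⋂ i ∈ I, quickSet h s j (i * s + r) with hG
    have hdet : ∀ t, InitDet t (G ∩ {x | FirstHit h ((a * s + r : ℕ) : ℤ) t x}) := by
      intro t x y hxy hx
      refine ⟨?_, initDet_firstHit h _ t hxy hx.2⟩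
      refine Set.mem_iInter₂.2 fun i hi => ?_
      have h1 : i * s + r + s ≤ a * s + r := by
        have := Nat.mul_le_mul_right s (ha i hi)
        rw [Nat.succ_mul] at this
        omega
      exact (initDet_quickSet_inter (t := t) h1 hxy ⟨Set.mem_iInter₂.1 hx.1 i hi, hx.2⟩).1
    have hdisj : Pairwise (Function.onFun Disjoint
        fun t => G ∩ {x | FirstHit h ((a * s + r : ℕ) : ℤ) t x}) := by
      intro t t' ht
      exact (pairwise_disjoint_firstHit _ ht).mono Set.inter_subset_right Set.inter_subset_right
    have hsub : (⋂ i ∈ insert a I, quickSet h s j (i * s + r)) ⊆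
        ⋃ t, (G ∩ {x | FirstHit h ((a * s + r : ℕ) : ℤ) t x}) ∩
          recenter t ⁻¹' slowSet h s j 0 := by
      intro x hx
      rw [Finset.set_biInter_insert] at hx
      obtain ⟨t, ht, ht'⟩ := Set.mem_iUnion.1 hx.1
      exact Set.mem_iUnion.2 ⟨t, ⟨hx.2, ht⟩, ht'⟩
    calc _ ≤ ∑' t, pathLaw m ((G ∩ {x | FirstHit h ((a * s + r : ℕ) : ℤ) t x}) ∩
          recenter t ⁻¹' slowSet h s j 0) := (measure_mono hsub).trans (measure_iUnion_le _)
      _ ≤ ∑' t, η * pathLaw m (G ∩ {x | FirstHit h ((a * s + r : ℕ) : ℤ) t x}) :=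
          ENNReal.tsum_le_tsum fun t => pathLaw_inter_recenter_le m (hdet t) (fun x hx => hx.2)
            (measurableSet_slowSet _ _ _) hη
      _ = η * pathLaw m (⋃ t, G ∩ {x | FirstHit h ((a * s + r : ℕ) : ℤ) t x}) := by
          rw [ENNReal.tsum_mul_left, measure_iUnion hdisj fun t => (hdet t).measurableSet]
      _ ≤ η * η ^ I.card :=
          mul_le_mul_right ((measure_mono (Set.iUnion_subset fun t => Set.inter_subset_left)).trans
            ih) _

open Classical in
-- Each level that is not passed quickly contributes at least `j + 1` upcrossings before time `t`,
-- and upcrossings into different levels happen at different times.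
theorem le_firstHit_time (hh : ∀ e ∈ unitVectors d, |h e| ≤ 1) {x : ℕ → Site d} (hx : IsWalk x)
    {s j n t : ℕ} (ht : FirstHit h n t x) (K : Finset ℕ) (hK : ∀ k ∈ K, k + s ≤ n) :
    (j + 1) * (K.filter fun k => x ∉ quickSet h s j k).card ≤ t := by
  have hcross : ∀ k : ℕ, k ≤ n → ∃ i ≤ t, FirstHit h k i x := fun k hk =>
    exists_first_crossing hh (fun i _ => hx.2 i) (by rw [hx.1, map_zero]; omega)
      (by rw [ht.1]; exact_mod_cast hk)
  have hcard : ∀ k ∈ K.filter fun k => x ∉ quickSet h s j k, j + 1 ≤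
      ((Finset.range t).filter fun i => h (x i) = (k : ℤ) - 1 ∧ h (x (i + 1)) = k).card := by
    intro k hk
    rw [Finset.mem_filter] at hk
    obtain ⟨u, hu, hu'⟩ := hcross k (by have := hK k hk.1; omega)
    obtain ⟨v, hv, hv'⟩ := hcross (k + s) (hK k hk.1)
    have huv : u ≤ v := by
      by_contra hlt
      have h1 := hu'.2 v (by omega)
      have h2 := hv'.1
      push_cast at h2
      omega
    obtain ⟨w, rfl⟩ := Nat.exists_eq_add_of_le huv
    by_contra hlt
    refine hk.2 (Set.mem_iUnion.2 ⟨u, hu', w, by simp [recenter], fun i _ => ?_, ?_,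
      fun i hi => ?_, ?_⟩)
    · simpa [recenter, add_assoc] using hx.2 (u + i)
    · have h1 := hu'.1
      have h2 := hv'.1
      push_cast at h2
      simp only [recenter, map_sub]
      omega
    · have h1 := hu'.1
      have h2 := hv'.2 (u + i) (by omega)
      push_cast at h2
      simp only [recenter, map_sub]
      omega
    · refine le_trans (Finset.card_le_card_of_injOn (fun i => u + i) (fun i hi => ?_)
        fun i _ i' _ hii => by simpa using hii) (Nat.lt_succ_iff.1 (not_le.1 hlt))
      have h1 := hu'.1
      simp only [recenter, map_sub, Finset.coe_filter, Finset.mem_range,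
        Set.mem_ofPred_eq] at hi ⊢
      rw [← add_assoc] at hi
      refine ⟨by omega, ?_, ?_⟩ <;> omega
  rw [mul_comm]
  refine (Finset.card_nsmul_le_sum _ _ _ hcard).trans ?_
  rw [← Finset.card_biUnion]
  · refine (Finset.card_le_card (Finset.biUnion_subset.2 fun k _ => Finset.filter_subset _ _)).trans
      (Finset.card_range t).le
  · intro k _ k' _ hkk
    rw [Function.onFun, Finset.disjoint_left]
    intro i hi hi'
    simp only [Finset.mem_filter] at hi hi'
    exact hkk (by have := hi.2.2.symm.trans hi'.2.2; exact_mod_cast this)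

/-- The event that level `(n + 1) s` is reached too early. -/
def earlySet (h : Site d →+ ℤ) (s j n : ℕ) : Set (ℕ → Site d) :=
  {x | IsWalk x ∧ ∃ t, FirstHit h ((n + 1) * s : ℕ) t x ∧ 2 * t < (j + 1) * (s * n)}

open Classical in
-- Pigeonhole: if every residue class modulo `s` had at least half of its `n` levels crossed more
-- than `j` times, the walk would have spent at least `(j + 1) s n / 2` steps.
theorem earlySet_subset (hh : ∀ e ∈ unitVectors d, |h e| ≤ 1) (s j n : ℕ) :
    earlySet h s j n ⊆ ⋃ r ∈ Finset.range s,
      ⋃ I ∈ (Finset.range n).powerset.filter fun I => n < 2 * I.card,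
        ⋂ i ∈ I, quickSet h s j (i * s + r) := by
  rintro x ⟨hx, t, ht, hlt⟩
  by_contra hcon
  have hle : ∀ r < s, n ≤ 2 * ((Finset.range n).filter fun i =>
      x ∉ quickSet h s j (i * s + r)).card := by
    intro r hr
    by_contra hlt'
    refine hcon (Set.mem_iUnion₂.2 ⟨r, Finset.mem_range.2 hr, Set.mem_iUnion₂.2
      ⟨(Finset.range n).filter fun i => x ∈ quickSet h s j (i * s + r), ?_, ?_⟩⟩)
    · rw [Finset.mem_filter, Finset.mem_powerset]
      refine ⟨Finset.filter_subset _ _, ?_⟩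
      have := Finset.card_filter_add_card_filter_not (s := Finset.range n)
        (fun i => x ∈ quickSet h s j (i * s + r))
      rw [Finset.card_range] at this
      omega
    · exact Set.mem_iInter₂.2 fun i hi => (Finset.mem_filter.1 hi).2
  have h1 := le_firstHit_time hh hx ht (s := s) (j := j) (Finset.range (n * s)) fun k hk => by
    have := Finset.mem_range.1 hk
    rw [Nat.succ_mul]
    omega
  have h2 : ∑ r ∈ Finset.range s, ((Finset.range n).filter fun i =>
      x ∉ quickSet h s j (i * s + r)).card ≤
      ((Finset.range (n * s)).filter fun k => x ∉ quickSet h s j k).card := by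
    rw [← Finset.card_sigma]
    refine Finset.card_le_card_of_injOn (fun q => q.2 * s + q.1) (fun q hq => ?_) ?_
    · simp only [Finset.coe_sigma, Set.mem_sigma_iff, Finset.mem_coe, Finset.mem_filter,
        Finset.mem_range] at hq ⊢
      refine ⟨?_, hq.2.2⟩
      have := Nat.mul_le_mul_right s hq.2.1
      rw [Nat.succ_mul] at this
      omega
    · rintro ⟨r, i⟩ hq ⟨r', i'⟩ hq' heq
      simp only [Finset.coe_sigma, Set.mem_sigma_iff, Finset.mem_coe, Finset.mem_filter,
        Finset.mem_range] at hq hq' heq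
      have hr : r = r' := by
        have := congrArg (· % s) heq
        simpa [Nat.add_mod, Nat.mod_eq_of_lt hq.1,
          Nat.mod_eq_of_lt hq'.1] using this
      subst hr
      have : i * s = i' * s := by omega
      rw [Nat.eq_of_mul_eq_mul_right (by omega) this]
  have h3 : s * n ≤ 2 * ∑ r ∈ Finset.range s, ((Finset.range n).filter fun i =>
      x ∉ quickSet h s j (i * s + r)).card := by
    rw [Finset.mul_sum]
    calc s * n = ∑ r ∈ Finset.range s, n := by simp
      _ ≤ _ := Finset.sum_le_sum fun r hr => hle r (Finset.mem_range.1 hr)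
  have h4 : (j + 1) * (s * n) ≤ 2 * t := by
    calc (j + 1) * (s * n) ≤ (j + 1) * (2 * ((Finset.range (n * s)).filter fun k =>
          x ∉ quickSet h s j k).card) := Nat.mul_le_mul_left _ (h3.trans (Nat.mul_le_mul_left _ h2))
      _ = 2 * ((j + 1) * ((Finset.range (n * s)).filter fun k =>
          x ∉ quickSet h s j k).card) := by ring
      _ ≤ 2 * t := Nat.mul_le_mul_left _ h1
  omega

/-- A union bound over `s` residues and at most `2 ^ n` sets of more than `n / 2` levels. With 1/16
per level each set costs at most `4 ^ (-n)`, and the total is summable. -/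
theorem pathLaw_earlySet_le (hh : ∀ e ∈ unitVectors d, |h e| ≤ 1) {s j : ℕ}
    (hη : EnvBound h m 16⁻¹ 0 (slowSet h s j 0)) (n : ℕ) :
    pathLaw m (earlySet h s j n) ≤ s * 2⁻¹ ^ n := by
  classical
  have hI : ∀ r, ∀ I ∈ (Finset.range n).powerset.filter fun I => n < 2 * I.card,
      pathLaw m (⋂ i ∈ I, quickSet h s j (i * s + r)) ≤ 4⁻¹ ^ n := by
    intro r I hI
    refine (pathLaw_biInter_quickSet_le hη I).trans ?_
    have h16 : (16⁻¹ : ℝ≥0∞) = 4⁻¹ ^ 2 := by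
      rw [← ENNReal.inv_pow]; norm_num
    rw [h16, ← pow_mul]
    refine pow_le_pow_right_of_le_one' ?_ (Finset.mem_filter.1 hI).2.le
    simp
  calc pathLaw m (earlySet h s j n) ≤ ∑ r ∈ Finset.range s,
        ∑ I ∈ (Finset.range n).powerset.filter fun I => n < 2 * I.card,
          pathLaw m (⋂ i ∈ I, quickSet h s j (i * s + r)) := by
        refine (measure_mono (earlySet_subset hh s j n)).trans
          ((measure_biUnion_finset_le _ _).trans ?_)
        exact Finset.sum_le_sum fun r _ => measure_biUnion_finset_le _ _
    _ ≤ ∑ r ∈ Finset.range s, (2 : ℝ≥0∞) ^ n * 4⁻¹ ^ n := by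
        refine Finset.sum_le_sum fun r _ => ?_
        refine (Finset.sum_le_card_nsmul _ _ _ (hI r)).trans ?_
        rw [nsmul_eq_mul]
        refine mul_le_mul_left ?_ _
        calc _ ≤ (((Finset.range n).powerset.card : ℕ) : ℝ≥0∞) := by
              exact_mod_cast Finset.card_filter_le _ _
          _ = 2 ^ n := by simp
    _ = s * 2⁻¹ ^ n := by
        rw [Finset.sum_const, Finset.card_range, nsmul_eq_mul, ← mul_pow]
        congr 2
        rw [show (4 : ℝ≥0∞) = 2 * 2 by norm_num, ENNReal.mul_inv (by simp) (by simp),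
          ← mul_assoc, ENNReal.mul_inv_cancel (by simp) (by simp), one_mul]

/-- If with probability one the walk eventually returns below its starting height or stays
bounded, its speed in that direction is not positive. -/
theorem ae_forall_exists_le (hh : ∀ e ∈ unitVectors d, |h e| ≤ 1)
    (h0 : pathLaw m (aheadSet h) = 0) :
    ∀ᵐ x ∂(pathLaw m), ∀ j : ℕ, ∃ K : ℤ, ∀ n : ℕ, ((j : ℤ) + 1) * h (x n) ≤ 2 * n + K := by
  rw [ae_all_iff]
  intro j
  obtain ⟨s, hs, hs1⟩ := ((eventually_envBound_slowSet hh h0 j (16⁻¹) (by simp)).and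
    (eventually_ge_atTop 1)).exists
  have hsum : ∑' n, pathLaw m (earlySet h s j n) ≠ ∞ := by
    refine ne_top_of_le_ne_top ?_ (ENNReal.tsum_le_tsum fun n =>
      pathLaw_earlySet_le hh (hs 0 (map_zero h)) n)
    rw [ENNReal.tsum_mul_left, ENNReal.tsum_geometric]
    refine ENNReal.mul_ne_top (by simp) (ENNReal.inv_ne_top.2 ?_)
    rw [ENNReal.one_sub_inv_two]
    simp
  filter_upwards [ae_isWalk_pathLaw m, ae_eventually_notMem hsum] with x hx hev
  obtain ⟨N, hN⟩ := eventually_atTop.1 hev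
  -- Above height `(N + 2) s`, rounding the height down to a multiple `(p + 1) s` gives `p ≥ N`,
  -- where Borel–Cantelli excludes early arrival; the rounding costs at most `2 s`.
  refine ⟨((j : ℤ) + 1) * ((N + 2) * s), fun n => ?_⟩
  have hj : (0 : ℤ) < (j : ℤ) + 1 := by omega
  rcases le_or_gt (h (x n)) ((N + 2) * s) with hle | hgt
  · have := mul_le_mul_of_nonneg_left hle hj.le
    omega
  · obtain ⟨k, hk⟩ := Int.eq_ofNat_of_zero_le (show 0 ≤ h (x n) by
      refine le_trans ?_ hgt.le; positivity)
    rw [hk] at hgt ⊢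
    have hk1 : (N + 2) * s < k := by exact_mod_cast hgt
    set q := k / s with hq
    have hq1 : q * s ≤ k := Nat.div_mul_le_self k s
    have hq2 : k < (q + 1) * s := by
      have := Nat.lt_mul_div_succ k (show 0 < s by omega)
      rwa [mul_comm] at this
    have hqN : N + 2 ≤ q := (Nat.le_div_iff_mul_le (by omega)).2 hk1.le
    obtain ⟨p, hp⟩ := Nat.exists_eq_add_of_le (show 1 ≤ q by omega)
    obtain ⟨t, htn, ht⟩ := exists_first_crossing (h := h) hh (t := n) (fun i _ => hx.2 i)
      (k := ((p + 1) * s : ℕ)) (by rw [hx.1, map_zero]; omega) (by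
        rw [hk, add_comm p 1, ← hp]; exact_mod_cast hq1)
    have h1 := hN p (by omega)
    have h2 : (j + 1) * (s * p) ≤ 2 * t := by
      by_contra hlt
      exact h1 ⟨hx, t, ht, by omega⟩
    have h3 : k ≤ s * p + 2 * s := by
      calc k ≤ (q + 1) * s := hq2.le
        _ = s * p + 2 * s := by rw [hp]; ring
    have h4 : (j + 1) * k ≤ 2 * n + (j + 1) * ((N + 2) * s) := by
      calc (j + 1) * k ≤ (j + 1) * (s * p + 2 * s) := Nat.mul_le_mul_left _ h3
        _ = (j + 1) * (s * p) + (j + 1) * (2 * s) := by ring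
        _ ≤ 2 * n + (j + 1) * ((N + 2) * s) := by
          refine add_le_add (h2.trans (by omega)) (Nat.mul_le_mul_left _ ?_)
          exact Nat.mul_le_mul_right _ (by omega)
    exact_mod_cast h4

end

/-! ### Law of large numbers along a measure preserving map -/

section

/-- If a countably valued map `Y` is independent of the measure preserving map `Θ`, the strong law
of large numbers holds along the iterates of `Θ`. -/
theorem strongLaw_iterate {α β : Type*} [MeasurableSpace α] [MeasurableSpace β] [Countable β]
    [MeasurableSingletonClass β] {μ : Measure α} [IsProbabilityMeasure μ] {Θ : α → α}
    (hΘ : MeasurePreserving Θ μ μ) {Y : α → β} (hY : Measurable Y)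
    (hind : IndepFun Y Θ μ) {f : β → ℝ} (hf : Integrable (fun a => f (Y a)) μ) :
    ∀ᵐ a ∂μ, Tendsto (fun n : ℕ => (∑ i ∈ Finset.range n, f (Y (Θ^[i] a))) / n) atTop
      (𝓝 (∫ a, f (Y a) ∂μ)) := by
  have hfm : Measurable f := measurable_of_countable f
  have hlt : ∀ i k, i < k → IndepFun (fun a => f (Y (Θ^[i] a))) (fun a => f (Y (Θ^[k] a))) μ := by
    intro i k hik
    obtain ⟨c, rfl⟩ := Nat.exists_eq_add_of_lt hik
    have h1 : IndepFun (fun a => f (Y a)) (fun a => f (Y (Θ^[c] (Θ a)))) μ :=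
      hind.comp (φ := f) (ψ := fun a => f (Y (Θ^[c] a))) hfm
        (hfm.comp (hY.comp (hΘ.measurable.iterate c)))
    rw [indepFun_iff_measure_inter_preimage_eq_mul] at h1 ⊢
    intro s t hs ht
    have hs' : MeasurableSet ((fun a => f (Y a)) ⁻¹' s) := (hfm.comp hY) hs
    have ht' : MeasurableSet ((fun a => f (Y (Θ^[c] (Θ a)))) ⁻¹' t) :=
      (hfm.comp (hY.comp ((hΘ.measurable.iterate c).comp hΘ.measurable))) ht
    have hi := hΘ.iterate i
    have h2 := h1 s t hs ht
    rw [← hi.measure_preimage (hs'.inter ht').nullMeasurableSet,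
      ← hi.measure_preimage hs'.nullMeasurableSet,
      ← hi.measure_preimage ht'.nullMeasurableSet] at h2
    have h3 : (fun a => f (Y (Θ^[i + c + 1] a))) ⁻¹' t =
        Θ^[i] ⁻¹' ((fun a => f (Y (Θ^[c] (Θ a)))) ⁻¹' t) := by
      ext a
      simp only [Set.mem_preimage]
      rw [show i + c + 1 = (c + 1) + i by omega, Function.iterate_add_apply,
        Function.iterate_succ_apply]
    rw [h3]
    exact h2
  -- Pairwise independence is sufficient here (Etemadi). It reduces to the independence of `Y` and
  -- `Θ` by pulling back along the smaller iterate.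
  refine strong_law_ae_real (fun i a => f (Y (Θ^[i] a))) hf ?_ fun i => ?_
  · intro i k hik
    rcases lt_or_gt_of_ne hik with h | h
    · exact hlt i k h
    · exact (hlt k i h).symm
  · refine ⟨(hfm.comp (hY.comp (hΘ.measurable.iterate i))).aemeasurable,
      (hfm.comp hY).aemeasurable, ?_⟩
    have h1 : Measurable fun a => f (Y a) := hfm.comp hY
    have h2 := Measure.map_map (μ := μ) h1 (hΘ.measurable.iterate i)
    rw [(hΘ.iterate i).map_eq] at h2
    exact h2.symm

/-- Without integrability the averages of a nonnegative function diverge. -/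
theorem strongLaw_iterate_atTop {α β : Type*} [MeasurableSpace α] [MeasurableSpace β] [Countable β]
    [MeasurableSingletonClass β] {μ : Measure α} [IsProbabilityMeasure μ] {Θ : α → α}
    (hΘ : MeasurePreserving Θ μ μ) {Y : α → β} (hY : Measurable Y)
    (hind : IndepFun Y Θ μ) {f : β → ℕ} (hf : ¬ Integrable (fun a => (f (Y a) : ℝ)) μ) :
    ∀ᵐ a ∂μ, Tendsto (fun n : ℕ => (∑ i ∈ Finset.range n, (f (Y (Θ^[i] a)) : ℝ)) / n) atTop
      atTop := by
  have hmeas : ∀ g : β → ℝ, Measurable fun a => g (Y a) := fun g =>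
    (measurable_of_countable g).comp hY
  have hint : ∀ M : ℕ, Integrable (fun a => (min (f (Y a)) M : ℕ) : α → ℝ) μ := fun M =>
    Integrable.of_bound (hmeas fun b => (min (f b) M : ℕ)).aestronglyMeasurable M
      (ae_of_all _ fun a => by rw [Real.norm_natCast]; exact_mod_cast min_le_right _ _)
  have hlim : Tendsto (fun M : ℕ => ∫ a, ((min (f (Y a)) M : ℕ) : ℝ) ∂μ) atTop atTop := by
    have htop : ∫⁻ a, (f (Y a) : ℝ≥0∞) ∂μ = ∞ := by
      by_contra hne
      refine hf ⟨(hmeas fun b => (f b : ℝ)).aestronglyMeasurable, ?_⟩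
      rw [hasFiniteIntegral_iff_enorm]
      simpa [lt_top_iff_ne_top] using hne
    have h1 : Tendsto (fun M : ℕ => ∫⁻ a, ((min (f (Y a)) M : ℕ) : ℝ≥0∞) ∂μ) atTop (𝓝 ∞) := by
      rw [← htop]
      refine lintegral_tendsto_of_tendsto_of_monotone (fun M => ?_) ?_ ?_
      · exact ((measurable_of_countable fun b => ((min (f b) M : ℕ) : ℝ≥0∞)).comp hY).aemeasurable
      · refine ae_of_all _ fun a M M' hM => ?_
        simp only
        exact_mod_cast min_le_min_left _ hM
      · refine ae_of_all _ fun a => tendsto_const_nhds.congr' ?_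
        filter_upwards [eventually_ge_atTop (f (Y a))] with M hM
        rw [min_eq_left hM]
    rw [tendsto_atTop]
    intro c
    filter_upwards [h1.eventually (lt_mem_nhds (ENNReal.ofReal_lt_top (r := c)))] with M hM
    rw [← ENNReal.ofReal_le_ofReal_iff (integral_nonneg fun a => by positivity),
      ofReal_integral_eq_lintegral_ofReal (hint M) (ae_of_all _ fun a => by positivity)]
    simpa only [ENNReal.ofReal_natCast] using hM.le
  -- The averages dominate those of every truncation at `M`, whose means tend to infinity.
  have hslln := ae_all_iff.2 fun M : ℕ =>
    strongLaw_iterate hΘ hY hind (f := fun b => ((min (f b) M : ℕ) : ℝ)) (hint M)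
  filter_upwards [hslln] with a ha
  rw [tendsto_atTop]
  intro c
  obtain ⟨M, hM⟩ := (hlim.eventually_gt_atTop c).exists
  filter_upwards [(ha M).eventually (lt_mem_nhds hM)] with n hn
  refine hn.le.trans ?_
  gcongr
  exact_mod_cast min_le_left _ _

/-- Convergence of `H n / n` from convergence along a sparse sequence of times. -/
theorem tendsto_div_of_sandwich {H L : ℕ → ℝ} {S : ℕ → ℕ} (hS0 : S 0 = 0) (hS : StrictMono S)
    (hL : ∀ i, 0 ≤ L i) (hH : ∀ i n, S i ≤ n → n < S (i + 1) → L i ≤ H n ∧ H n ≤ L (i + 1)) {v : ℝ}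
    (h1 : Tendsto (fun i => L i / S (i + 1)) atTop (𝓝 v))
    (h2 : Tendsto (fun i => L (i + 1) / S i) atTop (𝓝 v)) :
    Tendsto (fun n => H n / n) atTop (𝓝 v) := by
  have hex : ∀ n, ∃ i, S i ≤ n ∧ n < S (i + 1) := by
    intro n
    have hn : ∃ i, n < S (i + 1) := ⟨n, hS.le_apply⟩
    refine ⟨Nat.find hn, ?_, Nat.find_spec hn⟩
    rcases Nat.eq_zero_or_pos (Nat.find hn) with hz | hz
    · rw [hz, hS0]; exact Nat.zero_le _
    · have := Nat.find_min hn (Nat.sub_lt hz one_pos)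
      rw [show Nat.find hn - 1 + 1 = Nat.find hn by omega] at this
      exact not_lt.1 this
  choose I hI hI' using hex
  have hIt : Tendsto I atTop atTop := by
    rw [tendsto_atTop]
    intro c
    filter_upwards [eventually_ge_atTop (S c)] with n hn
    have := hS.lt_iff_lt.1 (lt_of_le_of_lt hn (hI' n))
    omega
  refine tendsto_of_tendsto_of_tendsto_of_le_of_le' (h1.comp hIt) (h2.comp hIt) ?_ ?_
  · filter_upwards [eventually_gt_atTop 0] with n hn
    simp only [Function.comp]
    have h3 := hH _ _ (hI n) (hI' n)
    have h4 : (0 : ℝ) < n := by exact_mod_cast hn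
    have h5 : (n : ℝ) ≤ S (I n + 1) := by exact_mod_cast (hI' n).le
    calc L (I n) / S (I n + 1) ≤ L (I n) / n := div_le_div_of_nonneg_left (hL _) h4 h5
      _ ≤ H n / n := by gcongr; exact h3.1
  · filter_upwards [hIt.eventually_gt_atTop 0] with n hn
    simp only [Function.comp]
    have h3 := hH _ _ (hI n) (hI' n)
    have h4 : (0 : ℝ) < S (I n) := by
      have := hS hn
      exact_mod_cast (Nat.zero_le _).trans_lt this
    have h5 : (S (I n) : ℝ) ≤ n := by exact_mod_cast hI n
    have h6 : (0 : ℝ) < n := h4.trans_le h5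
    calc H n / n ≤ L (I n + 1) / n := by gcongr; exact h3.2
      _ ≤ L (I n + 1) / S (I n) := div_le_div_of_nonneg_left (hL _) h4 h5

end

/-! ### Regeneration times -/

section

variable {d : ℕ} {h : Site d →+ ℤ} {m : Measure (LocalEnv d)} [IsProbabilityMeasure m]

/-- `t` is a regeneration time: a strict record after which the walk never backtracks. -/
def Regen (h : Site d →+ ℤ) (t : ℕ) (x : ℕ → Site d) : Prop :=
  (∀ i < t, h (x i) < h (x t)) ∧ recenter t x ∈ aheadSet h

theorem measurableSet_record (t : ℕ) :
    MeasurableSet {x : ℕ → Site d | ∀ i < t, h (x i) < h (x t)} :=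
  InitDet.measurableSet (n := t) fun _ _ hxy hx i hi => hxy i hi.le ▸ hxy t le_rfl ▸ hx i hi

theorem measurableSet_regen (t : ℕ) : MeasurableSet {x | Regen h t x} :=
  (measurableSet_record t).inter (measurable_recenter t measurableSet_aheadSet)

theorem IsWalk.height_le (hh : ∀ e ∈ unitVectors d, |h e| ≤ 1) {x : ℕ → Site d} (hx : IsWalk x)
    (n : ℕ) : h (x n) ≤ n := by
  induction n with
  | zero => simp [hx.1]
  | succ n ih =>
    have := hh _ (hx.2 n)
    rw [map_sub, abs_le] at this
    push_cast
    omega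

theorem pathLaw_inter_recenter_compl {k : ℤ} {t : ℕ} {B A : Set (ℕ → Site d)}
    (hB : InitDet t B) (hBF : ∀ x ∈ B, FirstHit h k t x) (hA : MeasurableSet A)
    (hAl : AheadLocal h A) :
    pathLaw m (B ∩ recenter t ⁻¹' Aᶜ) = pathLaw m B * (1 - pathLaw m A) := by
  rw [Set.preimage_compl, ← Set.sdiff_eq, ← Set.sdiff_self_inter,
    measure_sdiff Set.inter_subset_left
      (hB.measurableSet.inter (measurable_recenter t hA)).nullMeasurableSet (measure_ne_top _ _),
    pathLaw_inter_recenter_eq m hB hBF hA hAl,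
    ENNReal.mul_sub fun _ _ => measure_ne_top _ _, mul_one]

theorem aheadLocal_aheadSet : AheadLocal h (aheadSet h) :=
  aheadLocal_of_forall measurableSet_aheadSet fun _ hx => hx.1

theorem measurableSet_unbounded :
    MeasurableSet {x : ℕ → Site d | ∀ k : ℕ, ∃ i, (k : ℤ) ≤ h (x i)} := by
  have : {x : ℕ → Site d | ∀ k : ℕ, ∃ i, (k : ℤ) ≤ h (x i)} =
      ⋂ k : ℕ, ⋃ i, {x | (k : ℤ) ≤ h (x i)} := by
    ext x; simp
  rw [this]
  exact MeasurableSet.iInter fun k => MeasurableSet.iUnion fun i =>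
    measurableSet_le measurable_const ((measurable_of_countable h).comp (measurable_pi_apply i))

/-- A walk that is unbounded above regenerates. -/
theorem ae_exists_regen (hh : ∀ e ∈ unitVectors d, |h e| ≤ 1) (h0 : pathLaw m (aheadSet h) ≠ 0) :
    ∀ᵐ x ∂(pathLaw m), (∀ k : ℕ, ∃ i, (k : ℤ) ≤ h (x i)) → ∃ t, 1 ≤ t ∧ Regen h t x := by
  set G : Set (ℕ → Site d) := {x | IsWalk x} ∩ {x | ∀ k : ℕ, ∃ i, (k : ℤ) ≤ h (x i)} ∩
    ⋂ t, ⋂ (_ : 1 ≤ t), {x | Regen h t x}ᶜ with hG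
  have hGm : MeasurableSet G := (measurableSet_isWalk.inter measurableSet_unbounded).inter
    (MeasurableSet.iInter fun t => MeasurableSet.iInter fun _ => (measurableSet_regen t).compl)
  suffices hz : pathLaw m G = 0 by
    filter_upwards [measure_eq_zero_iff_ae_notMem.1 hz, ae_isWalk_pathLaw m] with x hx hw hu
    by_contra hcon
    push Not at hcon
    exact hx ⟨⟨hw, hu⟩, Set.mem_iInter₂.2 hcon⟩
  have hc1 : (pathLaw m).real (aheadSet h) ≤ 1 := measureReal_le_one
  have hc0 : 0 < (pathLaw m).real (aheadSet h) :=
    ENNReal.toReal_pos h0 (measure_ne_top _ _)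
  -- Whatever happened up to time `n`, the first hit of level `n + 1` is a regeneration with
  -- probability that of `aheadSet`, independently of the past.
  refine measure_eq_zero_of_forall_initDet _ hGm (c := 1 - (pathLaw m).real (aheadSet h))
    (by linarith) fun n B hBm hB => ?_
  -- Level `n + 1` cannot be reached before time `n + 1`, so `B` is already decided when it is hit
  -- and the hitting time is positive.
  have hdet : ∀ u, InitDet (n + 1 + u) (B ∩ {x | FirstHit h (n + 1) (n + 1 + u) x}) := fun u =>
    (hB.mono (by omega)).inter (initDet_firstHit h _ _)
  have hdisj : Pairwise (Function.onFun Disjoint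
      fun u => B ∩ {x | FirstHit h (n + 1) (n + 1 + u) x}) := by
    intro u u' hu
    exact (pairwise_disjoint_firstHit ((n : ℤ) + 1) (show n + 1 + u ≠ n + 1 + u' by omega)).mono
      Set.inter_subset_right Set.inter_subset_right
  have hsub : G ∩ B ⊆ ⋃ u, (B ∩ {x | FirstHit h (n + 1) (n + 1 + u) x}) ∩
      recenter (n + 1 + u) ⁻¹' (aheadSet h)ᶜ := by
    rintro x ⟨⟨⟨hw, hu⟩, hr⟩, hxB⟩
    obtain ⟨i, hi⟩ := hu (n + 1)
    obtain ⟨t, -, ht⟩ := exists_first_crossing (h := h) hh (t := i) (fun i _ => hw.2 i)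
      (k := (n : ℤ) + 1) (by rw [hw.1, map_zero]; omega) (by push_cast at hi; exact hi)
    have h1 := hw.height_le hh t
    rw [ht.1] at h1
    obtain ⟨u, rfl⟩ := Nat.exists_eq_add_of_le (show n + 1 ≤ t by omega)
    refine Set.mem_iUnion.2 ⟨u, ⟨hxB, ht⟩, fun hA => ?_⟩
    exact Set.mem_iInter₂.1 hr (n + 1 + u) (by omega) ⟨fun i hi => ht.1 ▸ ht.2 i hi, hA⟩
  have hle : pathLaw m (G ∩ B) ≤ pathLaw m B * (1 - pathLaw m (aheadSet h)) := by
    calc pathLaw m (G ∩ B) ≤ ∑' u, pathLaw m ((B ∩ {x | FirstHit h (n + 1) (n + 1 + u) x}) ∩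
          recenter (n + 1 + u) ⁻¹' (aheadSet h)ᶜ) :=
          (measure_mono hsub).trans (measure_iUnion_le _)
      _ = ∑' u, pathLaw m (B ∩ {x | FirstHit h (n + 1) (n + 1 + u) x}) *
          (1 - pathLaw m (aheadSet h)) := tsum_congr fun u =>
          pathLaw_inter_recenter_compl (hdet u) (fun x hx => hx.2) measurableSet_aheadSet
            aheadLocal_aheadSet
      _ ≤ _ := by
          rw [ENNReal.tsum_mul_right, ← measure_iUnion hdisj fun u => (hdet u).measurableSet]
          exact mul_le_mul_left (measure_mono (Set.iUnion_subset fun u => Set.inter_subset_left)) _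
  have := ENNReal.toReal_mono (ENNReal.mul_ne_top (measure_ne_top _ _) (by simp)) hle
  rw [ENNReal.toReal_mul, ENNReal.toReal_sub_of_le prob_le_one ENNReal.one_ne_top,
    ENNReal.toReal_one, mul_comm] at this
  exact this

/-- The first positive regeneration time. -/
def regenTime (h : Site d →+ ℤ) (x : ℕ → Site d) : ℕ := sInf {t | 1 ≤ t ∧ Regen h t x}

/-- The walk seen from its first regeneration time. -/
def regenShift (h : Site d →+ ℤ) (x : ℕ → Site d) : ℕ → Site d := recenter (regenTime h x) x

/-- The first regeneration time and the corresponding height. -/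
def regenData (h : Site d →+ ℤ) (x : ℕ → Site d) : ℕ × ℤ := (regenTime h x, h (x (regenTime h x)))

theorem regenTime_spec {x : ℕ → Site d} (hx : ∃ t, 1 ≤ t ∧ Regen h t x) :
    1 ≤ regenTime h x ∧ Regen h (regenTime h x) x := Nat.sInf_mem hx

theorem regenTime_le {x : ℕ → Site d} {t : ℕ} (ht : 1 ≤ t) (htx : Regen h t x) :
    regenTime h x ≤ t := Nat.sInf_le ⟨ht, htx⟩

theorem regenTime_eq_iff {x : ℕ → Site d} {t : ℕ} (ht : 1 ≤ t) :
    regenTime h x = t ↔ Regen h t x ∧ ∀ s, 1 ≤ s → s < t → ¬ Regen h s x := by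
  constructor
  · rintro rfl
    have hne : ({t | 1 ≤ t ∧ Regen h t x} : Set ℕ).Nonempty := by
      by_contra hne
      rw [Set.not_nonempty_iff_eq_empty] at hne
      rw [regenTime, hne, Nat.sInf_empty] at ht
      omega
    refine ⟨(regenTime_spec hne).2, fun s hs hst hr => ?_⟩
    exact absurd (regenTime_le hs hr) (not_le.2 hst)
  · rintro ⟨h1, h2⟩
    refine le_antisymm (regenTime_le ht h1) (not_lt.1 fun hlt => ?_)
    have h3 := regenTime_spec ⟨t, ht, h1⟩
    exact h2 _ h3.1 hlt h3.2

theorem measurable_regenTime : Measurable (regenTime h) := by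
  have hpos : ∀ t, 1 ≤ t → MeasurableSet (regenTime h ⁻¹' {t}) := by
    intro t ht
    have : regenTime h ⁻¹' {t} = {x | Regen h t x} ∩
        ⋂ s, ⋂ (_ : 1 ≤ s), ⋂ (_ : s < t), {x | Regen h s x}ᶜ := by
      ext x
      simp [regenTime_eq_iff ht]
    rw [this]
    exact (measurableSet_regen t).inter (MeasurableSet.iInter fun s => MeasurableSet.iInter
      fun _ => MeasurableSet.iInter fun _ => (measurableSet_regen s).compl)
  refine measurable_to_countable' fun t => ?_
  rcases Nat.eq_zero_or_pos t with rfl | ht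
  · have : regenTime h ⁻¹' {0} = (⋃ t, ⋃ (_ : 1 ≤ t), regenTime h ⁻¹' {t})ᶜ := by
      ext x
      simp only [Set.mem_preimage, Set.mem_singleton_iff, Set.mem_compl_iff, Set.mem_iUnion,
        exists_prop, exists_eq_right']
      omega
    rw [this]
    exact (MeasurableSet.iUnion fun t => MeasurableSet.iUnion fun ht => hpos t ht).compl
  · exact hpos t ht

theorem measurable_of_time {β : Type*} [MeasurableSpace β] {g : ℕ → (ℕ → Site d) → β}
    (hg : ∀ t, Measurable (g t)) : Measurable fun x => g (regenTime h x) x :=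
  (measurable_from_prod_countable_right (f := fun q : ℕ × (ℕ → Site d) => g q.1 q.2) hg).comp
    (measurable_regenTime.prodMk measurable_id)

theorem measurable_regenShift : Measurable (regenShift h) :=
  measurable_of_time fun t => measurable_recenter t

theorem measurable_regenData : Measurable (regenData h) :=
  measurable_regenTime.prodMk (measurable_of_time (g := fun t x => h (x t)) fun t =>
    (measurable_of_countable h).comp (measurable_pi_apply t))

/-- The part of the event `regenTime = t` that concerns the path before time `t`. -/
def preRegen (h : Site d →+ ℤ) (t : ℕ) : Set (ℕ → Site d) :=
  {x | (∀ i ≤ t, 0 ≤ h (x i)) ∧ (∀ i < t, h (x i) < h (x t)) ∧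
    ∀ s, 1 ≤ s → s < t → (∀ i < s, h (x i) < h (x s)) → ∃ i, s ≤ i ∧ i ≤ t ∧ h (x i) < h (x s)}

theorem initDet_preRegen (t : ℕ) : InitDet t (preRegen h t) := by
  rintro x y hxy ⟨h1, h2, h3⟩
  refine ⟨fun i hi => hxy i hi ▸ h1 i hi, fun i hi => hxy i hi.le ▸ hxy t le_rfl ▸ h2 i hi,
    fun s hs hst hr => ?_⟩
  obtain ⟨i, hi, hit, hlt⟩ := h3 s hs hst fun i hi => by
    rw [hxy i (by omega), hxy s hst.le]; exact hr i hi
  exact ⟨i, hi, hit, by rw [← hxy i hit, ← hxy s hst.le]; exact hlt⟩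

theorem recenter_mem_aheadSet_iff {x : ℕ → Site d} {t : ℕ} : recenter t x ∈ aheadSet h ↔
    (∀ i, t ≤ i → h (x t) ≤ h (x i)) ∧ ∀ k : ℕ, ∃ i, (k : ℤ) ≤ h (x i) := by
  simp only [aheadSet, recenter, Set.mem_ofPred_eq, map_sub]
  constructor
  · rintro ⟨h1, h2⟩
    refine ⟨fun i hi => ?_, fun k => ?_⟩
    · obtain ⟨c, rfl⟩ := Nat.exists_eq_add_of_le hi
      have := h1 c
      omega
    · obtain ⟨i, hi⟩ := h2 (k + (-h (x t)).toNat)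
      refine ⟨t + i, ?_⟩
      push_cast at hi
      omega
  · rintro ⟨h1, h2⟩
    refine ⟨fun i => ?_, fun k => ?_⟩
    · have := h1 (t + i) (by omega)
      omega
    · obtain ⟨M, hM⟩ : ∃ M : ℕ, ∀ k ≤ t, h (x k) < M := by
        refine ⟨∑ k ∈ Finset.range (t + 1), (h (x k)).toNat + 1, fun k hk => ?_⟩
        have : (h (x k)).toNat ≤ ∑ k ∈ Finset.range (t + 1), (h (x k)).toNat :=
          Finset.single_le_sum (f := fun k => (h (x k)).toNat) (fun _ _ => Nat.zero_le _)
          (Finset.mem_range.2 (Nat.lt_succ_of_le hk))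
        omega
      obtain ⟨i, hi⟩ := h2 (M + k + (h (x t)).toNat)
      push_cast at hi
      have hti : t ≤ i := by
        by_contra hlt
        have := hM i (by omega)
        omega
      obtain ⟨c, rfl⟩ := Nat.exists_eq_add_of_le hti
      exact ⟨c, by omega⟩

/-- A record time `s < t` that is not a regeneration must be undercut by time `t`, because from `t`
on the path stays at or above the strictly larger record height at `t`. This splits the event into
one about the past and one about the recentred future. -/
theorem aheadSet_inter_regenTime {t : ℕ} (ht : 1 ≤ t) :
    aheadSet h ∩ regenTime h ⁻¹' {t} = preRegen h t ∩ recenter t ⁻¹' aheadSet h := by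
  ext x
  simp only [Set.mem_inter_iff, Set.mem_preimage, Set.mem_singleton_iff, regenTime_eq_iff ht]
  constructor
  · rintro ⟨⟨h0, hu⟩, ⟨hrec, hA⟩, hno⟩
    refine ⟨⟨fun i _ => h0 i, hrec, fun s hs hst hr => ?_⟩, hA⟩
    by_contra hcon
    push Not at hcon
    refine hno s hs hst ⟨hr, recenter_mem_aheadSet_iff.2 ⟨fun i hi => ?_, hu⟩⟩
    rcases le_total i t with hit | hit
    · exact hcon i hi hit
    · exact (hrec s hst).le.trans ((recenter_mem_aheadSet_iff.1 hA).1 i hit)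
  · rintro ⟨⟨h0, hrec, hno⟩, hA⟩
    have hA' := recenter_mem_aheadSet_iff.1 hA
    refine ⟨⟨fun i => ?_, hA'.2⟩, ⟨hrec, hA⟩, fun s hs hst hr => ?_⟩
    · rcases le_total i t with hit | hit
      · exact h0 i hit
      · exact (h0 t le_rfl).trans (hA'.1 i hit)
    · obtain ⟨i, hi, -, hlt⟩ := hno s hs hst hr.1
      exact absurd ((recenter_mem_aheadSet_iff.1 hr.2).1 i hi) (not_le.2 hlt)

end

/-! ### Renewal structure under the conditioned law -/

section

variable {d : ℕ} {h : Site d →+ ℤ} {m : Measure (LocalEnv d)} [IsProbabilityMeasure m]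

/-- The path law conditioned on never going below the starting height. -/
def aheadLaw (h : Site d →+ ℤ) (m : Measure (LocalEnv d)) : Measure (ℕ → Site d) :=
  cond (pathLaw m) (aheadSet h)

theorem aheadLaw_apply (A : Set (ℕ → Site d)) :
    aheadLaw h m A = (pathLaw m (aheadSet h))⁻¹ * pathLaw m (aheadSet h ∩ A) :=
  cond_apply measurableSet_aheadSet _ _

theorem ae_aheadLaw {p : (ℕ → Site d) → Prop} (hp : ∀ᵐ x ∂(pathLaw m), x ∈ aheadSet h → p x) :
    ∀ᵐ x ∂(aheadLaw h m), p x := by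
  rw [ae_iff, aheadLaw_apply]
  have : pathLaw m (aheadSet h ∩ {x | ¬ p x}) = 0 := by
    refine measure_mono_null (fun x hx => ?_) (ae_iff.1 hp)
    exact fun hcon => hx.2 (hcon hx.1)
  rw [this, mul_zero]

theorem ae_aheadLaw_mem : ∀ᵐ x ∂(aheadLaw h m), x ∈ aheadSet h :=
  ae_aheadLaw (ae_of_all _ fun _ hx => hx)

theorem isProbabilityMeasure_aheadLaw (h0 : pathLaw m (aheadSet h) ≠ 0) :
    IsProbabilityMeasure (aheadLaw h m) :=
  cond_isProbabilityMeasure h0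

theorem ae_aheadLaw_exists_regen (hh : ∀ e ∈ unitVectors d, |h e| ≤ 1)
    (h0 : pathLaw m (aheadSet h) ≠ 0) :
    ∀ᵐ x ∂(aheadLaw h m), ∃ t, 1 ≤ t ∧ Regen h t x :=
  ae_aheadLaw ((ae_exists_regen hh h0).mono fun _ hx hA => hx hA.2)

/-- For fixed time and height the past is an event at a first hitting time, and the future,
intersected with `aheadSet`, reads only the environment ahead. The factor of the future is thus its
unconditioned probability on `aheadSet`, which the normalisation turns into the conditioned law
again. -/
theorem aheadLaw_regenData_inter (hh : ∀ e ∈ unitVectors d, |h e| ≤ 1)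
    (h0 : pathLaw m (aheadSet h) ≠ 0) (y : ℕ × ℤ) {A : Set (ℕ → Site d)} (hA : MeasurableSet A) :
    aheadLaw h m (regenData h ⁻¹' {y} ∩ regenShift h ⁻¹' A) =
      aheadLaw h m (regenData h ⁻¹' {y}) * aheadLaw h m A := by
  have := isProbabilityMeasure_aheadLaw (m := m) h0
  obtain ⟨t, l⟩ := y
  rcases Nat.eq_zero_or_pos t with rfl | ht
  · have hz : aheadLaw h m (regenData h ⁻¹' {((0 : ℕ), l)}) = 0 := by
      refine measure_mono_null (fun x hx => ?_) (ae_iff.1 (ae_aheadLaw_exists_regen hh h0))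
      intro hcon
      have h1 := (regenTime_spec hcon).1
      have h2 : regenTime h x = 0 := congrArg Prod.fst hx
      omega
    rw [hz, zero_mul]
    exact measure_mono_null Set.inter_subset_left hz
  · set B : Set (ℕ → Site d) := preRegen h t ∩ {x | h (x t) = l} with hB
    have hBdet : InitDet t B := (initDet_preRegen t).inter
      fun x y hxy (hx : h (x t) = l) => show h (y t) = l from hxy t le_rfl ▸ hx
    have hBF : ∀ x ∈ B, FirstHit h l t x := fun x hx => ⟨hx.2, fun i hi => hx.2 ▸ hx.1.2.1 i hi⟩
    have hset : ∀ A' : Set (ℕ → Site d), aheadSet h ∩ (regenData h ⁻¹' {(t, l)} ∩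
        regenShift h ⁻¹' A') = B ∩ recenter t ⁻¹' (A' ∩ aheadSet h) := by
      intro A'
      ext x
      have h1 := Set.ext_iff.1 (aheadSet_inter_regenTime (h := h) ht) x
      simp only [Set.mem_inter_iff, Set.mem_preimage, Set.mem_singleton_iff, regenData,
        Prod.mk.injEq, regenShift, hB, Set.mem_ofPred_eq] at h1 ⊢
      constructor
      · rintro ⟨hxA, ⟨rfl, hl⟩, hx'⟩
        have h2 := h1.1 ⟨hxA, rfl⟩
        exact ⟨⟨h2.1, hl⟩, hx', h2.2⟩
      · rintro ⟨⟨hp, hl⟩, hx', hx''⟩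
        obtain ⟨h2, rfl⟩ := h1.2 ⟨hp, hx''⟩
        exact ⟨h2, ⟨rfl, hl⟩, hx'⟩
    have key : ∀ A' : Set (ℕ → Site d), MeasurableSet A' →
        aheadLaw h m (regenData h ⁻¹' {(t, l)} ∩ regenShift h ⁻¹' A') =
          pathLaw m B * aheadLaw h m A' := by
      intro A' hA'
      rw [aheadLaw_apply, aheadLaw_apply, hset, pathLaw_inter_recenter_eq m hBdet hBF
        (hA'.inter measurableSet_aheadSet) (aheadLocal_aheadSet_inter hA'),
        Set.inter_comm A']
      ring
    have h1 := key Set.univ MeasurableSet.univ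
    rw [Set.preimage_univ, Set.inter_univ, measure_univ, mul_one] at h1
    rw [key A hA, h1]

theorem measurePreserving_regenShift (hh : ∀ e ∈ unitVectors d, |h e| ≤ 1)
    (h0 : pathLaw m (aheadSet h) ≠ 0) :
    MeasurePreserving (regenShift h) (aheadLaw h m) (aheadLaw h m) := by
  have := isProbabilityMeasure_aheadLaw (m := m) h0
  refine ⟨measurable_regenShift, Measure.ext fun A hA => ?_⟩
  rw [Measure.map_apply measurable_regenShift hA,
    measure_eq_tsum_fiber (aheadLaw h m) (measurable_regenData (h := h)) (regenShift h ⁻¹' A)]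
  have h2 : ∀ y, aheadLaw h m (regenShift h ⁻¹' A ∩ regenData h ⁻¹' {y}) =
      aheadLaw h m (regenData h ⁻¹' {y}) * aheadLaw h m A := fun y => by
    rw [Set.inter_comm, aheadLaw_regenData_inter hh h0 _ hA]
  rw [tsum_congr h2, ENNReal.tsum_mul_right]
  have h1 := measure_eq_tsum_fiber (aheadLaw h m) measurable_regenData (f := regenData h) Set.univ
  simp_rw [Set.univ_inter] at h1
  rw [← h1, measure_univ, one_mul]

theorem indepFun_regenData_regenShift (hh : ∀ e ∈ unitVectors d, |h e| ≤ 1)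
    (h0 : pathLaw m (aheadSet h) ≠ 0) :
    IndepFun (regenData h) (regenShift h) (aheadLaw h m) := by
  rw [indepFun_iff_measure_inter_preimage_eq_mul]
  intro s A hs hA
  rw [measure_eq_tsum_fiber (aheadLaw h m) measurable_regenData (_ ∩ _),
    measure_eq_tsum_fiber (aheadLaw h m) measurable_regenData (regenData h ⁻¹' s),
    ← ENNReal.tsum_mul_right]
  have hp := measurePreserving_regenShift (m := m) hh h0
  refine tsum_congr fun y => ?_
  rw [hp.measure_preimage hA.nullMeasurableSet]
  by_cases hy : y ∈ s
  · have h1 : regenData h ⁻¹' s ∩ regenData h ⁻¹' {y} = regenData h ⁻¹' {y} :=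
      Set.inter_eq_self_of_subset_right (Set.preimage_mono (Set.singleton_subset_iff.2 hy))
    rw [Set.inter_right_comm, h1, aheadLaw_regenData_inter hh h0 _ hA]
  · have h1 : regenData h ⁻¹' s ∩ regenData h ⁻¹' {y} = ∅ := by
      rw [← Set.preimage_inter, Set.inter_singleton_eq_empty.2 hy, Set.preimage_empty]
    rw [Set.inter_right_comm, h1, Set.empty_inter, measure_empty, zero_mul]

/-- The height gained until the first regeneration. -/
def regenHeight (h : Site d →+ ℤ) (x : ℕ → Site d) : ℕ := (h (x (regenTime h x))).toNat

/-- Let `M c` be the event that level `n - c` is first hit without going below 0, that the walk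
advances from there, and that its next regeneration gains more than `c`. Then `n - c` is a
regeneration level and the next one is above `n`; this happens for at most one `c`, so the
probabilities sum to at most 1. An advancing path hits every level, hence `M c` is at least as
likely as the product on the left. -/
theorem sum_aheadSet_regenHeight_le (hh : ∀ e ∈ unitVectors d, |h e| ≤ 1) (n : ℕ) :
    ∑ c ∈ Finset.range (n + 1), pathLaw m (aheadSet h) *
      pathLaw m (aheadSet h ∩ {x | c < regenHeight h x}) ≤ 1 := by
  set A : ℕ → Set (ℕ → Site d) := fun c => aheadSet h ∩ {x | c < regenHeight h x} with hAdef
  have hAm : ∀ c, MeasurableSet (A c) := by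
    intro c
    refine measurableSet_aheadSet.inter ?_
    exact measurableSet_lt measurable_const ((measurable_of_countable Int.toNat).comp
      (measurable_of_time (g := fun t x => h (x t)) fun t =>
        (measurable_of_countable h).comp (measurable_pi_apply t)))
  set B : ℕ → ℕ → Set (ℕ → Site d) := fun k t =>
    {x | FirstHit h k t x} ∩ {x | ∀ i ≤ t, 0 ≤ h (x i)} with hBdef
  have hB : ∀ k t, InitDet t (B k t) := fun k t => (initDet_firstHit h k t).inter
    fun x y hxy hx i hi => hxy i hi ▸ hx i hi
  have hBdisj : ∀ k, Pairwise (Function.onFun Disjoint (B k)) := fun k t t' ht =>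
    (pairwise_disjoint_firstHit (k : ℤ) ht).mono Set.inter_subset_left Set.inter_subset_left
  set M : ℕ → Set (ℕ → Site d) := fun c => ⋃ t, B (n - c) t ∩ recenter t ⁻¹' A c with hM
  have hMm : ∀ c, MeasurableSet (M c) := fun c => MeasurableSet.iUnion fun t =>
    (hB _ t).measurableSet.inter (measurable_recenter t (hAm c))
  have hle : ∀ c, pathLaw m (aheadSet h) * pathLaw m (A c) ≤ pathLaw m (M c) := by
    intro c
    have h1 : pathLaw m (M c) = (∑' t, pathLaw m (B (n - c) t)) * pathLaw m (A c) := by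
      rw [hM, measure_iUnion (fun t t' ht => (hBdisj _ ht).mono Set.inter_subset_left
        Set.inter_subset_left)
          fun t => (hB _ t).measurableSet.inter (measurable_recenter t (hAm c)),
        ← ENNReal.tsum_mul_right]
      refine tsum_congr fun t => pathLaw_inter_recenter_eq m (hB _ t) (fun x hx => hx.1) (hAm c)
        (aheadLocal_of_forall (hAm c) fun x hx => hx.1.1)
    rw [h1, ← measure_iUnion (hBdisj _) fun t => (hB _ t).measurableSet]
    refine mul_le_mul_left (measure_mono_ae ?_) _
    filter_upwards [ae_isWalk_pathLaw m] with x hx hxA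
    obtain ⟨i, hi⟩ := hxA.2 (n - c)
    obtain ⟨t, -, ht⟩ := exists_first_crossing hh (h := h) (t := i) (fun i _ => hx.2 i)
      (k := ((n - c : ℕ) : ℤ)) (by rw [hx.1, map_zero]; omega) hi
    exact Set.mem_iUnion.2 ⟨t, ht, fun i _ => hxA.1 i⟩
  have hdisj : (Finset.range (n + 1) : Set ℕ).PairwiseDisjoint M := by
    have hlt : ∀ c c', c < c' → c' < n + 1 → Disjoint (M c) (M c') := by
      intro c c' hc hc'
      rw [Set.disjoint_left]
      intro x hx hx'
      obtain ⟨t', ht', hA'⟩ := Set.mem_iUnion.1 hx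
      obtain ⟨t, ht, hA⟩ := Set.mem_iUnion.1 hx'
      have hk : h (x t) = ((n - c' : ℕ) : ℤ) := ht.1.1
      have hk' : h (x t') = ((n - c : ℕ) : ℤ) := ht'.1.1
      have htt : t < t' := by
        by_contra hcon
        rcases (not_lt.1 hcon).lt_or_eq with h1 | h1
        · have := ht.1.2 t' h1
          omega
        · rw [h1] at hk'; omega
      obtain ⟨u, rfl⟩ := Nat.exists_eq_add_of_lt htt
      have hreg : Regen h (u + 1) (recenter t x) := by
        refine ⟨fun i hi => ?_, ?_⟩
        · have := ht'.1.2 (t + i) (by omega)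
          simp only [recenter, map_sub]
          rw [← add_assoc]
          omega
        · rw [recenter_recenter, ← add_assoc]
          exact hA'.1
      have h1 := regenTime_le (by omega) hreg
      have h2 : c' < regenHeight h (recenter t x) := hA.2
      have h3 : h (recenter t x (regenTime h (recenter t x))) ≤ h (recenter t x (u + 1)) := by
        rcases h1.lt_or_eq with h4 | h4
        · exact (hreg.1 _ h4).le
        · rw [h4]
      have h4 : h (recenter t x (u + 1)) = ((n - c : ℕ) : ℤ) - ((n - c' : ℕ) : ℤ) := by
        simp only [recenter, map_sub]
        rw [← add_assoc, hk, hk']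
      rw [regenHeight] at h2
      omega
    intro c hc c' hc' hne
    rw [Finset.coe_range, Set.mem_Iio] at hc hc'
    rcases lt_or_gt_of_ne hne with h1 | h1
    · exact hlt c c' h1 hc'
    · exact (hlt c' c h1 hc).symm
  calc _ ≤ ∑ c ∈ Finset.range (n + 1), pathLaw m (M c) := Finset.sum_le_sum fun c _ => hle c
    _ = pathLaw m (⋃ c ∈ Finset.range (n + 1), M c) :=
        (measure_biUnion_finset hdisj fun c _ => hMm c).symm
    _ ≤ 1 := prob_le_one

end

/-! ### Linear growth of the height under the conditioned law -/

section

variable {d : ℕ} {h : Site d →+ ℤ} {m : Measure (LocalEnv d)} [IsProbabilityMeasure m]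

theorem measurable_regenHeight : Measurable (regenHeight h) :=
  (measurable_of_countable Int.toNat).comp
      (measurable_of_time (g := fun t x => h (x t)) fun t =>
        (measurable_of_countable h).comp (measurable_pi_apply t))

/-- Tail-sum formula for the mean, with the renewal bound on the partial sums. No moment of the
regeneration time is needed. -/
theorem integrable_regenHeight (hh : ∀ e ∈ unitVectors d, |h e| ≤ 1)
    (h0 : pathLaw m (aheadSet h) ≠ 0) :
    Integrable (fun x => (regenHeight h x : ℝ)) (aheadLaw h m) := by
  have hm := measurable_regenHeight (h := h)
  refine ⟨((measurable_of_countable fun n : ℕ => (n : ℝ)).comp hm).aestronglyMeasurable, ?_⟩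
  rw [hasFiniteIntegral_iff_enorm]
  have h1 : ∀ n : ℕ, (n : ℝ≥0∞) = ∑' c : ℕ, if c < n then 1 else 0 := by
    intro n
    rw [tsum_eq_sum (s := Finset.range n) fun c hc => if_neg (by simpa using hc)]
    rw [Finset.sum_congr rfl fun c hc => if_pos (Finset.mem_range.1 hc)]
    simp
  have h2 : ∀ c : ℕ, MeasurableSet {x | c < regenHeight h x} := fun c =>
    measurableSet_lt measurable_const hm
  have h3 : ∫⁻ x, ‖(regenHeight h x : ℝ)‖ₑ ∂(aheadLaw h m) =
      ∑' c : ℕ, aheadLaw h m {x | c < regenHeight h x} := by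
    have : ∀ x : ℕ → Site d, ‖(regenHeight h x : ℝ)‖ₑ =
        ∑' c : ℕ, {x | c < regenHeight h x}.indicator (fun _ => (1 : ℝ≥0∞)) x := by
      intro x
      rw [show ‖(regenHeight h x : ℝ)‖ₑ = (regenHeight h x : ℝ≥0∞) by simp, h1]
      simp only [Set.indicator_apply, Set.mem_ofPred_eq]
    simp_rw [this]
    rw [lintegral_tsum fun c => (measurable_const.indicator (h2 c)).aemeasurable]
    refine tsum_congr fun c => ?_
    rw [lintegral_indicator (h2 c), setLIntegral_const, one_mul]
  rw [h3]
  simp_rw [aheadLaw_apply]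
  rw [ENNReal.tsum_mul_left]
  refine ENNReal.mul_lt_top (ENNReal.inv_lt_top.2 (pos_iff_ne_zero.2 h0)) ?_
  have h4 : pathLaw m (aheadSet h) *
      ∑' c : ℕ, pathLaw m (aheadSet h ∩ {x | c < regenHeight h x}) ≤ 1 := by
    rw [← ENNReal.tsum_mul_left, ENNReal.tsum_eq_iSup_nat]
    refine iSup_le fun n => ?_
    refine le_trans (Finset.sum_le_sum_of_subset (Finset.range_mono (Nat.le_succ n)))
      (sum_aheadSet_regenHeight_le hh n)
  by_contra hcon
  rw [not_lt, top_le_iff] at hcon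
  rw [hcon, ENNReal.mul_top h0] at h4
  exact absurd h4 (by simp)

/-- The `i`-th regeneration time. -/
def regenTimes (h : Site d →+ ℤ) (x : ℕ → Site d) (i : ℕ) : ℕ :=
  ∑ k ∈ Finset.range i, regenTime h ((regenShift h)^[k] x)

theorem iterate_regenShift (x : ℕ → Site d) (i : ℕ) (hx : x 0 = 0) :
    (regenShift h)^[i] x = recenter (regenTimes h x i) x := by
  induction i with
  | zero => ext n; simp [regenTimes, recenter, hx]
  | succ i ih =>
    rw [Function.iterate_succ_apply', regenShift, regenTimes, Finset.sum_range_succ,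
      ← regenTimes]
    conv_lhs => rw [ih]
    rw [recenter_recenter, ← ih]

/-- On paths all of whose shifts regenerate, the height grows linearly. -/
theorem ae_aheadLaw_tendsto (hh : ∀ e ∈ unitVectors d, |h e| ≤ 1)
    (h0 : pathLaw m (aheadSet h) ≠ 0) :
    ∀ᵐ x ∂(aheadLaw h m), ∃ v : ℝ, Tendsto (fun n : ℕ => (h (x n) : ℝ) / n) atTop (𝓝 v) := by
  have := isProbabilityMeasure_aheadLaw (m := m) h0
  have hΘ := measurePreserving_regenShift (m := m) hh h0
  have hind := indepFun_regenData_regenShift (m := m) hh h0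
  have hreg : ∀ᵐ x ∂(aheadLaw h m), ∀ i, (regenShift h)^[i] x ∈ aheadSet h ∧
      ∃ t, 1 ≤ t ∧ Regen h t ((regenShift h)^[i] x) := by
    refine ae_all_iff.2 fun i => (hΘ.iterate i).quasiMeasurePreserving.ae
      (p := fun x => x ∈ aheadSet h ∧ ∃ t, 1 ≤ t ∧ Regen h t x) ?_
    filter_upwards [ae_aheadLaw_mem (h := h) (m := m), ae_aheadLaw_exists_regen hh h0]
      with x h1 h2
    exact ⟨h1, h2⟩
  have hwalk : ∀ᵐ x ∂(aheadLaw h m), x 0 = 0 :=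
    ae_aheadLaw ((ae_isWalk_pathLaw m).mono fun x hx _ => hx.1)
  have hheight := strongLaw_iterate hΘ measurable_regenData hind
    (f := fun y => (y.2.toNat : ℝ)) (integrable_regenHeight hh h0)
  -- The mean regeneration time may be infinite; then the average time per regeneration diverges.
  have hcomb : ∀ᵐ x ∂(aheadLaw h m), (∃ v : ℝ,
      Tendsto (fun i : ℕ => (regenTimes h x i : ℝ) / i) atTop (𝓝 v)) ∨
      Tendsto (fun i : ℕ => (regenTimes h x i : ℝ) / i) atTop atTop := by
    have hcast : ∀ x (i : ℕ), (regenTimes h x i : ℝ) =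
        ∑ k ∈ Finset.range i, (regenTime h ((regenShift h)^[k] x) : ℝ) := fun x i => by
      simp [regenTimes]
    simp_rw [hcast]
    by_cases hint : Integrable (fun x => (((fun y : ℕ × ℤ => y.1) (regenData h x) : ℕ) : ℝ))
        (aheadLaw h m)
    · filter_upwards [strongLaw_iterate hΘ measurable_regenData hind
        (f := fun y : ℕ × ℤ => (y.1 : ℝ)) hint] with x hx
      exact Or.inl ⟨_, hx⟩
    · filter_upwards [strongLaw_iterate_atTop hΘ measurable_regenData hind
        (f := fun y : ℕ × ℤ => y.1) hint] with x hx
      exact Or.inr hx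
  filter_upwards [hreg, hwalk, hheight, hcomb] with x hr hx0 hH hT
  set a := ∫ x, ((regenData h x).2.toNat : ℝ) ∂(aheadLaw h m)
  set L : ℕ → ℝ := fun i => (h (x (regenTimes h x i)) : ℝ) with hL
  have hsucc : ∀ i, regenTimes h x (i + 1) =
      regenTimes h x i + regenTime h ((regenShift h)^[i] x) := fun i =>
    Finset.sum_range_succ _ _
  have hmem : ∀ i, recenter (regenTimes h x i) x ∈ aheadSet h := fun i => by
    rw [← iterate_regenShift x i hx0]; exact (hr i).1
  have hspec := fun i => regenTime_spec (hr i).2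
  have hmono : StrictMono (regenTimes h x) := strictMono_nat_of_lt_succ fun i => by
    rw [hsucc]; have := (hspec i).1; omega
  have hLsum : ∀ i, L i = ∑ k ∈ Finset.range i,
      (((regenData h ((regenShift h)^[k] x)).2.toNat : ℕ) : ℝ) := by
    intro i
    induction i with
    | zero => simp [hL, regenTimes, hx0]
    | succ i ih =>
      rw [Finset.sum_range_succ, ← ih]
      simp only [hL, regenData]
      have h1 := (hmem i).1 (regenTime h ((regenShift h)^[i] x))
      rw [hsucc, iterate_regenShift x i hx0]
      rw [iterate_regenShift x i hx0] at h1
      have h2 : h (x (regenTimes h x i + regenTime h (recenter (regenTimes h x i) x))) =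
          h (x (regenTimes h x i)) + ((h (recenter (regenTimes h x i) x
            (regenTime h (recenter (regenTimes h x i) x)))).toNat : ℤ) := by
        rw [Int.toNat_of_nonneg h1]
        simp [recenter]
      rw [h2]
      push_cast
      rfl
  have hLlim : Tendsto (fun i : ℕ => L i / i) atTop (𝓝 a) := by
    refine hH.congr fun i => ?_
    rw [hLsum]
  -- Between two regenerations the height lies between the two regeneration heights: no return below
  -- the first, strict record at the second.
  have hsandwich : ∀ i n, regenTimes h x i ≤ n → n < regenTimes h x (i + 1) →
      L i ≤ (h (x n) : ℝ) ∧ (h (x n) : ℝ) ≤ L (i + 1) := by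
    intro i n hn hn'
    obtain ⟨c, rfl⟩ := Nat.exists_eq_add_of_le hn
    rw [hsucc] at hn'
    have h1 := (hmem i).1 c
    have h2 := (hspec i).2.1 c (by omega)
    simp only [hL, hsucc]
    rw [iterate_regenShift x i hx0] at h2 ⊢
    simp only [recenter, map_sub] at h1 h2
    constructor
    · exact_mod_cast (by omega : h (x (regenTimes h x i)) ≤ h (x (regenTimes h x i + c)))
    · refine Int.cast_le.2 ?_
      omega
  have hshift : ∀ {f : ℕ → ℝ} {b : ℝ}, Tendsto (fun i : ℕ => f i / i) atTop (𝓝 b) →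
      Tendsto (fun i : ℕ => f (i + 1) / i) atTop (𝓝 b) := by
    intro f b hf
    have h1 := (tendsto_add_atTop_iff_nat 1).2 hf
    have h2 : Tendsto (fun i : ℕ => ((i : ℝ) + 1) / i) atTop (𝓝 1) := by
      have h3 : Tendsto (fun i : ℕ => 1 + (1 : ℝ) / i) atTop (𝓝 (1 + 0)) :=
        tendsto_const_nhds.add tendsto_one_div_atTop_nhds_zero_nat
      rw [add_zero] at h3
      refine h3.congr' ?_
      filter_upwards [eventually_gt_atTop 0] with i hi
      have : (i : ℝ) ≠ 0 := by positivity
      field_simp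
    have h4 := h1.mul h2
    rw [mul_one] at h4
    refine h4.congr fun i => ?_
    push_cast
    have : (i : ℝ) + 1 ≠ 0 := by positivity
    field_simp
  have hshift' : Tendsto (fun i : ℕ => (regenTimes h x i : ℝ) / i) atTop atTop →
      Tendsto (fun i : ℕ => (regenTimes h x (i + 1) : ℝ) / i) atTop atTop := by
    intro hf
    refine tendsto_atTop_mono (fun i => ?_) hf
    have : regenTimes h x i ≤ regenTimes h x (i + 1) := hmono.monotone (Nat.le_succ i)
    gcongr
  have hdiv : ∀ (f g : ℕ → ℝ), (fun i : ℕ => (f i / i) / (g i / i)) =ᶠ[atTop]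
      fun i => f i / g i := by
    intro f g
    filter_upwards [eventually_gt_atTop 0] with i hi
    have : (i : ℝ) ≠ 0 := by positivity
    exact div_div_div_cancel_right₀ this _ _
  have hLnn : ∀ i, 0 ≤ L i := fun i => by
    rw [hLsum]; positivity
  -- With finite mean time the speed is the ratio of the mean height to the mean time, which is at
  -- least 1; with infinite mean time it is 0.
  rcases hT with ⟨b, hb⟩ | hb
  · have hb1 : (1 : ℝ) ≤ b := by
      refine ge_of_tendsto hb ?_
      filter_upwards [eventually_gt_atTop 0] with i hi
      rw [le_div_iff₀ (by positivity), one_mul]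
      exact_mod_cast hmono.le_apply
    have hb0 : b ≠ 0 := by positivity
    refine ⟨a / b, tendsto_div_of_sandwich (H := fun n => (h (x n) : ℝ))
      (by simp [regenTimes]) hmono hLnn hsandwich ?_ ?_⟩
    · exact (hLlim.div (hshift hb) hb0).congr' (hdiv _ _)
    · exact ((hshift hLlim).div hb hb0).congr' (hdiv _ _)
  · refine ⟨0, tendsto_div_of_sandwich (H := fun n => (h (x n) : ℝ))
      (by simp [regenTimes]) hmono hLnn hsandwich ?_ ?_⟩
    · exact (hLlim.div_atTop (hshift' hb)).congr' (hdiv _ _)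
    · exact ((hshift hLlim).div_atTop hb).congr' (hdiv _ _)

end

/-! ### Existence of the limiting velocity -/

section

variable {d : ℕ} {h : Site d →+ ℤ} {m : Measure (LocalEnv d)} [IsProbabilityMeasure m]

theorem tendsto_of_recenter {x : ℕ → Site d} {t : ℕ} {v : ℝ}
    (hx : Tendsto (fun n : ℕ => (h (recenter t x n) : ℝ) / n) atTop (𝓝 v)) :
    Tendsto (fun n : ℕ => (h (x n) : ℝ) / n) atTop (𝓝 v) := by
  rw [← tendsto_add_atTop_iff_nat t]
  have h1 : Tendsto (fun n : ℕ => (h (x t) : ℝ) / n) atTop (𝓝 0) :=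
    tendsto_const_div_atTop_nhds_zero_nat _
  have h2 : Tendsto (fun n : ℕ => (n : ℝ) / (n + t)) atTop (𝓝 1) :=
    tendsto_natCast_div_add_atTop (t : ℝ)
  have h3 := (hx.add h1).mul h2
  rw [add_zero, mul_one] at h3
  refine h3.congr' ?_
  filter_upwards [eventually_gt_atTop 0] with n hn
  have : (n : ℝ) ≠ 0 := by positivity
  have : (n : ℝ) + t ≠ 0 := by positivity
  simp only [recenter, map_sub, Int.cast_sub, Nat.cast_add, add_comm n t]
  field_simp
  ring

theorem measurableSet_exists_tendsto_height :
    MeasurableSet {x : ℕ → Site d | ∃ v : ℝ,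
      Tendsto (fun n : ℕ => (h (x n) : ℝ) / n) atTop (𝓝 v)} := by
  refine StronglyMeasurable.measurableSet_exists_tendsto (f := fun n (x : ℕ → Site d) =>
    (h (x n) : ℝ) / n) fun n => Measurable.stronglyMeasurable ?_
  exact (measurable_of_countable fun y : Site d => (h y : ℝ) / n).comp (measurable_pi_apply n)

/-- In every direction the walk has a limiting speed or does not move ballistically forwards. -/
theorem ae_tendsto_or_le (hh : ∀ e ∈ unitVectors d, |h e| ≤ 1) :
    ∀ᵐ x ∂(pathLaw m), (∃ v : ℝ, Tendsto (fun n : ℕ => (h (x n) : ℝ) / n) atTop (𝓝 v)) ∨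
      ∀ j : ℕ, ∃ K : ℤ, ∀ n : ℕ, ((j : ℤ) + 1) * h (x n) ≤ 2 * n + K := by
  by_cases h0 : pathLaw m (aheadSet h) = 0
  · filter_upwards [ae_forall_exists_le hh h0] with x hx
    exact Or.inr hx
  set C : Set (ℕ → Site d) := {x | ∃ v : ℝ,
    Tendsto (fun n : ℕ => (h (x n) : ℝ) / n) atTop (𝓝 v)} with hC
  have hCm : MeasurableSet C := measurableSet_exists_tendsto_height
  have hz : pathLaw m (Cᶜ ∩ aheadSet h) = 0 := by
    have h1 := ae_iff.1 (ae_aheadLaw_tendsto (m := m) hh h0)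
    rw [aheadLaw_apply, mul_eq_zero] at h1
    rcases h1 with h1 | h1
    · exact absurd h1 (ENNReal.inv_ne_zero.2 (measure_ne_top _ _))
    · rw [Set.inter_comm]; exact h1
  -- Transfer from the conditioned law: after the first hit of any level, an advancing path without
  -- a speed has probability 0.
  have hnull : ∀ᵐ x ∂(pathLaw m), ∀ (t : ℕ) (k : ℤ),
      ¬ x ∈ {x | FirstHit h k t x} ∩ recenter t ⁻¹' (Cᶜ ∩ aheadSet h) := by
    refine ae_all_iff.2 fun t => ae_all_iff.2 fun k => measure_eq_zero_iff_ae_notMem.1 ?_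
    rw [pathLaw_inter_recenter_eq m (initDet_firstHit h k t) (fun x hx => hx)
      (hCm.compl.inter measurableSet_aheadSet) (aheadLocal_aheadSet_inter hCm.compl), hz, mul_zero]
  filter_upwards [hnull, ae_exists_regen (m := m) hh h0] with x hx hr
  by_cases hu : ∀ k : ℕ, ∃ i, (k : ℤ) ≤ h (x i)
  · obtain ⟨t, -, hrec, hA⟩ := hr hu
    left
    by_contra hcon
    refine hx t (h (x t)) ⟨⟨rfl, hrec⟩, fun hcon' => hcon ?_, hA⟩
    obtain ⟨v, hv⟩ := hcon'
    exact ⟨v, tendsto_of_recenter hv⟩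
  · right
    push Not at hu
    obtain ⟨k, hk⟩ := hu
    intro j
    refine ⟨((j : ℤ) + 1) * k, fun n => ?_⟩
    have := mul_le_mul_of_nonneg_left (hk n).le (show (0 : ℤ) ≤ (j : ℤ) + 1 by omega)
    omega

theorem ae_exists_tendsto_height (hh : ∀ e ∈ unitVectors d, |h e| ≤ 1) :
    ∀ᵐ x ∂(pathLaw m), ∃ v : ℝ, Tendsto (fun n : ℕ => (h (x n) : ℝ) / n) atTop (𝓝 v) := by
  have hh' : ∀ e ∈ unitVectors d, |(-h) e| ≤ 1 := fun e he => by
    rw [AddMonoidHom.neg_apply, abs_neg]; exact hh e he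
  filter_upwards [ae_tendsto_or_le (m := m) hh, ae_tendsto_or_le (m := m) hh'] with x h1 h2
  rcases h1 with h1 | h1
  · exact h1
  rcases h2 with ⟨v, hv⟩ | h2
  · refine ⟨-v, hv.neg.congr fun n => ?_⟩
    simp [neg_div]
  -- Neither direction has been given a limit, so the height is at most `(2 n + K) / (j + 1)` in
  -- absolute value up to the choice of constants, for every `j`; the limit is 0.
  refine ⟨0, Metric.tendsto_atTop.2 fun ε hε => ?_⟩
  obtain ⟨j, hj⟩ := exists_nat_gt (4 / ε)
  obtain ⟨K, hK⟩ := h1 j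
  obtain ⟨K', hK'⟩ := h2 j
  refine ⟨max K.natAbs K'.natAbs + 1, fun n hn => ?_⟩
  have h3 := hK n
  have h4 := hK' n
  rw [AddMonoidHom.neg_apply] at h4
  have h5 : |((j : ℤ) + 1) * h (x n)| ≤ 3 * n := by
    rw [abs_le, ← neg_le, ← mul_neg]
    have := le_max_left K.natAbs K'.natAbs
    have := le_max_right K.natAbs K'.natAbs
    constructor <;> omega
  have hn0 : (0 : ℝ) < n := by exact_mod_cast (by omega : 0 < n)
  have hj0 : (0 : ℝ) < (j : ℝ) + 1 := by positivity
  have h6 : ((j : ℝ) + 1) * |(h (x n) : ℝ)| ≤ 3 * n := by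
    rw [← abs_of_pos hj0, ← abs_mul]
    exact_mod_cast h5
  have h7 : 4 < ε * ((j : ℝ) + 1) := by
    rw [div_lt_iff₀ hε] at hj
    nlinarith
  rw [dist_zero_right, Real.norm_eq_abs, abs_div, abs_of_pos hn0, div_lt_iff₀ hn0]
  by_contra hcon
  have h8 := mul_le_mul_of_nonneg_left (not_lt.1 hcon) hj0.le
  nlinarith

/-- The evaluation of a coordinate. -/
def coordHom (d : ℕ) (i : Fin d) : Site d →+ ℤ := Pi.evalAddMonoidHom (fun _ => ℤ) i

/-- The walk in an i.i.d. random environment has a (possibly random) limiting velocity. -/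
theorem ae_exists_hasVelocity : ∀ᵐ x ∂(pathLaw m), ∃ v, HasVelocity x v := by
  have := ae_all_iff.2 fun i : Fin d => ae_exists_tendsto_height (m := m) (h := coordHom d i)
    fun e he => abs_coord_le_one he i
  filter_upwards [this] with x hx
  choose v hv using hx
  refine ⟨v, tendsto_pi_nhds.2 fun i => (hv i).congr fun n => ?_⟩
  simp [toReal, coordHom, div_eq_inv_mul]

end

/-! ### Walks driven by two stacks of steps -/

section

variable {d : ℕ}

/-- Partial sums of a sequence of steps. -/
def stepSum (y : ℕ → Step d) (n : ℕ) : Site d := ∑ i ∈ Finset.range n, (y i : Site d)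

theorem stepSum_succ (y : ℕ → Step d) (n : ℕ) : stepSum y (n + 1) = stepSum y n + y n :=
  Finset.sum_range_succ _ _

/-- The number of steps of the first kind used up to time `n`, when the walk takes its steps from
the sequence `y₁` at the sites where `b` holds, and from `y₂` elsewhere. -/
def stackCount (b : Site d → Bool) (y₁ y₂ : ℕ → Step d) : ℕ → ℕ
  | 0 => 0
  | n + 1 => stackCount b y₁ y₂ n +
      if b (stepSum y₁ (stackCount b y₁ y₂ n) + stepSum y₂ (n - stackCount b y₁ y₂ n)) then 1 else 0

/-- The walk that takes its steps from the sequence `y₁` at the sites where `b` holds, and from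
`y₂` elsewhere. -/
def stackWalk (b : Site d → Bool) (y₁ y₂ : ℕ → Step d) (n : ℕ) : Site d :=
  stepSum y₁ (stackCount b y₁ y₂ n) + stepSum y₂ (n - stackCount b y₁ y₂ n)

/-- The number of visits of `w` to `b` before time `n`. -/
def boolVisits (b : Site d → Bool) (w : ℕ → Site d) (n : ℕ) : ℕ :=
  ((Finset.range n).filter fun i => b (w i)).card

theorem stackCount_succ (b : Site d → Bool) (y₁ y₂ : ℕ → Step d) (n : ℕ) :
    stackCount b y₁ y₂ (n + 1) = stackCount b y₁ y₂ n + if b (stackWalk b y₁ y₂ n) then 1 else 0 :=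
  rfl

theorem stackCount_le (b : Site d → Bool) (y₁ y₂ : ℕ → Step d) (n : ℕ) :
    stackCount b y₁ y₂ n ≤ n := by
  induction n with
  | zero => exact le_rfl
  | succ n ih =>
    rw [stackCount_succ]
    split_ifs <;> omega

theorem stackWalk_zero (b : Site d → Bool) (y₁ y₂ : ℕ → Step d) : stackWalk b y₁ y₂ 0 = 0 := by
  simp [stackWalk, stackCount, stepSum]

theorem stackWalk_succ (b : Site d → Bool) (y₁ y₂ : ℕ → Step d) (n : ℕ) :
    stackWalk b y₁ y₂ (n + 1) = stackWalk b y₁ y₂ n +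
      if b (stackWalk b y₁ y₂ n) then (y₁ (stackCount b y₁ y₂ n) : Site d)
      else y₂ (n - stackCount b y₁ y₂ n) := by
  have h := stackCount_le b y₁ y₂ n
  conv_lhs => rw [stackWalk, stackCount_succ]
  split_ifs with hb
  · rw [show n + 1 - (stackCount b y₁ y₂ n + 1) = n - stackCount b y₁ y₂ n by omega,
      stepSum_succ, stackWalk]
    abel
  · rw [add_zero, show n + 1 - stackCount b y₁ y₂ n = n - stackCount b y₁ y₂ n + 1 by omega,
      stepSum_succ, stackWalk]
    abel

theorem stackCount_eq_boolVisits (b : Site d → Bool) (y₁ y₂ : ℕ → Step d) (n : ℕ) :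
    stackCount b y₁ y₂ n = boolVisits b (stackWalk b y₁ y₂) n := by
  induction n with
  | zero => rfl
  | succ n ih =>
    rw [stackCount_succ, ih, boolVisits, boolVisits, Finset.range_add_one, Finset.filter_insert]
    split_ifs
    · rw [Finset.card_insert_of_notMem (by simp)]
    · rfl

theorem boolVisits_congr {b : Site d → Bool} {w w' : ℕ → Site d} {n : ℕ}
    (h : ∀ i < n, w i = w' i) : boolVisits b w n = boolVisits b w' n := by
  unfold boolVisits
  congr 1
  exact Finset.filter_congr fun i hi => by rw [h i (Finset.mem_range.1 hi)]

theorem boolVisits_lt {b : Site d → Bool} {w : ℕ → Site d} {i j : ℕ} (hij : i < j)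
    (hb : b (w i)) : boolVisits b w i < boolVisits b w j := by
  refine Finset.card_lt_card ((Finset.ssubset_iff_of_subset ?_).2 ⟨i, ?_, ?_⟩)
  · exact Finset.filter_subset_filter _ (Finset.range_mono hij.le)
  · simp [hij, hb]
  · simp

theorem sub_boolVisits (b : Site d → Bool) (w : ℕ → Site d) (n : ℕ) :
    n - boolVisits b w n = boolVisits (fun x => !b x) w n := by
  have := Finset.card_filter_add_card_filter_not (s := Finset.range n) (fun i => b (w i) = true)
  rw [Finset.card_range] at this
  unfold boolVisits
  simp only [Bool.not_eq_true, Bool.not_eq_eq_eq_not, Bool.not_true] at this ⊢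
  omega

/-- Along a prescribed path the index of the stack entry used at each time depends on the path
alone: it is the number of earlier visits to sites of the same type. Following the path therefore
becomes a condition on explicit entries of each stack separately. -/
theorem stackWalk_mem_cyl_iff (b : Site d → Bool) (y₁ y₂ : ℕ → Step d) (n : ℕ)
    (w : ℕ → Site d) : stackWalk b y₁ y₂ ∈ cyl n w ↔ w 0 = 0 ∧
      (∀ i ∈ (Finset.range n).filter fun i => b (w i),
        (y₁ (boolVisits b w i) : Site d) = w (i + 1) - w i) ∧
      (∀ i ∈ (Finset.range n).filter fun i => ¬ b (w i),
        (y₂ (boolVisits (fun x => !b x) w i) : Site d) = w (i + 1) - w i) := by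
  have hstep : ∀ i, (∀ j ≤ i, stackWalk b y₁ y₂ j = w j) →
      stackWalk b y₁ y₂ (i + 1) = w i + if b (w i) then (y₁ (boolVisits b w i) : Site d)
        else y₂ (boolVisits (fun x => !b x) w i) := by
    intro i hi
    rw [stackWalk_succ, hi i le_rfl, stackCount_eq_boolVisits,
      boolVisits_congr fun j hj => hi j (le_of_lt hj), sub_boolVisits]
  constructor
  · intro hw
    refine ⟨(hw 0 (Nat.zero_le _)).symm.trans (stackWalk_zero _ _ _), fun i hi => ?_,
      fun i hi => ?_⟩
    all_goals
      rw [Finset.mem_filter, Finset.mem_range] at hi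
      have h1 := hstep i fun j hj => hw j (by omega)
      rw [hw (i + 1) (by omega)] at h1
      simp [h1, hi.2]
  · rintro ⟨h0, h1, h2⟩ i
    induction i using Nat.strong_induction_on with
    | _ i ih =>
      intro hi
      rcases Nat.eq_zero_or_pos i with rfl | hpos
      · rw [stackWalk_zero, h0]
      · obtain ⟨k, rfl⟩ := Nat.exists_eq_add_of_le' (show 1 ≤ i from hpos)
        rw [hstep k fun j hj => ih j (by omega) (by omega)]
        by_cases hb : b (w k)
        · rw [if_pos hb, h1 k (Finset.mem_filter.2 ⟨Finset.mem_range.2 (by omega), hb⟩)]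
          abel
        · rw [if_neg hb, h2 k (Finset.mem_filter.2 ⟨Finset.mem_range.2 (by omega), hb⟩)]
          abel

theorem infinitePi_forall_mem {ι α : Type*} [MeasurableSpace α] {μ : Measure α}
    [IsProbabilityMeasure μ] (I : Finset ι) {k : ι → ℕ} (hk : Set.InjOn k I) {T : ι → Set α}
    (hT : ∀ i, MeasurableSet (T i)) :
    Measure.infinitePi (fun _ : ℕ => μ) {y | ∀ i ∈ I, y (k i) ∈ T i} = ∏ i ∈ I, μ (T i) := by
  classical
  have h1 : {y : ℕ → α | ∀ i ∈ I, y (k i) ∈ T i} =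
      Set.pi (I.image k : Finset ℕ) fun j => ⋂ i ∈ I.filter fun i => k i = j, T i := by
    ext y
    simp only [Set.mem_ofPred_eq, Set.mem_pi, Finset.mem_coe, Finset.mem_image, Set.mem_iInter,
      Finset.mem_filter]
    constructor
    · rintro h _ ⟨i, hi, rfl⟩ i' ⟨hi', hii⟩
      rw [← hii]
      exact h i' hi'
    · intro h i hi
      exact h (k i) ⟨i, hi, rfl⟩ i ⟨hi, rfl⟩
  rw [h1, Measure.infinitePi_pi _ fun j _ => Finset.measurableSet_biInter _ fun i _ => hT i,
    Finset.prod_image hk]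
  refine Finset.prod_congr rfl fun i hi => ?_
  congr 1
  have : I.filter (fun i' => k i' = k i) = {i} := by
    ext i'
    simp only [Finset.mem_filter, Finset.mem_singleton]
    constructor
    · rintro ⟨hi', h⟩
      exact hk hi' hi h
    · rintro rfl
      exact ⟨hi, rfl⟩
  rw [this]
  simp

/-- An i.i.d. sequence of steps. -/
abbrev stepLaw (γ : LocalEnv d) : Measure (ℕ → Step d) :=
  Measure.infinitePi fun _ : ℕ => (γ : Measure (Step d))

/-- The environment given by the types of the sites. -/
def boolEnv (γ₁ γ₂ : LocalEnv d) (b : Site d → Bool) : Env d := fun x => if b x then γ₁ else γ₂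

theorem measurable_stepSum (n : ℕ) : Measurable fun y : ℕ → Step d => stepSum y n := by
  unfold stepSum
  fun_prop

theorem measurable_of_countable_index {α β ι : Type*} [MeasurableSpace α] [MeasurableSpace β]
    [MeasurableSpace ι] [Countable ι] [MeasurableSingletonClass ι] {g : ι → α → β} {f : α → ι}
    (hg : ∀ i, Measurable (g i)) (hf : Measurable f) : Measurable fun a => g (f a) a :=
  (measurable_from_prod_countable_right (f := fun q : ι × α => g q.1 q.2) hg).comp
    (hf.prodMk measurable_id)

theorem measurable_stackCount {α : Type*} [MeasurableSpace α] {b : α → Site d → Bool}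
    {y₁ y₂ : α → ℕ → Step d} (hb : Measurable b) (hy₁ : Measurable y₁) (hy₂ : Measurable y₂)
    (n : ℕ) : Measurable (fun a => stackCount (b a) (y₁ a) (y₂ a) n) ∧
      Measurable (fun a => stackWalk (b a) (y₁ a) (y₂ a) n) := by
  induction n with
  | zero => simp [stackWalk_zero, stackCount]
  | succ n ih =>
    have hc : Measurable (fun a => stackCount (b a) (y₁ a) (y₂ a) (n + 1)) := by
      simp only [stackCount_succ]
      refine ih.1.add (Measurable.ite ?_ measurable_const measurable_const)
      have : Measurable fun a => b a (stackWalk (b a) (y₁ a) (y₂ a) n) :=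
        measurable_of_countable_index (g := fun x a => b a x)
          (fun x => (measurable_pi_apply x).comp hb) ih.2
      exact this (measurableSet_singleton true)
    refine ⟨hc, ?_⟩
    unfold stackWalk
    refine Measurable.add ?_ ?_
    · exact measurable_of_countable_index (g := fun k a => stepSum (y₁ a) k)
        (fun k => (measurable_stepSum k).comp hy₁) hc
    · exact measurable_of_countable_index (g := fun k a => stepSum (y₂ a) k)
        (fun k => (measurable_stepSum k).comp hy₂) (measurable_const.sub hc)

theorem measurable_stackWalk {α : Type*} [MeasurableSpace α] {b : α → Site d → Bool}
    {y₁ y₂ : α → ℕ → Step d} (hb : Measurable b) (hy₁ : Measurable y₁) (hy₂ : Measurable y₂) :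
    Measurable (fun a => stackWalk (b a) (y₁ a) (y₂ a)) :=
  measurable_pi_lambda _ fun n => (measurable_stackCount hb hy₁ hy₂ n).2

/-- With independent i.i.d. sequences of steps, `stackWalk` is the Markov chain in the environment
`boolEnv`. -/
theorem map_stackWalk (γ₁ γ₂ : LocalEnv d) (b : Site d → Bool) :
    ((stepLaw γ₁).prod (stepLaw γ₂)).map (fun q => stackWalk b q.1 q.2) =
      quenchedLaw d (boolEnv γ₁ γ₂ b) := by
  have hm : Measurable fun q : (ℕ → Step d) × (ℕ → Step d) => stackWalk b q.1 q.2 :=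
    measurable_stackWalk measurable_const measurable_fst measurable_snd
  have := Measure.isProbabilityMeasure_map (μ := (stepLaw γ₁).prod (stepLaw γ₂)) hm.aemeasurable
  refine measure_ext_cyl fun n w => ?_
  rw [Measure.map_apply hm (measurableSet_cyl n w), quenchedLaw_cyl]
  split_ifs with h0
  · have hset : (fun q : (ℕ → Step d) × (ℕ → Step d) => stackWalk b q.1 q.2) ⁻¹' cyl n w =
        {y | ∀ i ∈ (Finset.range n).filter fun i => b (w i),
          y (boolVisits b w i) ∈ {s : Step d | (s : Site d) = w (i + 1) - w i}} ×ˢ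
        {y | ∀ i ∈ (Finset.range n).filter fun i => ¬ b (w i),
          y (boolVisits (fun x => !b x) w i) ∈ {s : Step d | (s : Site d) = w (i + 1) - w i}} := by
      ext q
      rw [Set.mem_preimage, stackWalk_mem_cyl_iff]
      simp only [h0, true_and, Set.mem_prod, Set.mem_ofPred_eq]
    -- Different times at sites of one type use different entries, so the entries involved are
    -- independent even if the path revisits a site.
    have hinj : ∀ (b : Site d → Bool) (I : Finset ℕ), (∀ i ∈ I, b (w i)) →
        Set.InjOn (boolVisits b w) I := by
      intro b I hI i hi j hj hij
      rcases lt_trichotomy i j with h | h | h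
      · exact absurd hij (boolVisits_lt h (hI i hi)).ne
      · exact h
      · exact absurd hij (boolVisits_lt h (hI j hj)).ne'
    rw [hset, Measure.prod_prod,
      infinitePi_forall_mem _ (hinj b _ fun i hi => (Finset.mem_filter.1 hi).2)
        fun i => (Set.to_countable _).measurableSet,
      infinitePi_forall_mem _ (hinj _ _ fun i hi => by simpa using (Finset.mem_filter.1 hi).2)
        fun i => (Set.to_countable _).measurableSet, pathProb,
      ← Finset.prod_filter_mul_prod_filter_not (Finset.range n) (fun i => b (w i) = true)]
    congr 1
    all_goals
      refine Finset.prod_congr rfl fun i hi => ?_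
      have := (Finset.mem_filter.1 hi).2
      simp [stepProb, boolEnv, this]
  · convert measure_empty (μ := (stepLaw γ₁).prod (stepLaw γ₂))
    rw [Set.eq_empty_iff_forall_notMem]
    intro q hq
    exact h0 ((stackWalk_mem_cyl_iff b q.1 q.2 n w).1 hq).1

end

/-! ### The coupling and the monotone counts -/

section

variable {d : ℕ}

/-- The space of the coupling: uniform marks at the sites, and two sequences of steps. -/
abbrev Coupling (d : ℕ) : Type := (Site d → unitInterval) × (ℕ → Step d) × (ℕ → Step d)

/-- Uniform i.i.d. marks. -/
abbrev markLaw (d : ℕ) : Measure (Site d → unitInterval) :=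
  Measure.infinitePi fun _ : Site d => volume

/-- The law of the coupling. -/
abbrev coupLaw (γ₁ γ₂ : LocalEnv d) : Measure (Coupling d) :=
  (markLaw d).prod ((stepLaw γ₁).prod (stepLaw γ₂))

open Classical in
/-- The sites of the first type at the parameter `p`. -/
def markType (p : unitInterval) (u : Site d → unitInterval) (x : Site d) : Bool :=
  decide (u x ≤ p)

theorem markType_iff {p : unitInterval} {u : Site d → unitInterval} {x : Site d} :
    markType p u x = true ↔ u x ≤ p := by simp [markType]

theorem measurable_markType (p : unitInterval) : Measurable (markType (d := d) p) := by
  classical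
  refine measurable_pi_lambda _ fun x => ?_
  refine measurable_to_bool ?_
  have : (fun u : Site d → unitInterval => markType p u x) ⁻¹' {true} =
      (fun u => u x) ⁻¹' Set.Iic p := by
    ext u
    simp [markType]
  rw [this]
  exact measurable_pi_apply x measurableSet_Iic

/-- The coupled environments. -/
def coupEnv (γ₁ γ₂ : LocalEnv d) (p : unitInterval) (a : Coupling d) : Env d :=
  boolEnv γ₁ γ₂ (markType p a.1)

/-- The coupled walks. -/
def coupWalk (p : unitInterval) (a : Coupling d) : ℕ → Site d :=
  stackWalk (markType p a.1) a.2.1 a.2.2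

theorem measurable_boolEnv (γ₁ γ₂ : LocalEnv d) : Measurable (boolEnv γ₁ γ₂) :=
  measurable_pi_lambda _ fun x =>
    (measurable_of_countable fun c : Bool => if c then γ₁ else γ₂).comp (measurable_pi_apply x)

theorem measurable_coupEnv (γ₁ γ₂ : LocalEnv d) (p : unitInterval) :
    Measurable (coupEnv γ₁ γ₂ p) :=
  (measurable_boolEnv γ₁ γ₂).comp ((measurable_markType p).comp measurable_fst)

theorem measurable_coupWalk (p : unitInterval) : Measurable (coupWalk (d := d) p) :=
  measurable_stackWalk ((measurable_markType p).comp measurable_fst)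
    (measurable_fst.comp measurable_snd) (measurable_snd.comp measurable_snd)

theorem map_boolEnv_markType (γ₁ γ₂ : LocalEnv d) (p : unitInterval) :
    (markLaw d).map (fun u => boolEnv γ₁ γ₂ (markType p u)) = envLaw γ₁ γ₂ p := by
  classical
  have hf : Measurable fun u : unitInterval => if u ≤ p then γ₁ else γ₂ :=
    Measurable.ite measurableSet_Iic measurable_const measurable_const
  have h1 : (volume : Measure unitInterval).map (fun u => if u ≤ p then γ₁ else γ₂) =
      siteLaw γ₁ γ₂ p := by
    ext s hs
    rw [Measure.map_apply hf hs, siteLaw]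
    simp only [Measure.coe_add, Measure.coe_smul, Pi.add_apply, Pi.smul_apply, smul_eq_mul,
      Measure.dirac_apply' _ hs]
    have h2 : (volume : Measure unitInterval) (Set.Iic p)ᶜ = ENNReal.ofReal (1 - p) := by
      rw [Set.compl_Iic, unitInterval.volume_Ioi]
    by_cases hs1 : γ₁ ∈ s <;> by_cases hs2 : γ₂ ∈ s
    · have : (fun u : unitInterval => if u ≤ p then γ₁ else γ₂) ⁻¹' s = Set.univ := by
        ext u; by_cases hu : u ≤ p <;> simp [hu, hs1, hs2]
      rw [this]
      simp [hs1, hs2, ← ENNReal.ofReal_add p.2.1 (sub_nonneg.2 p.2.2)]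
    · have : (fun u : unitInterval => if u ≤ p then γ₁ else γ₂) ⁻¹' s = Set.Iic p := by
        ext u; by_cases hu : u ≤ p <;> simp [hu, hs1, hs2]
      rw [this]
      simp [hs1, hs2]
    · have : (fun u : unitInterval => if u ≤ p then γ₁ else γ₂) ⁻¹' s = (Set.Iic p)ᶜ := by
        ext u
        by_cases hu : u ≤ p <;>
          simp only [Set.mem_preimage, Set.mem_compl_iff, Set.mem_Iic, hu, hs1, hs2, if_true,
            if_false, not_true_eq_false, not_false_eq_true]
      rw [this, h2]
      simp [hs1, hs2]
    · have : (fun u : unitInterval => if u ≤ p then γ₁ else γ₂) ⁻¹' s = ∅ := by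
        ext u; by_cases hu : u ≤ p <;> simp [hu, hs1, hs2]
      rw [this]
      simp [hs1, hs2]
  have h3 := Measure.infinitePi_map_pi (μ := fun _ : Site d => (volume : Measure unitInterval))
    (f := fun _ u => if u ≤ p then γ₁ else γ₂) (fun _ => hf)
  simp only [h1] at h3
  rw [envLaw, ← h3]
  congr 1
  ext u x
  simp [boolEnv, markType]

/-- Fubini: for fixed marks the walk has the quenched law of the environment they define, and a
uniform mark is at most `p` with probability `p`. -/
theorem isRWRE_coupling (γ₁ γ₂ : LocalEnv d) (p : unitInterval) :
    IsRWRE γ₁ γ₂ p (coupLaw γ₁ γ₂) (coupEnv γ₁ γ₂ p) (coupWalk p) where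
  measurable_env := measurable_coupEnv γ₁ γ₂ p
  measurable_walk := measurable_coupWalk p
  map_eq := by
    have hm : Measurable fun a => (coupEnv γ₁ γ₂ p a, coupWalk p a) :=
      (measurable_coupEnv γ₁ γ₂ p).prodMk (measurable_coupWalk p)
    have hm' : Measurable fun u : Site d → unitInterval => boolEnv γ₁ γ₂ (markType p u) :=
      (measurable_boolEnv γ₁ γ₂).comp (measurable_markType p)
    ext S hS
    rw [Measure.map_apply hm hS, annealedLaw, Measure.compProd_apply hS,
      Measure.prod_apply (hm hS), ← map_boolEnv_markType γ₁ γ₂ p,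
      lintegral_map (Kernel.measurable_kernel_prodMk_left hS) hm']
    refine lintegral_congr fun u => ?_
    rw [← map_stackWalk, Measure.map_apply
      (measurable_stackWalk measurable_const measurable_fst measurable_snd)
      (measurable_prodMk_left hS)]
    rfl

theorem annealedLaw_map_snd (γ₁ γ₂ : LocalEnv d) (p : unitInterval) :
    (annealedLaw γ₁ γ₂ p).map Prod.snd = pathLaw (siteLaw γ₁ γ₂ p) :=
  Measure.snd_compProd _ _

theorem map_coupWalk (γ₁ γ₂ : LocalEnv d) (p : unitInterval) :
    (coupLaw γ₁ γ₂).map (coupWalk p) = pathLaw (siteLaw γ₁ γ₂ p) := by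
  have h := isRWRE_coupling γ₁ γ₂ p
  rw [← annealedLaw_map_snd, ← h.map_eq, Measure.map_map measurable_snd
    (h.measurable_env.prodMk h.measurable_walk)]
  rfl

theorem ae_coupWalk_exists_hasVelocity (γ₁ γ₂ : LocalEnv d) (p : unitInterval) :
    ∀ᵐ a ∂(coupLaw γ₁ γ₂), ∃ v, HasVelocity (coupWalk p a) v := by
  have := ae_exists_hasVelocity (m := siteLaw γ₁ γ₂ p)
  rw [← map_coupWalk] at this
  exact ae_of_ae_map (measurable_coupWalk p).aemeasurable this

/-- The number of steps of the first kind used by the coupled walk. -/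
def coupCount (p : unitInterval) (a : Coupling d) (n : ℕ) : ℕ :=
  stackCount (markType p a.1) a.2.1 a.2.2 n

/-- Since the two local laws differ, the type of a site can be read off its environment. -/
theorem visits_coupling {γ₁ γ₂ : LocalEnv d} (hγ : γ₁ ≠ γ₂) (p : unitInterval) (a : Coupling d)
    (n : ℕ) : visits γ₁ (coupEnv γ₁ γ₂ p a) (coupWalk p a) n = coupCount p a n := by
  rw [coupCount, stackCount_eq_boolVisits]
  unfold visits boolVisits
  congr 1
  refine Finset.filter_congr fun i _ => ?_
  change (if markType p a.1 (coupWalk p a i) = true then γ₁ else γ₂) = γ₁ ↔ _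
  by_cases hb : markType p a.1 (coupWalk p a i) = true
  · rw [if_pos hb]
    exact ⟨fun _ => hb, fun _ => rfl⟩
  · rw [if_neg hb]
    exact ⟨fun h => absurd h.symm hγ, fun h => absurd h hb⟩

/-- The heart of the coupling. A strict inequality survives one step because counts grow by at most
1; if the counts are equal then so are the positions, and a site in `b` is in `b'`. -/
theorem stackCount_mono {b b' : Site d → Bool} (hb : ∀ x, b x → b' x) (y₁ y₂ : ℕ → Step d)
    (n : ℕ) : stackCount b y₁ y₂ n ≤ stackCount b' y₁ y₂ n := by
  induction n with
  | zero => exact le_rfl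
  | succ n ih =>
    rw [stackCount_succ, stackCount_succ]
    rcases ih.lt_or_eq with h | h
    · split_ifs <;> omega
    · have hw : stackWalk b y₁ y₂ n = stackWalk b' y₁ y₂ n := by
        rw [stackWalk, stackWalk, h]
      rw [hw, h]
      by_cases h1 : b (stackWalk b' y₁ y₂ n)
      · rw [if_pos h1, if_pos (hb _ h1)]
      · rw [if_neg h1]
        omega

theorem coupCount_mono {p p' : unitInterval} (hp : p ≤ p') (a : Coupling d) (n : ℕ) :
    coupCount p a n ≤ coupCount p' a n :=
  stackCount_mono (fun _ hx => markType_iff.2 ((markType_iff.1 hx).trans hp)) _ _ n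

theorem ae_step_ne {γ : LocalEnv d} {e : Site d} (he : e ∉ directions γ) :
    ∀ᵐ y ∂(stepLaw γ), ∀ i, (y i : Site d) ≠ e := by
  refine ae_all_iff.2 fun i => ?_
  have h1 : (γ : Measure (Step d)) {s : Step d | (s : Site d) = e} = 0 := by
    have h2 : ¬ 0 < prob γ e := he
    have h3 : prob γ e = 0 := le_antisymm (not_lt.1 h2) measureReal_nonneg
    exact (measureReal_eq_zero_iff).1 h3
  have h4 := Measure.infinitePi_map_eval (μ := fun _ : ℕ => (γ : Measure (Step d))) i
  have h5 : ∀ᵐ s : Step d ∂(γ : Measure (Step d)), (s : Site d) ≠ e := by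
    rw [ae_iff]
    simpa using h1
  rw [← h4] at h5
  exact ae_of_ae_map (measurable_pi_apply i).aemeasurable h5

theorem dotProduct_unitVectors {e s : Site d} (he : e ∈ unitVectors d) (hs : s ∈ unitVectors d) :
    (s = e ∧ s ⬝ᵥ e = 1) ∨ (s = -e ∧ s ⬝ᵥ e = -1) ∨ s ⬝ᵥ e = 0 := by
  simp only [unitVectors, Finset.mem_union, Finset.mem_image, Finset.mem_univ, true_and] at he hs
  rcases he with ⟨k, rfl⟩ | ⟨k, rfl⟩ <;> rcases hs with ⟨l, rfl⟩ | ⟨l, rfl⟩ <;>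
    by_cases hkl : l = k
  all_goals first | (subst hkl; simp [← Pi.single_neg]) | simp [hkl]

theorem mem_unitVectors_of_directions {γ : LocalEnv d} {e : Site d} (he : e ∈ directions γ) :
    e ∈ unitVectors d := by
  by_contra hcon
  have : {s : Step d | (s : Site d) = e} = ∅ := by
    rw [Set.eq_empty_iff_forall_notMem]
    rintro s rfl
    exact hcon s.2
  have h1 : 0 < prob γ e := he
  rw [prob, this, measureReal_empty] at h1
  exact lt_irrefl _ h1

theorem stepSum_dotProduct_monotone {e : Site d} (he : e ∈ unitVectors d) {y : ℕ → Step d}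
    (hy : ∀ i, (y i : Site d) ≠ -e) : Monotone fun n => stepSum y n ⬝ᵥ e := by
  refine monotone_nat_of_le_succ fun n => ?_
  rw [stepSum_succ, add_dotProduct]
  rcases dotProduct_unitVectors he (y n).2 with h | h | h
  · omega
  · exact absurd h.1 (hy n)
  · omega

/-- The first stack never contains `-e` and the second never contains `e`. Replacing steps of the
second by steps of the first thus never decreases the component along `e`. -/
theorem ae_coupWalk_dotProduct_le {γ₁ γ₂ : LocalEnv d} {p p' : unitInterval} (hp : p ≤ p')
    {e : Site d} (h1 : e ∈ directions γ₁) (h2 : e ∉ directions γ₂) (h3 : -e ∉ directions γ₁) :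
    ∀ᵐ a ∂(coupLaw γ₁ γ₂), ∀ n, coupWalk p a n ⬝ᵥ e ≤ coupWalk p' a n ⬝ᵥ e := by
  have he := mem_unitVectors_of_directions h1
  have hne : -e ∈ unitVectors d := by
    simp only [unitVectors, Finset.mem_union, Finset.mem_image, Finset.mem_univ, true_and] at he ⊢
    rcases he with ⟨k, rfl⟩ | ⟨k, rfl⟩
    · exact Or.inr ⟨k, by simp [Pi.single_neg]⟩
    · exact Or.inl ⟨k, by simp [← Pi.single_neg]⟩
  have hae1 : ∀ᵐ a ∂(coupLaw γ₁ γ₂), ∀ i, (a.2.1 i : Site d) ≠ -e :=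
    Measure.quasiMeasurePreserving_snd.ae (Measure.quasiMeasurePreserving_fst.ae (ae_step_ne h3))
  have hae2 : ∀ᵐ a ∂(coupLaw γ₁ γ₂), ∀ i, (a.2.2 i : Site d) ≠ e :=
    Measure.quasiMeasurePreserving_snd.ae (Measure.quasiMeasurePreserving_snd.ae (ae_step_ne h2))
  filter_upwards [hae1, hae2] with a ha1 ha2 n
  have hN := coupCount_mono hp a n
  have hm1 := stepSum_dotProduct_monotone he ha1 hN
  have hm2 := stepSum_dotProduct_monotone hne (by simpa using ha2) (Nat.sub_le_sub_left hN n)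
  simp only [dotProduct_neg] at hm1 hm2
  simp only [coupWalk, stackWalk, add_dotProduct]
  simp only [coupCount] at hm1 hm2
  omega

end

/-! ### Ordering of the velocities -/

section

variable {d : ℕ}

theorem integral_step_coord (γ : LocalEnv d) (i : Fin d) :
    ∫ s : Step d, ((s : Site d) i : ℝ) ∂(γ : Measure (Step d)) = drift γ i := by
  rw [integral_fintype (Integrable.of_finite), drift, Finset.sum_apply,
    ← Finset.sum_coe_sort (unitVectors d)]
  refine Finset.sum_congr rfl fun s _ => ?_
  have : {s' : Step d | (s' : Site d) = s} = {s} := by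
    ext s'
    exact Subtype.ext_iff.symm
  simp only [prob, this, Pi.smul_apply, toReal, smul_eq_mul]

/-- The strong law of large numbers for the sums of i.i.d. steps. -/
theorem ae_tendsto_stepSum (γ : LocalEnv d) : ∀ᵐ y ∂(stepLaw γ), ∀ i,
    Tendsto (fun n : ℕ => (stepSum y n i : ℝ) / n) atTop (𝓝 (drift γ i)) := by
  refine ae_all_iff.2 fun i => ?_
  have hm : Measurable fun s : Step d => ((s : Site d) i : ℝ) := measurable_of_countable _
  have hmap : ∀ k, (stepLaw γ).map (fun y => y k) = (γ : Measure (Step d)) := fun k =>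
    Measure.infinitePi_map_eval (μ := fun _ : ℕ => (γ : Measure (Step d))) k
  have hint : Integrable (fun y : ℕ → Step d => ((y 0 : Site d) i : ℝ)) (stepLaw γ) := by
    have h1 : Integrable (fun s : Step d => ((s : Site d) i : ℝ))
        ((stepLaw γ).map (fun y => y 0)) := by
      rw [hmap]; exact Integrable.of_finite
    exact h1.comp_measurable (measurable_pi_apply 0)
  have hE : ∫ y, ((y 0 : Site d) i : ℝ) ∂(stepLaw γ) = drift γ i := by
    rw [← integral_step_coord, ← hmap 0, integral_map (measurable_pi_apply 0).aemeasurable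
      hm.aestronglyMeasurable]
  have hind := iIndepFun_infinitePi (P := fun _ : ℕ => (γ : Measure (Step d)))
    (X := fun _ (s : Step d) => ((s : Site d) i : ℝ)) fun _ => hm
  have h := strong_law_ae_real (μ := stepLaw γ) (fun k y => ((y k : Site d) i : ℝ)) hint
    (fun k l hkl => hind.indepFun hkl) fun k => by
      refine ⟨(hm.comp (measurable_pi_apply k)).aemeasurable,
        (hm.comp (measurable_pi_apply 0)).aemeasurable, ?_⟩
      have h1 := Measure.map_map (μ := stepLaw γ) hm (measurable_pi_apply k)
      have h2 := Measure.map_map (μ := stepLaw γ) hm (measurable_pi_apply 0)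
      rw [hmap] at h1 h2
      exact h1.symm.trans h2
  rw [hE] at h
  filter_upwards [h] with y hy
  refine hy.congr fun n => ?_
  simp [stepSum, Finset.sum_apply]

theorem exists_abs_sub_le {f : ℕ → ℝ} {u : ℝ} (hf : Tendsto (fun n : ℕ => f n / n) atTop (𝓝 u))
    {ε : ℝ} (hε : 0 < ε) : ∃ C, ∀ k : ℕ, |f k - u * k| ≤ ε * k + C := by
  obtain ⟨K, hK⟩ := Metric.tendsto_atTop.1 hf ε hε
  refine ⟨∑ k ∈ Finset.range (K + 1), |f k - u * k|, fun k => ?_⟩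
  rcases le_or_gt k K with hk | hk
  · have h1 := Finset.single_le_sum (f := fun k : ℕ => |f k - u * k|) (fun _ _ => abs_nonneg _)
      (Finset.mem_range.2 (Nat.lt_succ_of_le hk))
    have h2 : 0 ≤ ε * k := by positivity
    linarith
  · have hk0 : (0 : ℝ) < k := by exact_mod_cast (Nat.zero_le _).trans_lt hk
    have h1 := hK k hk.le
    have h2 : |f k - u * k| ≤ ε * k := by
      have h3 : f k - u * k = (f k / k - u) * k := by field_simp
      rw [h3, abs_mul, abs_of_pos hk0]
      exact mul_le_mul_of_nonneg_right h1.le hk0.le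
    have h3 : 0 ≤ ∑ k ∈ Finset.range (K + 1), |f k - u * k| :=
      Finset.sum_nonneg fun _ _ => abs_nonneg _
    linarith

/-- No growth of `N` is required: the error at `N n` is at most `ε N n + C`, hence at most `ε n +
C`. -/
theorem tendsto_sub_div_of_le {f : ℕ → ℝ} {u : ℝ}
    (hf : Tendsto (fun n : ℕ => f n / n) atTop (𝓝 u)) {N : ℕ → ℕ} (hN : ∀ n, N n ≤ n) :
    Tendsto (fun n : ℕ => (f (N n) - u * N n) / n) atTop (𝓝 0) := by
  rw [Metric.tendsto_atTop]
  intro ε hε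
  obtain ⟨C, hC⟩ := exists_abs_sub_le hf (half_pos hε)
  obtain ⟨K, hK⟩ := exists_nat_gt (2 * C / ε)
  refine ⟨K + 1, fun n hn => ?_⟩
  have hn0 : (0 : ℝ) < n := by exact_mod_cast (Nat.succ_pos K).trans_le hn
  have hKn : (K : ℝ) < n := by exact_mod_cast hn
  rw [dist_zero_right, Real.norm_eq_abs, abs_div, abs_of_pos hn0, div_lt_iff₀ hn0]
  have h1 := hC (N n)
  have h2 : (N n : ℝ) ≤ n := by exact_mod_cast hN n
  have h3 : 2 * C < n * ε := by
    rw [div_lt_iff₀ hε] at hK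
    nlinarith
  nlinarith

theorem tendsto_stackWalk {γ₁ γ₂ : LocalEnv d} (b : Site d → Bool) {y₁ y₂ : ℕ → Step d}
    (h₁ : ∀ i, Tendsto (fun n : ℕ => (stepSum y₁ n i : ℝ) / n) atTop (𝓝 (drift γ₁ i)))
    (h₂ : ∀ i, Tendsto (fun n : ℕ => (stepSum y₂ n i : ℝ) / n) atTop (𝓝 (drift γ₂ i)))
    (i : Fin d) : Tendsto (fun n : ℕ => ((stackWalk b y₁ y₂ n i : ℝ) -
      drift γ₁ i * stackCount b y₁ y₂ n - drift γ₂ i * (n - stackCount b y₁ y₂ n)) / n)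
      atTop (𝓝 0) := by
  have h3 := (tendsto_sub_div_of_le (h₁ i) (N := stackCount b y₁ y₂) (stackCount_le b y₁ y₂)).add
    (tendsto_sub_div_of_le (h₂ i) (N := fun n => n - stackCount b y₁ y₂ n)
      fun n => Nat.sub_le _ _)
  rw [add_zero] at h3
  refine h3.congr fun n => ?_
  rw [← add_div, Nat.cast_sub (stackCount_le b y₁ y₂ n), stackWalk, Pi.add_apply]
  push_cast
  ring

theorem ae_coupling_steps (γ₁ γ₂ : LocalEnv d) : ∀ᵐ a ∂(coupLaw γ₁ γ₂),
    (∀ i, Tendsto (fun n : ℕ => (stepSum a.2.1 n i : ℝ) / n) atTop (𝓝 (drift γ₁ i))) ∧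
    ∀ i, Tendsto (fun n : ℕ => (stepSum a.2.2 n i : ℝ) / n) atTop (𝓝 (drift γ₂ i)) := by
  filter_upwards [Measure.quasiMeasurePreserving_snd.ae
      (Measure.quasiMeasurePreserving_fst.ae (ae_tendsto_stepSum γ₁)),
    Measure.quasiMeasurePreserving_snd.ae
      (Measure.quasiMeasurePreserving_snd.ae (ae_tendsto_stepSum γ₂))] with a h1 h2
  exact ⟨h1, h2⟩

/-- The difference of the velocities is a nonnegative multiple of the difference of the drifts. -/
theorem velocity_le {γ₁ γ₂ : LocalEnv d} {p p' : unitInterval} (hp : p ≤ p') {a : Coupling d}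
    (h₁ : ∀ i, Tendsto (fun n : ℕ => (stepSum a.2.1 n i : ℝ) / n) atTop (𝓝 (drift γ₁ i)))
    (h₂ : ∀ i, Tendsto (fun n : ℕ => (stepSum a.2.2 n i : ℝ) / n) atTop (𝓝 (drift γ₂ i)))
    {v v' : Fin d → ℝ} (hv : HasVelocity (coupWalk p a) v) (hv' : HasVelocity (coupWalk p' a) v')
    {u : Fin d → ℝ} (hu : 0 ≤ (drift γ₁ - drift γ₂) ⬝ᵥ u) : v ⬝ᵥ u ≤ v' ⬝ᵥ u := by
  have h3 : Tendsto (fun n : ℕ => ((coupCount p' a n : ℝ) - coupCount p a n) / n *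
      ((drift γ₁ - drift γ₂) ⬝ᵥ u)) atTop (𝓝 (v' ⬝ᵥ u - v ⬝ᵥ u)) := by
    -- Subtract the expansions of the two walks; only the difference of the counts times the
    -- difference of the drifts remains.
    have h4 : Tendsto (fun n : ℕ => (((coupCount p' a n : ℝ) - coupCount p a n) / n) •
        (drift γ₁ - drift γ₂)) atTop (𝓝 (v' - v)) := by
      refine tendsto_pi_nhds.2 fun i => ?_
      have h5 := ((tendsto_pi_nhds.1 hv' i).sub (tendsto_pi_nhds.1 hv i)).sub
        ((tendsto_stackWalk (markType p' a.1) h₁ h₂ i).sub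
          (tendsto_stackWalk (markType p a.1) h₁ h₂ i))
      rw [sub_zero, sub_zero] at h5
      refine h5.congr fun n => ?_
      simp only [coupWalk, coupCount, Pi.smul_apply, toReal, smul_eq_mul, Pi.sub_apply]
      ring
    have h6 : Continuous fun w : Fin d → ℝ => w ⬝ᵥ u := by
      unfold dotProduct; fun_prop
    have h7 := (h6.tendsto _).comp h4
    rw [sub_dotProduct] at h7
    refine h7.congr fun n => ?_
    simp [smul_dotProduct]
  refine sub_nonneg.1 (ge_of_tendsto' h3 fun n => mul_nonneg (div_nonneg ?_ (by positivity)) hu)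
  rw [sub_nonneg]
  exact_mod_cast coupCount_mono hp a n

open Classical in
/-- The limiting velocity of the coupled walk, where it exists. -/
def coupVelocity (p : unitInterval) (a : Coupling d) : Fin d → ℝ :=
  if h : ∃ v, HasVelocity (coupWalk p a) v then h.choose else 0

theorem ae_hasVelocity_coupVelocity (γ₁ γ₂ : LocalEnv d) (p : unitInterval) :
    ∀ᵐ a ∂(coupLaw γ₁ γ₂), HasVelocity (coupWalk p a) (coupVelocity p a) := by
  filter_upwards [ae_coupWalk_exists_hasVelocity γ₁ γ₂ p] with a ha
  rw [coupVelocity, dif_pos ha]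
  exact ha.choose_spec

theorem ae_coupVelocity_le {γ₁ γ₂ : LocalEnv d} {p p' : unitInterval} (hp : p ≤ p')
    {u : Fin d → ℝ} (hu : 0 ≤ (drift γ₁ - drift γ₂) ⬝ᵥ u) :
    ∀ᵐ a ∂(coupLaw γ₁ γ₂), coupVelocity p a ⬝ᵥ u ≤ coupVelocity p' a ⬝ᵥ u := by
  filter_upwards [ae_coupling_steps γ₁ γ₂, ae_hasVelocity_coupVelocity γ₁ γ₂ p,
    ae_hasVelocity_coupVelocity γ₁ γ₂ p'] with a ha hv hv'
  exact velocity_le hp ha.1 ha.2 hv hv' hu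

/-- Both deterministic limits are realised in the coupling, and a single good sample point is enough
to compare them. -/
theorem deterministic_velocity_le {γ₁ γ₂ : LocalEnv d} {p p' : unitInterval} (hp : p ≤ p')
    {v v' : Fin d → ℝ} (hv : ∀ᵐ z ∂(annealedLaw γ₁ γ₂ p), HasVelocity z.2 v)
    (hv' : ∀ᵐ z ∂(annealedLaw γ₁ γ₂ p'), HasVelocity z.2 v')
    {u : Fin d → ℝ} (hu : 0 ≤ (drift γ₁ - drift γ₂) ⬝ᵥ u) : v ⬝ᵥ u ≤ v' ⬝ᵥ u := by
  have h : ∀ (q : unitInterval) (w : Fin d → ℝ),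
      (∀ᵐ z ∂(annealedLaw γ₁ γ₂ q), HasVelocity z.2 w) →
      ∀ᵐ a ∂(coupLaw γ₁ γ₂), HasVelocity (coupWalk q a) w := by
    intro q w hw
    have hq := isRWRE_coupling γ₁ γ₂ q
    rw [← hq.map_eq] at hw
    exact ae_of_ae_map (hq.measurable_env.prodMk hq.measurable_walk).aemeasurable hw
  obtain ⟨a, ha, h1, h2⟩ := ((ae_coupling_steps γ₁ γ₂).and
    ((h p v hv).and (h p' v' hv'))).exists
  exact velocity_le hp ha.1 ha.2 h1 h2 hu

theorem monotoneOn_or_antitoneOn_velocity {γ₁ γ₂ : LocalEnv d} {S : Set unitInterval}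
    {v : unitInterval → Fin d → ℝ}
    (hv : ∀ p ∈ S, ∀ᵐ z ∂(annealedLaw γ₁ γ₂ p), HasVelocity z.2 (v p)) (i : Fin d) :
    MonotoneOn (fun p => v p i) S ∨ AntitoneOn (fun p => v p i) S := by
  rcases le_total (drift γ₂ i) (drift γ₁ i) with h | h
  · left
    intro p hp p' hp' hpp
    have := deterministic_velocity_le hpp (hv p hp) (hv p' hp') (u := Pi.single i 1)
      (by simpa using h)
    simpa using this
  · right
    intro p hp p' hp' hpp
    have := deterministic_velocity_le hpp (hv p hp) (hv p' hp') (u := Pi.single i (-1))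
      (by simpa using h)
    simpa using this

end

/-! ### Fresh tails of an i.i.d. sequence of steps -/

section

variable {d : ℕ}

/-- The tail of a sequence. -/
def tail {E : Type*} (c : ℕ) (y : ℕ → E) : ℕ → E := fun k => y (c + k)

theorem measurable_tail {E : Type*} [MeasurableSpace E] (c : ℕ) :
    Measurable (tail c : (ℕ → E) → ℕ → E) := by
  unfold tail; fun_prop

theorem measurePreserving_tail {E : Type*} [MeasurableSpace E] (μ : Measure E)
    [IsProbabilityMeasure μ] (c : ℕ) :
    MeasurePreserving (tail c) (Measure.infinitePi fun _ : ℕ => μ)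
      (Measure.infinitePi fun _ : ℕ => μ) := by
  refine ⟨measurable_tail c, Measure.eq_infinitePi _ fun s t ht => ?_⟩
  rw [Measure.map_apply (measurable_tail c) (MeasurableSet.pi s.countable_toSet fun i _ => ht i)]
  have : tail c ⁻¹' (Set.pi (s : Set ℕ) t) = {y | ∀ i ∈ s, y (c + i) ∈ t i} := by
    ext y; simp [tail, Set.mem_pi]
  rw [this, infinitePi_forall_mem s (fun i _ j _ hij => Nat.add_left_cancel hij) ht]

/-- Membership is decided by the entries before time `c`. -/
def DetBefore {E : Type*} (c : ℕ) (B : Set (ℕ → E)) : Prop :=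
  ∀ ⦃x y⦄, (∀ i < c, x i = y i) → x ∈ B → y ∈ B

theorem DetBefore.mono {E : Type*} {c c' : ℕ} {B : Set (ℕ → E)} (hB : DetBefore c B)
    (h : c ≤ c') : DetBefore c' B := fun _ _ hxy hx => hB (fun i hi => hxy i (hi.trans_le h)) hx

theorem DetBefore.inter {E : Type*} {c : ℕ} {B C : Set (ℕ → E)} (hB : DetBefore c B)
    (hC : DetBefore c C) : DetBefore c (B ∩ C) := fun _ _ hxy hx => ⟨hB hxy hx.1, hC hxy hx.2⟩

theorem DetBefore.compl {E : Type*} {c : ℕ} {B : Set (ℕ → E)} (hB : DetBefore c B) :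
    DetBefore c Bᶜ := fun _ _ hxy hx hy => hx (hB (fun i hi => (hxy i hi).symm) hy)

theorem DetBefore.initDet {E : Type*} {c : ℕ} {B : Set (ℕ → E)} (hB : DetBefore c B) :
    InitDet c B := fun _ _ hxy hx => hB (fun i hi => hxy i hi.le) hx

theorem measure_inter_tail {γ : LocalEnv d} {c : ℕ} {B A : Set (ℕ → Step d)}
    (hB : DetBefore c B) (hA : MeasurableSet A) :
    stepLaw γ (B ∩ tail c ⁻¹' A) = stepLaw γ B * stepLaw γ A := by
  classical
  have hBm := hB.initDet.measurableSet
  have hA' : MeasurableSet (tail c ⁻¹' A) := measurable_tail c hA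
  have h := lintegral_mul_infinitePi (γ : Measure (Step d)) (ι := ℕ)
    (f := B.indicator 1) (g := (tail c ⁻¹' A).indicator 1) (measurable_one.indicator hBm)
    (measurable_one.indicator hA') (S := {i | i < c}) (T := {i | c ≤ i}) ?_ ?_ ?_
  · rw [lintegral_indicator_one hBm, lintegral_indicator_one hA',
      (measurePreserving_tail _ c).measure_preimage hA.nullMeasurableSet] at h
    rw [← h, ← lintegral_indicator_one (hBm.inter hA')]
    refine lintegral_congr fun y => ?_
    rw [Set.inter_indicator_one]
    rfl
  · intro x y hxy
    have : x ∈ B ↔ y ∈ B := ⟨fun hx => hB (fun i hi => hxy i hi) hx,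
      fun hy => hB (fun i hi => (hxy i hi).symm) hy⟩
    simp [Set.indicator_apply, this]
  · intro x y hxy
    have : tail c x = tail c y := by
      ext1 k
      exact hxy (c + k) (by simp)
    simp [Set.indicator_apply, this]
  · rw [Set.disjoint_left]
    intro i hi hi'
    exact absurd (show c ≤ i from hi') (not_le.2 hi)

/-- If `Q c` is decided before time `c` and holds for arbitrarily large `c`, then at one of these
times the tail of the sequence lies in the given set of positive probability. -/
theorem ae_exists_tail_mem {γ : LocalEnv d} {Q : ℕ → Set (ℕ → Step d)}
    (hQ : ∀ c, DetBefore c (Q c)) {W : Set (ℕ → Step d)} (hW : MeasurableSet W)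
    (hW0 : stepLaw γ W ≠ 0) :
    ∀ᵐ y ∂(stepLaw γ), (∀ M, ∃ c, M ≤ c ∧ y ∈ Q c) → ∃ c, y ∈ Q c ∧ tail c y ∈ W := by
  set G : Set (ℕ → Step d) := (⋂ M, ⋃ c, ⋃ (_ : M ≤ c), Q c) ∩
    ⋂ c, (Q c ∩ tail c ⁻¹' W)ᶜ with hG
  have hQm : ∀ c, MeasurableSet (Q c) := fun c => (hQ c).initDet.measurableSet
  have hGm : MeasurableSet G :=
    (MeasurableSet.iInter fun M => MeasurableSet.iUnion fun c => MeasurableSet.iUnion fun _ =>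
      hQm c).inter (MeasurableSet.iInter fun c => ((hQm c).inter (measurable_tail c hW)).compl)
  suffices hz : stepLaw γ G = 0 by
    filter_upwards [measure_eq_zero_iff_ae_notMem.1 hz] with y hy hyQ
    by_contra hcon
    push Not at hcon
    refine hy ⟨Set.mem_iInter.2 fun M => ?_, Set.mem_iInter.2 fun c hc => hcon c hc.1 hc.2⟩
    obtain ⟨c, hc, hc'⟩ := hyQ M
    exact Set.mem_iUnion₂.2 ⟨c, hc, hc'⟩
  have hc0 : 0 < (stepLaw γ).real W := ENNReal.toReal_pos hW0 (measure_ne_top _ _)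
  refine measure_eq_zero_of_forall_initDet _ hGm (c := 1 - (stepLaw γ).real W) (by linarith)
    fun n B hBm hB => ?_
  -- The first success of `Q` at a time beyond `n`, together with the given past `B`; the tail from
  -- that time is independent of it.
  set F : ℕ → Set (ℕ → Step d) := fun u =>
    (B ∩ Q (n + 1 + u)) ∩ ⋂ v, ⋂ (_ : v < u), (Q (n + 1 + v))ᶜ with hF
  have hFdet : ∀ u, DetBefore (n + 1 + u) (F u) := by
    intro u
    refine DetBefore.inter (DetBefore.inter ?_ (hQ _)) ?_
    · exact fun x y hxy hx => hB (fun i hi => hxy i (by omega)) hx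
    · intro x y hxy hx
      refine Set.mem_iInter₂.2 fun v hv => ?_
      exact (hQ (n + 1 + v)).compl (fun i hi => hxy i (by omega)) (Set.mem_iInter₂.1 hx v hv)
  have hFm : ∀ u, MeasurableSet (F u) := fun u => (hFdet u).initDet.measurableSet
  have hdisj : Pairwise (Function.onFun Disjoint F) := by
    intro u v huv
    rw [Function.onFun, Set.disjoint_left]
    intro y hy hy'
    rcases lt_or_gt_of_ne huv with h | h
    · exact Set.mem_iInter₂.1 hy'.2 u h hy.1.2
    · exact Set.mem_iInter₂.1 hy.2 v h hy'.1.2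
  have hsub : G ∩ B ⊆ ⋃ u, F u ∩ tail (n + 1 + u) ⁻¹' Wᶜ := by
    classical
    rintro y ⟨⟨hy1, hy2⟩, hyB⟩
    have hex : ∃ u, y ∈ Q (n + 1 + u) := by
      obtain ⟨c, hc, hcQ⟩ := Set.mem_iUnion₂.1 (Set.mem_iInter.1 hy1 (n + 1))
      obtain ⟨u, rfl⟩ := Nat.exists_eq_add_of_le hc
      exact ⟨u, hcQ⟩
    refine Set.mem_iUnion.2 ⟨Nat.find hex, ⟨⟨hyB, Nat.find_spec hex⟩,
      Set.mem_iInter₂.2 fun v hv => Nat.find_min hex hv⟩, fun hW' => ?_⟩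
    exact Set.mem_iInter.1 hy2 _ ⟨Nat.find_spec hex, hW'⟩
  have hle : stepLaw γ (G ∩ B) ≤ stepLaw γ B * (1 - stepLaw γ W) := by
    calc stepLaw γ (G ∩ B) ≤ ∑' u, stepLaw γ (F u ∩ tail (n + 1 + u) ⁻¹' Wᶜ) :=
          (measure_mono hsub).trans (measure_iUnion_le _)
      _ = ∑' u, stepLaw γ (F u) * (1 - stepLaw γ W) := by
          refine tsum_congr fun u => ?_
          rw [measure_inter_tail (hFdet u) hW.compl, prob_compl_eq_one_sub hW]
      _ ≤ _ := by
          rw [ENNReal.tsum_mul_right, ← measure_iUnion hdisj hFm]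
          exact mul_le_mul_left (measure_mono (Set.iUnion_subset fun u =>
            Set.inter_subset_left.trans Set.inter_subset_left)) _
  have := ENNReal.toReal_mono (ENNReal.mul_ne_top (measure_ne_top _ _) (by simp)) hle
  rw [ENNReal.toReal_mul, ENNReal.toReal_sub_of_le prob_le_one ENNReal.one_ne_top,
    ENNReal.toReal_one, mul_comm] at this
  exact this

/-- Partial sums of a function of the steps. -/
def partialSum (φ : Step d → ℝ) (y : ℕ → Step d) (n : ℕ) : ℝ := ∑ i ∈ Finset.range n, φ (y i)

theorem partialSum_add (φ : Step d → ℝ) (y : ℕ → Step d) (c k : ℕ) :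
    partialSum φ y (c + k) = partialSum φ y c + partialSum φ (tail c y) k :=
  Finset.sum_range_add _ _ _

theorem measurable_partialSum (φ : Step d → ℝ) (n : ℕ) :
    Measurable fun y : ℕ → Step d => partialSum φ y n := by
  unfold partialSum
  exact Finset.measurable_fun_sum _ fun i _ =>
    (measurable_of_countable φ).comp (measurable_pi_apply i)

/-- The sequences whose partial sums stay nonnegative. -/
def nonnegSet (φ : Step d → ℝ) : Set (ℕ → Step d) := {y | ∀ k, 0 ≤ partialSum φ y k}

theorem measurableSet_nonnegSet (φ : Step d → ℝ) : MeasurableSet (nonnegSet φ) := by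
  have : nonnegSet φ = ⋂ k, {y | 0 ≤ partialSum φ y k} := by ext y; simp [nonnegSet]
  rw [this]
  exact MeasurableSet.iInter fun k => measurableSet_le measurable_const (measurable_partialSum φ k)

/-- Partial sums that tend to infinity attain a global minimum, and the tail from there has
nonnegative partial sums. If this had probability 0, then almost surely no tail would have the
property. -/
theorem stepLaw_nonnegSet_ne_zero {γ : LocalEnv d} {φ : Step d → ℝ}
    (hφ : ∀ᵐ y ∂(stepLaw γ), Tendsto (partialSum φ y) atTop atTop) :
    stepLaw γ (nonnegSet φ) ≠ 0 := by
  intro h0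
  have hnull : ∀ᵐ y ∂(stepLaw γ), ∀ c, tail c y ∉ nonnegSet φ := by
    refine ae_all_iff.2 fun c => ?_
    exact (measurePreserving_tail _ c).quasiMeasurePreserving.ae
      (p := fun y => y ∉ nonnegSet φ) (measure_eq_zero_iff_ae_notMem.1 h0)
  obtain ⟨y, hy, hy'⟩ := (hφ.and hnull).exists
  obtain ⟨K, hK⟩ := eventually_atTop.1 (hy.eventually_ge_atTop 0)
  obtain ⟨c, -, hc⟩ := Finset.exists_min_image (Finset.range (K + 1)) (partialSum φ y) ⟨0, by simp⟩
  refine hy' c fun k => ?_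
  have h1 : partialSum φ y c ≤ partialSum φ y (c + k) := by
    by_cases hck : c + k ≤ K
    · exact hc _ (Finset.mem_range.2 (by omega))
    · refine le_trans ?_ (hK (c + k) (by omega))
      have := hc 0 (by simp)
      simpa [partialSum] using this
  rw [partialSum_add] at h1
  linarith

theorem exists_direction (γ : LocalEnv d) : ∃ s : Step d, (γ : Measure (Step d)) {s} ≠ 0 := by
  by_contra hcon
  push Not at hcon
  have h1 : (γ : Measure (Step d)) Set.univ = 0 := by
    rw [← Set.biUnion_of_singleton Set.univ]
    exact (measure_biUnion_null_iff (Set.to_countable _)).2 fun s _ => hcon s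
  rw [measure_univ] at h1
  exact one_ne_zero h1

/-- The partial sums of i.i.d. steps visit infinitely many sites. -/
theorem ae_infinite_range_stepSum (γ : LocalEnv d) :
    ∀ᵐ y ∂(stepLaw γ), ∀ j, (Set.range fun k => stepSum y (j + k)).Infinite := by
  obtain ⟨s, hs⟩ := exists_direction γ
  -- Arbitrarily long runs of one charged direction occur after every time, and a run visits as many
  -- distinct sites as its length. This needs no drift or ellipticity.
  have hruns : ∀ᵐ y ∂(stepLaw γ), ∀ j L : ℕ, ∃ c, j ≤ c ∧ ∀ i ∈ Finset.range L, y (c + i) = s := by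
    refine ae_all_iff.2 fun j => ae_all_iff.2 fun L => ?_
    set W : Set (ℕ → Step d) := {y | ∀ i ∈ Finset.range L, y i ∈ ({s} : Set (Step d))} with hW
    have hWm : MeasurableSet W := by
      have : W = ⋂ i ∈ Finset.range L, (fun y => y i) ⁻¹' {s} := by ext y; simp [hW]
      rw [this]
      exact Finset.measurableSet_biInter _ fun i _ =>
        measurable_pi_apply i (measurableSet_singleton s)
    have hW0 : stepLaw γ W ≠ 0 := by
      rw [hW, infinitePi_forall_mem (Finset.range L) (k := fun i => i) (fun i _ k _ hik => hik)
        fun i => measurableSet_singleton s]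
      exact Finset.prod_ne_zero_iff.2 fun i _ => hs
    filter_upwards [ae_exists_tail_mem (γ := γ) (Q := fun c => {_y | j ≤ c})
      (fun c _ _ _ hx => hx) hWm hW0] with y hy
    obtain ⟨c, hc, hc'⟩ := hy fun M => ⟨max M j, le_max_left _ _, le_max_right M j⟩
    exact ⟨c, hc, fun i hi => hc' i hi⟩
  filter_upwards [hruns] with y hy j hfin
  have hs0 : (s : Site d) ≠ 0 := by
    intro h0
    have := dotProduct_unitVectors s.2 s.2
    rw [h0] at this
    have h1 := s.2
    rw [h0] at h1
    simp only [unitVectors, Finset.mem_union, Finset.mem_image, Finset.mem_univ, true_and] at h1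
    rcases h1 with ⟨k, hk⟩ | ⟨k, hk⟩
    all_goals
      have := congrFun hk k
      simp at this
  obtain ⟨c, hjc, hc⟩ := hy j (hfin.toFinset.card + 1)
  obtain ⟨e, rfl⟩ := Nat.exists_eq_add_of_le hjc
  have hval : ∀ i ≤ hfin.toFinset.card + 1,
      stepSum y (j + e + i) = stepSum y (j + e) + i • (s : Site d) := by
    intro i
    induction i with
    | zero => intro _; simp
    | succ i ih =>
      intro hi
      rw [← add_assoc, stepSum_succ, ih (by omega), hc i (Finset.mem_range.2 (by omega)),
        succ_nsmul, add_assoc]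
  have hinj : Set.InjOn (fun i => stepSum y (j + e + i))
      (Finset.range (hfin.toFinset.card + 1) : Set ℕ) := by
    intro i hi k hk hik
    rw [Finset.coe_range, Set.mem_Iio] at hi hk
    simp only [hval i hi.le, hval k hk.le, add_right_inj] at hik
    obtain ⟨x, hx⟩ := Function.ne_iff.1 hs0
    have := congrFun hik x
    simp only [Pi.smul_apply, nsmul_eq_mul] at this
    exact_mod_cast mul_right_cancel₀ hx this
  have hcard := Finset.card_le_card_of_injOn (s := Finset.range (hfin.toFinset.card + 1))
    (t := hfin.toFinset) (fun i => stepSum y (j + e + i)) (fun i _ => by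
      rw [Finset.mem_coe, Set.Finite.mem_toFinset]
      exact ⟨e + i, by simp only [add_assoc]⟩) hinj
  rw [Finset.card_range] at hcard
  omega

end

/-! ### Records and unused steps in the coupling -/

section

variable {d : ℕ}

/-- Up to time `t` the walk reads only those entries of the second stack that it has consumed, so
what it did is independent of the rest. -/
theorem stackCount_congr {b : Site d → Bool} {y₁ y y' : ℕ → Step d} {t : ℕ}
    (h : ∀ i < t - stackCount b y₁ y t, y i = y' i) :
    ∀ s ≤ t, stackCount b y₁ y s = stackCount b y₁ y' s := by
  have hmono : ∀ s ≤ t, s - stackCount b y₁ y s ≤ t - stackCount b y₁ y t := by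
    have : Monotone fun s => s - stackCount b y₁ y s := by
      refine monotone_nat_of_le_succ fun s => ?_
      have h1 := stackCount_le b y₁ y s
      simp only [stackCount_succ]
      split_ifs <;> omega
    exact fun s hs => this hs
  intro s
  induction s with
  | zero => intro _; rfl
  | succ s ih =>
    intro hs
    have h1 := ih (by omega)
    have h2 : stackWalk b y₁ y s = stackWalk b y₁ y' s := by
      rw [stackWalk, stackWalk, ← h1]
      congr 1
      refine Finset.sum_congr rfl fun i hi => ?_
      rw [h i ((Finset.mem_range.1 hi).trans_le (hmono s (by omega)))]
    rw [stackCount_succ, stackCount_succ, h1, h2]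

/-- The unused part of the second sequence of steps is fresh. -/
theorem ae_exists_stack_tail_mem (b : Site d → Bool) (y₁ : ℕ → Step d) (R : Set ℕ)
    {γ : LocalEnv d} {W : Set (ℕ → Step d)} (hW : MeasurableSet W) (hW0 : stepLaw γ W ≠ 0) :
    ∀ᵐ y ∂(stepLaw γ),
      (∀ M, ∃ t, M ≤ t ∧ M ≤ t - stackCount b y₁ y t ∧ stackCount b y₁ y t ∈ R) →
      ∀ M, ∃ t, M ≤ t ∧ stackCount b y₁ y t ∈ R ∧ tail (t - stackCount b y₁ y t) y ∈ W := by
  have h : ∀ M, ∀ᵐ y ∂(stepLaw γ), (∀ N, ∃ c, N ≤ c ∧ y ∈ {y | ∃ t, M ≤ t ∧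
      t - stackCount b y₁ y t = c ∧ stackCount b y₁ y t ∈ R}) → ∃ c, y ∈ {y | ∃ t, M ≤ t ∧
      t - stackCount b y₁ y t = c ∧ stackCount b y₁ y t ∈ R} ∧ tail c y ∈ W := by
    intro M
    refine ae_exists_tail_mem (Q := fun c => {y | ∃ t, M ≤ t ∧
      t - stackCount b y₁ y t = c ∧ stackCount b y₁ y t ∈ R}) ?_ hW hW0
    rintro c y y' hyy ⟨t, ht, rfl, hR⟩
    have := stackCount_congr hyy t le_rfl
    exact ⟨t, ht, by rw [this], this ▸ hR⟩
  filter_upwards [ae_all_iff.2 h] with y hy hyp M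
  obtain ⟨c, ⟨t, ht, rfl, hR⟩, hc⟩ := hy M fun N => by
    obtain ⟨t, ht, ht', hR⟩ := hyp (max M N)
    exact ⟨_, (le_max_right _ _).trans ht', t, (le_max_left _ _).trans ht, rfl, hR⟩
  exact ⟨t, ht, hR, hc⟩

/-- `n` is a record time of the sequence. -/
def IsRecord (g : ℕ → ℝ) (n : ℕ) : Prop := ∀ j ≤ n, g j ≤ g n

/-- Fix the marks and the first stack. Being at a record of the first stack is then decided by the
consumed part of the second, whose remaining part is fresh and stays nonnegative with positive
probability at each trial. -/
theorem ae_coupling_record {γ γ' : LocalEnv d} {β : (Site d → unitInterval) → Site d → Bool}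
    (hβ : Measurable β) (φ ψ : Step d → ℝ) (hψ : stepLaw γ' (nonnegSet ψ) ≠ 0) :
    ∀ᵐ a ∂(coupLaw γ γ'),
      (∀ M, ∃ t, M ≤ t ∧ M ≤ t - stackCount (β a.1) a.2.1 a.2.2 t ∧
        IsRecord (partialSum φ a.2.1) (stackCount (β a.1) a.2.1 a.2.2 t)) →
      ∀ M, ∃ t, M ≤ t ∧ IsRecord (partialSum φ a.2.1) (stackCount (β a.1) a.2.1 a.2.2 t) ∧
        tail (t - stackCount (β a.1) a.2.1 a.2.2 t) a.2.2 ∈ nonnegSet ψ := by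
  have hc : ∀ t, Measurable fun a : Coupling d => stackCount (β a.1) a.2.1 a.2.2 t := fun t =>
    (measurable_stackCount (hβ.comp measurable_fst) (measurable_fst.comp measurable_snd)
      (measurable_snd.comp measurable_snd) t).1
  have hrec : ∀ t, Measurable fun a : Coupling d =>
      IsRecord (partialSum φ a.2.1) (stackCount (β a.1) a.2.1 a.2.2 t) := by
    intro t
    refine measurable_of_countable_index (g := fun n (a : Coupling d) =>
      IsRecord (partialSum φ a.2.1) n) (fun n => ?_) (hc t)
    have hp : ∀ j, Measurable fun a : Coupling d => partialSum φ a.2.1 j := fun j =>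
      (measurable_partialSum φ j).comp (measurable_fst.comp measurable_snd)
    unfold IsRecord
    refine Measurable.forall fun j => Measurable.forall fun _ => ?_
    exact measurableSet_setOfPred.1 (measurableSet_le (hp j) (hp n))
  have htail : ∀ t, Measurable fun a : Coupling d =>
      tail (t - stackCount (β a.1) a.2.1 a.2.2 t) a.2.2 ∈ nonnegSet ψ := by
    intro t
    refine measurable_of_countable_index (g := fun n (a : Coupling d) =>
      tail (t - n) a.2.2 ∈ nonnegSet ψ) (fun n => ?_) (hc t)
    exact measurableSet_setOfPred.1 (((measurable_tail _).comp
      (measurable_snd.comp measurable_snd)) (measurableSet_nonnegSet ψ))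
  have hM : ∀ M t, Measurable fun a : Coupling d => M ≤ t - stackCount (β a.1) a.2.1 a.2.2 t :=
    fun M t => measurableSet_setOfPred.1
      (measurableSet_le measurable_const (measurable_const.sub (hc t)))
  have hmeas : Measurable fun a : Coupling d =>
      (∀ M, ∃ t, M ≤ t ∧ M ≤ t - stackCount (β a.1) a.2.1 a.2.2 t ∧
        IsRecord (partialSum φ a.2.1) (stackCount (β a.1) a.2.1 a.2.2 t)) →
      ∀ M, ∃ t, M ≤ t ∧ IsRecord (partialSum φ a.2.1) (stackCount (β a.1) a.2.1 a.2.2 t) ∧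
        tail (t - stackCount (β a.1) a.2.1 a.2.2 t) a.2.2 ∈ nonnegSet ψ := by
    refine Measurable.imp ?_ ?_
    · exact Measurable.forall fun M => Measurable.exists fun t =>
        measurable_const.and ((hM M t).and (hrec t))
    · exact Measurable.forall fun M => Measurable.exists fun t =>
        measurable_const.and ((hrec t).and (htail t))
  rw [Measure.ae_prod_iff_ae_ae (measurableSet_setOfPred.2 hmeas)]
  refine ae_of_all _ fun u => ?_
  refine (Measure.ae_prod_iff_ae_ae (measurableSet_setOfPred.2
    (hmeas.comp (measurable_prodMk_left (x := u))))).2 (ae_of_all _ fun y₁ => ?_)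
  exact ae_exists_stack_tail_mem (β u) y₁ {n | IsRecord (partialSum φ y₁) n}
    (measurableSet_nonnegSet ψ) hψ

/-- Infinitely many sites cannot all have their marks in a set which is not of full measure. -/
theorem markLaw_forall_mem_eq_zero {z : ℕ → Site d} (hz : (Set.range z).Infinite)
    {A : Set unitInterval} (hA : MeasurableSet A) (hA1 : (volume : Measure unitInterval) A < 1) :
    markLaw d {u | ∀ k, u (z k) ∈ A} = 0 := by
  have hle : ∀ n : ℕ, markLaw d {u | ∀ k, u (z k) ∈ A} ≤ (volume : Measure unitInterval) A ^ n := by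
    intro n
    obtain ⟨T, hT, hTn⟩ := hz.exists_subset_card_eq n
    calc markLaw d {u | ∀ k, u (z k) ∈ A} ≤ markLaw d (Set.pi (T : Set (Site d)) fun _ => A) := by
          refine measure_mono fun u hu x hx => ?_
          obtain ⟨k, rfl⟩ := hT hx
          exact hu k
      _ = (volume : Measure unitInterval) A ^ n := by
          rw [Measure.infinitePi_pi _ fun _ _ => hA, Finset.prod_const, hTn]
  exact le_antisymm (ge_of_tendsto' (ENNReal.tendsto_pow_atTop_nhds_zero_of_lt_one hA1) hle)
    zero_le

/-- The walk uses infinitely many steps of the first kind, unless there are no such sites. -/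
theorem ae_coupling_count_unbounded {γ γ' : LocalEnv d} {A : Set unitInterval}
    (hA : MeasurableSet A) (hA1 : (volume : Measure unitInterval) Aᶜ < 1)
    {β : (Site d → unitInterval) → Site d → Bool} (hβ : ∀ u x, β u x = true ↔ u x ∈ A) :
    ∀ᵐ a ∂(coupLaw γ γ'), ∀ M, ∃ t, M ≤ stackCount (β a.1) a.2.1 a.2.2 t := by
  -- If the count stopped at `c`, the walk would follow a translated tail of the second stack while
  -- avoiding sites marked in `A`. For fixed stacks this path meets infinitely many sites with
  -- independent marks, so the event is null.
  have hnull : ∀ᵐ a ∂(coupLaw γ γ'), ∀ c j : ℕ,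
      ¬ ∀ k, a.1 (stepSum a.2.1 c + stepSum a.2.2 (j + k)) ∈ Aᶜ := by
    refine ae_all_iff.2 fun c => ae_all_iff.2 fun j => ?_
    have hm : Measurable fun a : Coupling d =>
        ¬ ∀ k, a.1 (stepSum a.2.1 c + stepSum a.2.2 (j + k)) ∈ Aᶜ := by
      refine Measurable.not (Measurable.forall fun k => ?_)
      have h1 : Measurable fun a : Coupling d => stepSum a.2.1 c + stepSum a.2.2 (j + k) :=
        ((measurable_stepSum c).comp (measurable_fst.comp measurable_snd)).add
          ((measurable_stepSum (j + k)).comp (measurable_snd.comp measurable_snd))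
      have h2 : Measurable fun a : Coupling d =>
          a.1 (stepSum a.2.1 c + stepSum a.2.2 (j + k)) :=
        measurable_of_countable_index (g := fun x (a : Coupling d) => a.1 x)
          (fun x => (measurable_pi_apply x).comp measurable_fst) h1
      exact measurableSet_setOfPred.1 (h2 hA.compl)
    rw [Measure.ae_prod_iff_ae_ae (measurableSet_setOfPred.2 hm), Measure.ae_ae_comm
      (measurableSet_setOfPred.2 hm)]
    filter_upwards [Measure.quasiMeasurePreserving_snd.ae (ae_infinite_range_stepSum γ')] with q hq
    rw [ae_iff]
    simp only [not_not]
    refine markLaw_forall_mem_eq_zero (z := fun k => stepSum q.1 c + stepSum q.2 (j + k)) ?_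
      hA.compl hA1
    have h3 := (hq j).image (f := fun x => stepSum q.1 c + x) (add_right_injective _).injOn
    rwa [← Set.range_comp] at h3
  filter_upwards [hnull] with a ha
  set N := stackCount (β a.1) a.2.1 a.2.2 with hN
  by_contra hcon
  push Not at hcon
  obtain ⟨M, hM⟩ := hcon
  have hmono : Monotone N := monotone_nat_of_le_succ fun n => by
    rw [hN, stackCount_succ]; exact Nat.le_add_right _ _
  obtain ⟨t, ht⟩ : ∃ t, ∀ s, t ≤ s → N s = N t := by
    classical
    have hb : ∃ c, ∀ s, N s ≤ c := ⟨M, fun s => (hM s).le⟩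
    have hne : ∃ t, N t = Nat.find hb := by
      by_contra hno
      push Not at hno
      have hlt : ∀ s, N s < Nat.find hb := fun s => lt_of_le_of_ne (Nat.find_spec hb s) (hno s)
      have hpos : 0 < Nat.find hb := (Nat.zero_le _).trans_lt (hlt 0)
      exact Nat.find_min hb (Nat.sub_lt hpos one_pos) fun s => by have := hlt s; omega
    obtain ⟨t, ht⟩ := hne
    exact ⟨t, fun s hs => le_antisymm (ht ▸ Nat.find_spec hb s) (hmono hs)⟩
  have hle : N t ≤ t := stackCount_le (β a.1) a.2.1 a.2.2 t
  refine ha (N t) (t - N t) fun k hk => ?_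
  have h1 := stackCount_succ (β a.1) a.2.1 a.2.2 (t + k)
  rw [← hN, ht (t + k + 1) (by omega), ht (t + k) (by omega)] at h1
  have h2 : stackWalk (β a.1) a.2.1 a.2.2 (t + k) =
      stepSum a.2.1 (N t) + stepSum a.2.2 (t - N t + k) := by
    rw [stackWalk, ← hN, ht (t + k) (by omega), show t + k - N t = t - N t + k by omega]
  rw [h2, if_pos ((hβ _ _).2 hk)] at h1
  omega

theorem stackCount_swap (b : Site d → Bool) (y₁ y₂ : ℕ → Step d) (n : ℕ) :
    stackCount (fun x => !b x) y₂ y₁ n = n - stackCount b y₁ y₂ n := by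
  induction n with
  | zero => rfl
  | succ n ih =>
    have h := stackCount_le b y₁ y₂ n
    have hw : stackWalk (fun x => !b x) y₂ y₁ n = stackWalk b y₁ y₂ n := by
      rw [stackWalk, stackWalk, ih, Nat.sub_sub_self h, add_comm]
    rw [stackCount_succ, stackCount_succ, ih, hw]
    cases b (stackWalk b y₁ y₂ n) <;> simp; omega

/-- Exchange of the two sequences of steps. -/
theorem quasiMeasurePreserving_swap (γ γ' : LocalEnv d) :
    Measure.QuasiMeasurePreserving (fun a : Coupling d => ((a.1, a.2.2, a.2.1) : Coupling d))
      (coupLaw γ γ') (coupLaw γ' γ) :=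
  ((MeasurePreserving.id (markLaw d)).prod
    (Measure.measurePreserving_swap (μ := stepLaw γ) (ν := stepLaw γ'))).quasiMeasurePreserving

end

/-! ### Order of a coordinate infinitely often -/

section

variable {d : ℕ}

theorem monotone_stackCount (b : Site d → Bool) (y₁ y₂ : ℕ → Step d) :
    Monotone (stackCount b y₁ y₂) := monotone_nat_of_le_succ fun n => by
  rw [stackCount_succ]; exact Nat.le_add_right _ _

theorem monotone_sub_stackCount (b : Site d → Bool) (y₁ y₂ : ℕ → Step d) :
    Monotone fun n => n - stackCount b y₁ y₂ n := by
  simp only [← stackCount_swap]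
  exact monotone_stackCount _ _ _

/-- The count increases by at most 1 per step and is unbounded, so it takes every value. Choose a
record index larger than the count at a time when the second stack has been used often enough; the
count reaches that index only later. -/
theorem exists_record {b : Site d → Bool} {y₁ y₂ : ℕ → Step d} {g : ℕ → ℝ}
    (hg : Tendsto g atTop atTop) (h1 : ∀ M, ∃ t, M ≤ stackCount b y₁ y₂ t)
    (h2 : ∀ M, ∃ t, M ≤ t - stackCount b y₁ y₂ t) (M : ℕ) :
    ∃ t, M ≤ t ∧ M ≤ t - stackCount b y₁ y₂ t ∧ IsRecord g (stackCount b y₁ y₂ t) := by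
  classical
  obtain ⟨t₀, ht₀⟩ := h2 M
  obtain ⟨r, hr, hrec⟩ := frequently_atTop.1 (frequently_high_scores hg)
    (max M (stackCount b y₁ y₂ t₀ + 1))
  have hM : M ≤ r := (le_max_left _ _).trans hr
  have hr0 : stackCount b y₁ y₂ t₀ + 1 ≤ r := (le_max_right _ _).trans hr
  have hex := h1 r
  set t := Nat.find hex with ht
  have hrt : r ≤ stackCount b y₁ y₂ t := Nat.find_spec hex
  have heq : stackCount b y₁ y₂ t = r := by
    refine le_antisymm ?_ hrt
    rcases Nat.eq_zero_or_pos t with hz | hz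
    · rw [hz]; exact Nat.zero_le _
    · have h3 := Nat.find_min hex (Nat.sub_lt hz one_pos)
      have h4 := stackCount_succ b y₁ y₂ (t - 1)
      rw [show t - 1 + 1 = t by omega] at h4
      change ¬ r ≤ stackCount b y₁ y₂ (t - 1) at h3
      split_ifs at h4 <;> omega
  have htt : t₀ ≤ t := by
    by_contra hlt
    have := monotone_stackCount b y₁ y₂ (show t ≤ t₀ by omega)
    omega
  refine ⟨t, ?_, ht₀.trans (monotone_sub_stackCount b y₁ y₂ htt), ?_⟩
  · have := stackCount_le b y₁ y₂ t
    omega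
  · rw [heq]
    intro j hj
    rcases hj.lt_or_eq with h | h
    · exact (hrec j h).le
    · rw [h]

theorem tendsto_sub_mul_atTop {f : ℕ → ℝ} {u c : ℝ} (hu : c < u)
    (hf : Tendsto (fun n : ℕ => f n / n) atTop (𝓝 u)) :
    Tendsto (fun n : ℕ => f n - c * n) atTop atTop := by
  have h1 : Tendsto (fun n : ℕ => f n / n - c) atTop (𝓝 (u - c)) := hf.sub_const c
  refine (h1.pos_mul_atTop (sub_pos.2 hu) tendsto_natCast_atTop_atTop).congr' ?_
  filter_upwards [eventually_gt_atTop 0] with n hn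
  have : (n : ℝ) ≠ 0 := by positivity
  field_simp

theorem exists_forall_lt_le (g : ℕ → ℝ) (B : ℕ) : ∃ C, ∀ k < B, g k ≤ C := by
  obtain ⟨C, hC⟩ := ((Finset.range B).image g).exists_le
  exact ⟨C, fun k hk => hC _ (Finset.mem_image_of_mem g (Finset.mem_range.2 hk))⟩

/-- Comparison of two walks using the same sequences of steps. -/
theorem frequently_le_of_counts {φ ψ : ℕ → ℝ} {N N' : ℕ → ℕ} (hφ : Tendsto φ atTop atTop)
    (hψ : Tendsto ψ atTop atTop) (hN : ∀ n, N n ≤ N' n)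
    (hA : (∀ M, ∃ t, M ≤ t - N' t) →
      ∀ M, ∃ t, M ≤ t ∧ IsRecord φ (N' t) ∧ ∀ k, ψ (t - N' t) ≤ ψ (t - N' t + k))
    (hB : (∀ M, ∃ t, M ≤ N t) →
      ∀ M, ∃ t, M ≤ t ∧ IsRecord ψ (t - N t) ∧ ∀ k, φ (N t) ≤ φ (N t + k))
    (hle : ∀ n, N' n ≤ n) :
    ∃ᶠ n in atTop, 0 ≤ (φ (N' n) - φ (N n)) + (ψ (n - N n) - ψ (n - N' n)) := by
  by_cases h1 : ∀ M, ∃ t, M ≤ t - N' t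
  · refine frequently_atTop.2 fun M => ?_
    obtain ⟨t, ht, hrec, hfut⟩ := hA h1 M
    have h3 := hrec _ (hN t)
    have h4 := hfut (N' t - N t)
    rw [show t - N' t + (N' t - N t) = t - N t by have := hN t; have := hle t; omega] at h4
    exact ⟨t, ht, by linarith⟩
  by_cases h2 : ∀ M, ∃ t, M ≤ N t
  · refine frequently_atTop.2 fun M => ?_
    obtain ⟨t, ht, hrec, hfut⟩ := hB h2 M
    have h3 := hrec _ (Nat.sub_le_sub_left (hN t) t)
    have h4 := hfut (N' t - N t)
    rw [show N t + (N' t - N t) = N' t by have := hN t; omega] at h4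
    exact ⟨t, ht, by linarith⟩
  -- One walk eventually uses only the first stack and the other only the second, so the divergence
  -- of both sums decides.
  push Not at h1 h2
  obtain ⟨B₁, hB₁⟩ := h1
  obtain ⟨B₂, hB₂⟩ := h2
  obtain ⟨C₁, hC₁⟩ := exists_forall_lt_le ψ B₁
  obtain ⟨C₂, hC₂⟩ := exists_forall_lt_le φ B₂
  have hN' : Tendsto N' atTop atTop :=
    tendsto_atTop_mono (fun n => by have := hB₁ n; omega) (tendsto_sub_atTop_nat B₁)
  have hNc : Tendsto (fun n => n - N n) atTop atTop :=
    tendsto_atTop_mono (fun n => by have := hB₂ n; omega) (tendsto_sub_atTop_nat B₂)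
  refine Eventually.frequently ?_
  filter_upwards [(hφ.comp hN').eventually_ge_atTop C₂, (hψ.comp hNc).eventually_ge_atTop C₁]
    with n h3 h4
  have h5 := hC₁ _ (hB₁ n)
  have h6 := hC₂ _ (hB₂ n)
  simp only [Function.comp] at h3 h4
  linarith

/-- The coordinate in which the drifts are ordered is ordered infinitely often. -/
theorem ae_frequently_coupWalk_le {γ₁ γ₂ : LocalEnv d} {p p' : unitInterval} (hp : p < p')
    {i : Fin d} (hi : drift γ₂ i < drift γ₁ i) :
    ∀ᵐ a ∂(coupLaw γ₁ γ₂), ∃ᶠ n in atTop, coupWalk p a n i ≤ coupWalk p' a n i := by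
  -- Recentring by a value strictly between the drifts makes both partial sums tend to infinity. The
  -- terms in `c` cancel in the difference of the walks, since the surplus of first steps equals the
  -- deficit of second steps.
  set c := (drift γ₁ i + drift γ₂ i) / 2 with hc
  have hc1 : c < drift γ₁ i := by rw [hc]; linarith
  have hc2 : drift γ₂ i < c := by rw [hc]; linarith
  set φ : Step d → ℝ := fun s => ((s : Site d) i : ℝ) - c with hφ
  set ψ : Step d → ℝ := fun s => c - ((s : Site d) i : ℝ) with hψ
  have hφs : ∀ y n, partialSum φ y n = (stepSum y n i : ℝ) - c * n := by
    intro y n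
    simp [partialSum, hφ, stepSum, Finset.sum_apply, mul_comm]
  have hψs : ∀ y n, partialSum ψ y n = c * n - (stepSum y n i : ℝ) := by
    intro y n
    simp [partialSum, hψ, stepSum, Finset.sum_apply, mul_comm]
  have hφt : ∀ y : ℕ → Step d, (∀ i, Tendsto (fun n : ℕ => (stepSum y n i : ℝ) / n) atTop
      (𝓝 (drift γ₁ i))) → Tendsto (partialSum φ y) atTop atTop := by
    intro y hy
    exact (tendsto_sub_mul_atTop hc1 (hy i)).congr fun n => (hφs y n).symm
  have hψt : ∀ y : ℕ → Step d, (∀ i, Tendsto (fun n : ℕ => (stepSum y n i : ℝ) / n) atTop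
      (𝓝 (drift γ₂ i))) → Tendsto (partialSum ψ y) atTop atTop := by
    intro y hy
    have h1 : Tendsto (fun n : ℕ => (-(stepSum y n i : ℝ)) / n) atTop (𝓝 (-drift γ₂ i)) := by
      simpa only [neg_div] using (hy i).neg
    refine (tendsto_sub_mul_atTop (neg_lt_neg hc2) h1).congr fun n => ?_
    rw [hψs]; ring
  have hφ0 : stepLaw γ₁ (nonnegSet φ) ≠ 0 :=
    stepLaw_nonnegSet_ne_zero ((ae_tendsto_stepSum γ₁).mono hφt)
  have hψ0 : stepLaw γ₂ (nonnegSet ψ) ≠ 0 :=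
    stepLaw_nonnegSet_ne_zero ((ae_tendsto_stepSum γ₂).mono hψt)
  have hβ : Measurable fun (u : Site d → unitInterval) x => !markType p u x :=
    measurable_pi_lambda _ fun x => (measurable_of_countable fun b : Bool => !b).comp
      ((measurable_pi_apply x).comp (measurable_markType p))
  have hA := ae_coupling_record (γ := γ₁) (γ' := γ₂) (measurable_markType p') φ ψ hψ0
  have hB := (quasiMeasurePreserving_swap γ₁ γ₂).ae
    (ae_coupling_record (γ := γ₂) (γ' := γ₁) hβ ψ φ hφ0)
  -- The strict inequality `p < p'` gives `p' > 0` here and `p < 1` in the mirror statement: the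
  -- walk at `p'` uses its first stack forever, the walk at `p` its second.
  have hU := ae_coupling_count_unbounded (γ := γ₁) (γ' := γ₂) (A := Set.Iic p') measurableSet_Iic
    (by
      rw [Set.compl_Iic, unitInterval.volume_Ioi, ENNReal.ofReal_lt_one]
      have : (0 : ℝ) < p' := p.2.1.trans_lt hp
      linarith) (β := markType p') fun u x => markType_iff
  have hV := (quasiMeasurePreserving_swap γ₁ γ₂).ae
    (ae_coupling_count_unbounded (γ := γ₂) (γ' := γ₁) (A := (Set.Iic p)ᶜ) measurableSet_Iic.compl
    (by
      rw [compl_compl, unitInterval.volume_Iic, ENNReal.ofReal_lt_one]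
      exact lt_of_lt_of_le hp p'.2.2) (β := fun u x => !markType p u x) fun u x => by
        rw [Set.mem_compl_iff, Set.mem_Iic, ← markType_iff (p := p), Bool.not_eq_true,
          Bool.not_eq_true'])
  filter_upwards [ae_coupling_steps γ₁ γ₂, hA, hB, hU, hV] with a hs hA hB hU hV
  simp only [stackCount_swap] at hB hV
  have hsub : ∀ t, t - (t - coupCount p a t) = coupCount p a t := fun t =>
    Nat.sub_sub_self (stackCount_le _ _ _ t)
  have hfreq := frequently_le_of_counts (φ := partialSum φ a.2.1) (ψ := partialSum ψ a.2.2)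
    (N := coupCount p a) (N' := coupCount p' a) (hφt _ hs.1) (hψt _ hs.2)
    (coupCount_mono hp.le a) (fun h M => ?_) (fun h M => ?_) fun n => stackCount_le _ _ _ n
  · refine hfreq.mono fun n hn => ?_
    have h1 : (coupWalk p a n i : ℝ) ≤ coupWalk p' a n i := by
      simp only [hφs, hψs] at hn
      have hle : ∀ q, coupCount q a n ≤ n := fun q => stackCount_le _ _ _ n
      rw [Nat.cast_sub (hle p), Nat.cast_sub (hle p')] at hn
      simp only [coupWalk, stackWalk, Pi.add_apply, Int.cast_add]
      simp only [coupCount] at hn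
      linarith
    exact_mod_cast h1
  · obtain ⟨t, ht, hrec, htail⟩ := hA (exists_record (hφt _ hs.1) hU h) M
    refine ⟨t, ht, hrec, fun k => ?_⟩
    rw [partialSum_add]
    exact le_add_of_nonneg_right (htail k)
  · have hrec' := exists_record (b := fun x => !markType p a.1 x) (y₁ := a.2.2) (y₂ := a.2.1)
      (hψt _ hs.2) (by simpa only [stackCount_swap] using hV) (by
        simp only [stackCount_swap]
        intro M
        obtain ⟨t, ht⟩ := h M
        exact ⟨t, by rw [← hsub t] at ht; exact ht⟩)
    simp only [stackCount_swap] at hrec'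
    obtain ⟨t, ht, hrec, htail⟩ := hB hrec' M
    have htail' : tail (t - (t - coupCount p a t)) a.2.1 ∈ nonnegSet φ := htail
    rw [hsub] at htail'
    refine ⟨t, ht, hrec, fun k => ?_⟩
    rw [partialSum_add]
    exact le_add_of_nonneg_right (htail' k)

end

end RWRE

end

/-! ### The coupling theorem and monotone deterministic speeds -/

open RWRE in
theorem mainTheorem1 (d : ℕ) (hd : 2 ≤ d) (γ₁ γ₂ : LocalEnv d) (hγ : γ₁ ≠ γ₂) :
    -- a coupling of the walks (and of their environments) for all values of `p`
    (∃ (Ω : Type) (_ : MeasurableSpace Ω) (P : Measure Ω) (_ : IsProbabilityMeasure P)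
        (ω : unitInterval → Ω → Env d) (X : unitInterval → Ω → ℕ → Site d)
        (V : unitInterval → Ω → Fin d → ℝ),
      (∀ p, IsRWRE γ₁ γ₂ p P (ω p) (X p)) ∧
      -- the (possibly random) limiting velocities exist
      (∀ p, ∀ᵐ a ∂P, HasVelocity (X p a) (V p a)) ∧
      ∀ p p' : unitInterval, p < p' →
        -- the number of visits to `γ₁`-sites is monotone in `p`
        (∀ᵐ a ∂P, ∀ n, visits γ₁ (ω p a) (X p a) n ≤ visits γ₁ (ω p' a) (X p' a) n) ∧
        -- pathwise monotonicity along directions available only in `γ₁`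
        (∀ e : Site d, e ∈ directions γ₁ → e ∉ directions γ₂ → -e ∉ directions γ₁ →
          ∀ᵐ a ∂P, ∀ n, X p a n ⬝ᵥ e ≤ X p' a n ⬝ᵥ e) ∧
        -- the first coordinates are ordered infinitely often
        (drift γ₂ ⟨0, by omega⟩ < drift γ₁ ⟨0, by omega⟩ →
          ∀ᵐ a ∂P, ∃ᶠ n in atTop, X p a n ⟨0, by omega⟩ ≤ X p' a n ⟨0, by omega⟩) ∧
        -- the limiting velocities are ordered
        (∀ u : Fin d → ℝ, u ≠ 0 →
          (0 ≤ (drift γ₁ - drift γ₂) ⬝ᵥ u → ∀ᵐ a ∂P, V p a ⬝ᵥ u ≤ V p' a ⬝ᵥ u) ∧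
          ((drift γ₁ - drift γ₂) ⬝ᵥ u ≤ 0 → ∀ᵐ a ∂P, V p' a ⬝ᵥ u ≤ V p a ⬝ᵥ u))) ∧
    -- monotonicity of deterministic speeds
    (∀ (S : Set unitInterval) (v : unitInterval → Fin d → ℝ),
      (∀ p ∈ S, ∀ᵐ z ∂(annealedLaw γ₁ γ₂ p), HasVelocity z.2 (v p)) →
      ∀ i : Fin d, MonotoneOn (fun p => v p i) S ∨ AntitoneOn (fun p => v p i) S) := by
  refine ⟨⟨Coupling d, inferInstance, coupLaw γ₁ γ₂, inferInstance, coupEnv γ₁ γ₂, coupWalk,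
    coupVelocity, isRWRE_coupling γ₁ γ₂, ae_hasVelocity_coupVelocity γ₁ γ₂,
    fun p p' hp => ⟨?_, fun e h1 h2 h3 => ae_coupWalk_dotProduct_le hp.le h1 h2 h3,
      fun hi => ae_frequently_coupWalk_le hp hi, fun u _ => ⟨fun hu => ae_coupVelocity_le hp.le hu,
        fun hu => ?_⟩⟩⟩,
    fun S v hv i => monotoneOn_or_antitoneOn_velocity hv i⟩
  · refine MeasureTheory.ae_of_all _ fun a n => ?_
    rw [visits_coupling hγ, visits_coupling hγ]
    exact coupCount_mono hp.le a n
  · have h := ae_coupVelocity_le (γ₁ := γ₁) (γ₂ := γ₂) hp.le (u := -u) (by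
      rw [dotProduct_neg]; exact neg_nonneg.2 hu)
    filter_upwards [h] with a ha
    simpa only [dotProduct_neg, neg_le_neg_iff] using ha
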